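/- **Proposition 5.1.** Let $F_0$ be a complete discretely valued field with ring of integers $O_{F_0}$, uniformizer $\pi_0$ and perfect residue field of characteristic $\neq 2$. Let $F/F_0$ be a ramified quadratic extension with ring of integers $O_F$ and a uniformizer $\pi$ with $\pi^2=\pi_0$. Let $V$ be an $F$-vector space of dimension $n=2m>3$ with an $F/F_0$-hermitian form $\phi$ and a basis $e_1,\dots,e_n$ such that $\phi(e_i,e_{n+1-j})=\delta_{ij}$. Put $(x,y)=\tfrac12\mathrm{Tr}_{F/F_0}\,\phi(x,y)$ and $$\Lambda_m=\mathrm{span}_{O_F}\{\pi^{-1}e_1,\dots,\pi^{-1}e_m,e_{m+1},\dots,e_n\},$$ on which $(\,,)$ takes values in $O_{F_0}$, and let $t$ be the $O_{F_0}$-linear endomorphism of $\Lambda_m$ given by multiplication by $\pi$. Let $(r,s)$ be a signature with $r+s=n$ and $r,s\ge 1$. Consider the functor whose points over an $O_F$-scheme $S$ are the pairs $(\mathcal F_0,\mathcal F_1)$ of Zariski locally $\mathcal O_S$-direct summands of $\Lambda_m\otimes_{O_{F_0}}\mathcal O_S$, of ranks $s$ and $n$ respectively, such that 1. $0\subset\mathcal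 F_0\subset\mathcal F_1\subset\Lambda_m\otimes\mathcal O_S$; 2. $\mathcal F_1$ is totally isotropic for $(\,,)\otimes\mathcal O_S$; 3. $(t+\pi)\mathcal F_1\subset\mathcal F_0$; 4. $(t-\pi)\mathcal F_0=(0)$. This functor is represented by an $O_F$-scheme $\mathcal M$, the naive splitting (or Krämer) model, and $\mathcal M$ is not flat over $\mathrm{Spec}\,O_F$. Moreover, some point of the special fibre of $\mathcal M$ has an affine open neighbourhood in $\mathcal M$ whose generic fibre is empty. -/

import Mathlib

open CategoryTheory AlgebraicGeometry TensorProduct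

universe u

set_option linter.unusedSectionVars false

namespace NaiveSplitting

/-! ### Nested pairs of submodules, as a functor on algebras -/

section Functor

variable {R : Type u} [CommRing R] {L : Type u} [AddCommGroup L] [Module R L]

/-- The base change of a point `N` of the Grassmannian along `f : A → B` is spanned by the image
of `N` in `B ⊗ L`. -/
theorem map_eq_span {k : ℕ} {A B : Type u} [CommRing A] [Algebra R A] [CommRing B] [Algebra R B]
    (f : A →ₐ[R] B) (N : Module.Grassmannian A (A ⊗[R] L) k) :
    (N.map f).toSubmodule = Submodule.span B
      (TensorProduct.map f.toLinearMap (LinearMap.id : L →ₗ[R] L) '' (N.toSubmodule : Set _)) := by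
  let : Algebra A B := f.toAlgebra
  have : IsScalarTower R A B :=
    IsScalarTower.of_algebraMap_eq' <| IsScalarTower.algebraMap_eq R A B
  rw [Module.Grassmannian.map_toSubmodule]
  change (Module.Grassmannian.baseChangeMkQ B N.toSubmodule).ker = _
  have hmap : ∀ z : A ⊗[R] L, TensorProduct.map f.toLinearMap (LinearMap.id : L →ₗ[R] L) z =
      AlgebraTensorModule.cancelBaseChange R A B B L (1 ⊗ₜ[A] z) := by
    intro z
    induction z using TensorProduct.induction_on with
    | zero => simp
    | tmul a l =>
      simp only [TensorProduct.map_tmul, AlgebraTensorModule.cancelBaseChange_tmul]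
      simp [Algebra.smul_def, RingHom.algebraMap_toAlgebra]
    | add x y hx hy => rw [map_add, hx, hy, TensorProduct.tmul_add, map_add]
  have hex₀ : Function.Exact N.toSubmodule.subtype N.toSubmodule.mkQ :=
    LinearMap.exact_subtype_mkQ N.toSubmodule
  have hex := @lTensor_exact A N.toSubmodule _ _ _ _ _ _ _ _ _ N.toSubmodule.subtype
    N.toSubmodule.mkQ B _ _ hex₀
    (Submodule.mkQ_surjective N.toSubmodule)
  apply le_antisymm
  · intro x hx
    obtain ⟨y, rfl⟩ := (AlgebraTensorModule.cancelBaseChange R A B B L).surjective x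
    have hy : LinearMap.lTensor B N.toSubmodule.mkQ y = 0 := by
      simpa [Module.Grassmannian.baseChangeMkQ, LinearMap.baseChange_eq_ltensor] using hx
    obtain ⟨w, rfl⟩ := (hex y).1 hy
    clear hx hy
    induction w using TensorProduct.induction_on with
    | zero => simp
    | tmul b v =>
      have : LinearMap.lTensor B N.toSubmodule.subtype (b ⊗ₜ[A] v) = b • (1 ⊗ₜ[A] (v : A ⊗[R] L)) := by
        simp [TensorProduct.smul_tmul']
      rw [this, map_smul, ← hmap]
      exact Submodule.smul_mem _ _ (Submodule.subset_span ⟨v, v.2, rfl⟩)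
    | add x y hx hy => rw [map_add, map_add]; exact Submodule.add_mem _ hx hy
  · rw [Submodule.span_le]
    rintro _ ⟨z, hz, rfl⟩
    have : N.toSubmodule.mkQ z = 0 := by simpa using hz
    simp [hmap, Module.Grassmannian.baseChangeMkQ, this]

variable (ϖ : R) (t : L →ₗ[R] L) (β : LinearMap.BilinForm R L)

/-- The conditions on a pair `𝓕₀`, `𝓕₁` of submodules of `A ⊗ L`:
`𝓕₀ ⊆ 𝓕₁`, `𝓕₁` is totally isotropic, `(t + ϖ) 𝓕₁ ⊆ 𝓕₀` and `(t - ϖ) 𝓕₀ = 0`. -/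
structure IsSplitPair {A : Type u} [CommRing A] [Algebra R A]
    (F₀ F₁ : Submodule A (A ⊗[R] L)) : Prop where
  le : F₀ ≤ F₁
  isotropic : ∀ x ∈ F₁, ∀ y ∈ F₁, β.baseChange A x y = 0
  add_mem : ∀ x ∈ F₁, t.baseChange A x + ϖ • x ∈ F₀
  apply_sub_eq_zero : ∀ x ∈ F₀, t.baseChange A x - ϖ • x = 0

variable {ϖ t β} in
theorem IsSplitPair.map {k₀ k₁ : ℕ} {A B : Type u} [CommRing A] [Algebra R A] [CommRing B]
    [Algebra R B] (f : A →ₐ[R] B) {N₀ : Module.Grassmannian A (A ⊗[R] L) k₀}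
    {N₁ : Module.Grassmannian A (A ⊗[R] L) k₁}
    (h : IsSplitPair ϖ t β N₀.toSubmodule N₁.toSubmodule) :
    IsSplitPair ϖ t β (N₀.map f).toSubmodule (N₁.map f).toSubmodule := by
  rw [map_eq_span, map_eq_span]
  set g := TensorProduct.map f.toLinearMap (LinearMap.id : L →ₗ[R] L) with hg
  have ht : ∀ z, t.baseChange B (g z) = g (t.baseChange A z) := by
    intro z
    induction z using TensorProduct.induction_on with
    | zero => simp
    | tmul a l => simp [hg]
    | add x y hx hy => simp only [map_add, hx, hy]
  have hβ : ∀ z w, β.baseChange B (g z) (g w) = f (β.baseChange A z w) := by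
    intro z w
    induction z using TensorProduct.induction_on with
    | zero => simp
    | tmul a l =>
      induction w using TensorProduct.induction_on with
      | zero => simp
      | tmul b l' => simp [hg]
      | add x y hx hy => simp only [map_add, hx, hy]
    | add x y hx hy => simp only [map_add, LinearMap.add_apply, hx, hy]
  have hspan : ∀ (N : Submodule A (A ⊗[R] L)) (P : B ⊗[R] L → Prop),
      (∀ z ∈ N, P (g z)) → P 0 → (∀ x y, P x → P y → P (x + y)) →
      (∀ (b : B) x, P x → P (b • x)) → ∀ x ∈ Submodule.span B (g '' (N : Set _)), P x := by
    intro N P h1 h2 h3 h4 x hx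
    induction hx using Submodule.span_induction with
    | mem x hx => obtain ⟨z, hz, rfl⟩ := hx; exact h1 z hz
    | zero => exact h2
    | add x y _ _ hx hy => exact h3 x y hx hy
    | smul b x _ hx => exact h4 b x hx
  refine ⟨Submodule.span_mono (Set.image_mono h.le), ?_, ?_, ?_⟩
  · intro x hx y hy
    refine hspan _ (fun x => β.baseChange B x y = 0) (fun z hz => ?_) (by simp)
      (fun a b ha hb => by simp [ha, hb]) (fun b x hx => by simp [hx]) x hx
    refine hspan _ (fun y => β.baseChange B (g z) y = 0) (fun w hw => ?_) (by simp)
      (fun a b ha hb => by simp [ha, hb]) (fun b x hx => by simp [hx]) y hy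
    rw [hβ, h.isotropic z hz w hw, map_zero]
  · refine hspan _ _ (fun z hz => ?_) (by simp) (fun a b ha hb => ?_) (fun b x hx => ?_)
    · rw [ht, ← map_smul, ← map_add]
      exact Submodule.subset_span ⟨_, h.add_mem z hz, rfl⟩
    · rw [map_add, smul_add, add_add_add_comm]
      exact Submodule.add_mem _ ha hb
    · rw [map_smul, smul_comm, ← smul_add]
      exact Submodule.smul_mem _ _ hx
  · refine hspan _ (fun x => t.baseChange B x - ϖ • x = 0) (fun z hz => ?_) (by simp)
      (fun a b ha hb => ?_) (fun b x hx => ?_)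
    · rw [ht, ← map_smul, ← map_sub, h.apply_sub_eq_zero z hz, map_zero]
    · rw [map_add, smul_add, add_sub_add_comm, ha, hb, add_zero]
    · rw [sub_eq_zero] at hx ⊢
      rw [map_smul, hx, smul_comm]

/-- The functor sending an `R`-algebra `A` to the set of pairs `𝓕₀ ⊆ 𝓕₁ ⊆ A ⊗ L` of Zariski locally
direct summands, of ranks `s` and `n`, satisfying `IsSplitPair`. Here `L` is meant to be free of
rank `2 * n`, and a submodule is a locally direct summand of rank `k` exactly when its quotient is
locally free of rank `2 * n - k`; the latter is how points of `Module.Grassmannian` are given. -/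
noncomputable def splitPairFunctor (n s : ℕ) : CommAlgCat.{u} R ⥤ Type u where
  obj A := {N : Module.Grassmannian A (A ⊗[R] L) (2 * n - s) ×
      Module.Grassmannian A (A ⊗[R] L) n //
      IsSplitPair ϖ t β N.1.toSubmodule N.2.toSubmodule}
  map f := TypeCat.ofHom fun N => ⟨(N.1.1.map f.hom, N.1.2.map f.hom), N.2.map f.hom⟩
  map_id A := by
    refine ConcreteCategory.hom_ext _ _ fun N => Subtype.ext (Prod.ext ?_ ?_)
    · exact Module.Grassmannian.map_id _ A N.1.1
    · exact Module.Grassmannian.map_id _ A N.1.2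
  map_comp f g := by
    refine ConcreteCategory.hom_ext _ _ fun N => Subtype.ext (Prod.ext ?_ ?_)
    · exact Module.Grassmannian.map_comp _ f.hom g.hom N.1.1
    · exact Module.Grassmannian.map_comp _ f.hom g.hom N.1.2

end Functor

/-- The functor of points `A ↦ Hom_R (Spec A, M)`, on `R`-algebras, of a scheme `M` over `Spec R`.
A scheme over `Spec R` is determined by it up to unique isomorphism. -/
noncomputable def pointsFunctor {R : Type u} [CommRing R] (M : Over (Spec (CommRingCat.of R))) :
    CommAlgCat.{u} R ⥤ Type u :=
  opOp (CommAlgCat.{u} R) ⋙ (algSpec (CommRingCat.of R)).op ⋙ yoneda.obj M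

/-- The scheme `M` over `Spec R` represents the functor `G` on `R`-algebras. -/
def Represents {R : Type u} [CommRing R] (M : Over (Spec (CommRingCat.of R)))
    (G : CommAlgCat.{u} R ⥤ Type u) : Prop :=
  Nonempty (pointsFunctor M ≅ G)

/-! ### The ramified quadratic extension and the split hermitian space -/

/-- `F / F₀` is a ramified quadratic extension of the fraction field `F₀` of the discrete valuation
ring `O₀` of residue characteristic different from two, generated by a square root `π` of a
uniformizer `π₀` of `O₀`, and `V` is an `F`-vector space of dimension `2 * m` with a split
`F / F₀`-hermitian form `φ`. -/
structure SplitHermitianSpace (O₀ F₀ F V : Type u) [CommRing O₀] [IsDomain O₀]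
    [IsDiscreteValuationRing O₀] [Field F₀] [Algebra O₀ F₀] [IsFractionRing O₀ F₀]
    [Field F] [Algebra F₀ F] [AddCommGroup V] [Module F V] (m : ℕ) where
  two_residue_ne_zero : (2 : IsLocalRing.ResidueField O₀) ≠ 0
  /-- The uniformizer of `F₀`. -/
  π₀ : O₀
  irreducible_π₀ : Irreducible π₀
  finrank_eq_two : Module.finrank F₀ F = 2
  /-- The uniformizer of `F`. -/
  π : F
  π_sq : π ^ 2 = algebraMap F₀ F (algebraMap O₀ F₀ π₀)
  /-- The nontrivial automorphism of `F / F₀`. -/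
  conj : F ≃ₐ[F₀] F
  conj_ne_one : conj ≠ 1
  /-- The hermitian form. -/
  φ : V →ₗ[F] V →ₛₗ[(conj : F →+* F)] F
  hermitian : ∀ x y, φ y x = conj (φ x y)
  /-- The basis splitting the form. -/
  e : Module.Basis (Fin (2 * m)) F V
  split : ∀ i j, φ (e i) (e j.rev) = if i = j then 1 else 0

namespace SplitHermitianSpace

variable {O₀ F₀ F V : Type u} [CommRing O₀] [IsDomain O₀]
    [IsDiscreteValuationRing O₀] [Field F₀] [Algebra O₀ F₀] [IsFractionRing O₀ F₀]
    [Field F] [Algebra F₀ F] [Algebra O₀ F] [IsScalarTower O₀ F₀ F]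
    [AddCommGroup V] [Module F V] [Module O₀ V] [IsScalarTower O₀ F V] {m : ℕ}
    (D : SplitHermitianSpace O₀ F₀ F V m)

/-- The ring of integers of `F`. -/
abbrev integers (_ : SplitHermitianSpace O₀ F₀ F V m) : Type u := integralClosure O₀ F

theorem π_ne_zero : D.π ≠ 0 := by
  intro h
  have h1 := D.π_sq
  rw [h, zero_pow two_ne_zero, eq_comm, map_eq_zero,
    IsFractionRing.to_map_eq_zero_iff] at h1
  exact D.irreducible_π₀.ne_zero h1

theorem isIntegral_π : IsIntegral O₀ D.π := by
  refine IsIntegral.of_pow (n := 2) two_pos ?_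
  rw [D.π_sq, ← IsScalarTower.algebraMap_apply]
  exact isIntegral_algebraMap

/-- `π` as an element of the ring of integers of `F`. -/
def unif : D.integers := ⟨D.π, D.isIntegral_π⟩

/-- The standard lattice `Λ_m`, the span over the ring of integers of `F` of
`π⁻¹ e₁, …, π⁻¹ e_m, e_{m+1}, …, e_{2m}`. -/
def lattice : Submodule D.integers V :=
  Submodule.span D.integers
    (Set.range fun i : Fin (2 * m) => if i.val < m then D.π⁻¹ • D.e i else D.e i)

/-- The symmetric form `(x, y) = ½ Tr_{F / F₀} φ(x, y)` on `V`. -/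
noncomputable def symmForm (x y : V) : F₀ := 2⁻¹ * Algebra.trace F₀ F (D.φ x y)

theorem finiteDimensional (D : SplitHermitianSpace O₀ F₀ F V m) : FiniteDimensional F₀ F :=
  Module.finite_of_finrank_pos (by rw [D.finrank_eq_two]; norm_num)

theorem isUnit_two (D : SplitHermitianSpace O₀ F₀ F V m) : IsUnit (2 : O₀) := by
  by_contra h
  apply D.two_residue_ne_zero
  rw [← map_ofNat (IsLocalRing.residue O₀) 2, IsLocalRing.residue_eq_zero_iff]
  exact h

theorem univ_eq (g : F ≃ₐ[F₀] F) : g = 1 ∨ g = D.conj := by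
  have := D.finiteDimensional
  classical
  by_contra! h
  have hc : ({1, D.conj, g} : Finset (F ≃ₐ[F₀] F)).card = 3 := by
    rw [Finset.card_eq_three]
    exact ⟨_, _, _, D.conj_ne_one.symm, h.1.symm, h.2.symm, rfl⟩
  have h1 := Finset.card_le_univ ({1, D.conj, g} : Finset (F ≃ₐ[F₀] F))
  have h2 := AlgEquiv.card_le (F := F₀) (K := F)
  rw [D.finrank_eq_two] at h2
  omega

theorem trace_eq (x : F) : algebraMap F₀ F (Algebra.trace F₀ F x) = x + D.conj x := by
  have := D.finiteDimensional
  classical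
  have hu : (Finset.univ : Finset (F ≃ₐ[F₀] F)) = {1, D.conj} := by
    ext g
    simpa using D.univ_eq g
  have hg : IsGalois F₀ F := by
    apply IsGalois.of_card_aut_eq_finrank
    rw [D.finrank_eq_two, Nat.card_eq_fintype_card, ← Finset.card_univ, hu,
      Finset.card_pair D.conj_ne_one.symm]
  rw [trace_eq_sum_automorphisms, hu, Finset.sum_pair D.conj_ne_one.symm]
  rfl

theorem conj_π : D.conj D.π = -D.π := by
  have h1 : D.conj D.π ^ 2 = D.π ^ 2 := by rw [← map_pow, D.π_sq, AlgEquiv.commutes]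
  rcases sq_eq_sq_iff_eq_or_eq_neg.1 h1 with h | h
  · exfalso
    have hd : (2 : F₀) ≠ 0 := by
      have := (D.isUnit_two.map (algebraMap O₀ F₀)).ne_zero
      rwa [map_ofNat] at this
    have h2 := D.trace_eq D.π
    rw [h, ← two_mul] at h2
    -- then `π` lies in `F₀`, where `π₀` is not a square
    have h3 : D.π = algebraMap F₀ F (2⁻¹ * Algebra.trace F₀ F D.π) := by
      rw [map_mul, h2, map_inv₀, map_ofNat, inv_mul_cancel_left₀]
      rw [← map_ofNat (algebraMap F₀ F) 2]
      exact (map_ne_zero _).2 hd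
    set c := 2⁻¹ * Algebra.trace F₀ F D.π
    have h4 : c ^ 2 = algebraMap O₀ F₀ D.π₀ := by
      apply (algebraMap F₀ F).injective
      rw [map_pow, ← h3, D.π_sq]
    have h5 : IsIntegral O₀ c :=
      IsIntegral.of_pow (n := 2) two_pos (h4 ▸ isIntegral_algebraMap)
    obtain ⟨d, hd'⟩ := IsIntegrallyClosed.isIntegral_iff.1 h5
    rw [← hd', ← map_pow] at h4
    have h6 : d ^ 2 = D.π₀ := IsFractionRing.injective O₀ F₀ h4
    exact not_irreducible_pow (by norm_num) (h6 ▸ D.irreducible_π₀)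
  · exact h

/-- `φ` takes values in `π⁻¹ O_F` on the standard lattice. -/
theorem isIntegral_π_mul_φ {x y : V} (hx : x ∈ D.lattice) (hy : y ∈ D.lattice) :
    IsIntegral O₀ (D.π * D.φ x y) := by
  have hconj : ∀ {z : F}, IsIntegral O₀ z → IsIntegral O₀ (D.conj z) := fun hz =>
    hz.map (D.conj.toAlgHom.restrictScalars O₀)
  unfold lattice at hx hy
  induction hx using Submodule.span_induction with
  | zero => simpa using isIntegral_zero
  | add x x' _ _ hx hx' => simpa [mul_add] using hx.add hx'
  | smul a x _ hx =>
    have : D.π * D.φ (a • x) y = (a : F) * (D.π * D.φ x y) := by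
      rw [show a • x = (a : F) • x from rfl, map_smul, LinearMap.smul_apply, smul_eq_mul]
      ring
    rw [this]
    exact a.2.mul hx
  | mem x hx =>
  induction hy using Submodule.span_induction with
  | zero => simpa using isIntegral_zero
  | add y y' _ _ hy hy' => simpa [mul_add] using hy.add hy'
  | smul a y _ hy =>
    have : D.π * D.φ x (a • y) = D.conj (a : F) * (D.π * D.φ x y) := by
      rw [show a • y = (a : F) • y from rfl, LinearMap.map_smulₛₗ, smul_eq_mul]
      simp only [RingHom.coe_coe]
      ring
    rw [this]
    exact (hconj a.2).mul hy
  | mem y hy =>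
  obtain ⟨i, rfl⟩ := hx
  obtain ⟨j, rfl⟩ := hy
  have hs : ∀ i j, D.φ (D.e i) (D.e j) = if i = j.rev then 1 else 0 := by
    intro i j
    simpa using D.split i j.rev
  have h0 := D.π_ne_zero
  have hi := D.isIntegral_π
  by_cases hij : i = j.rev
  · have hv : i.val + j.val + 1 = 2 * m := by
      rw [hij, Fin.val_rev]; omega
    by_cases h1 : i.val < m
    · have h2 : ¬ j.val < m := by omega
      simp only [h1, h2, if_true, if_false, map_smul, LinearMap.smul_apply, hs, smul_eq_mul]
      simpa [h0, ← hij] using isIntegral_one (R := O₀) (B := F)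
    · simp only [h1, if_false]
      split_ifs
      · rw [LinearMap.map_smulₛₗ, hs]
        simp only [hij, if_true, RingHom.coe_coe, map_inv₀, D.conj_π, smul_eq_mul]
        rw [show D.π * ((-D.π)⁻¹ * 1) = -1 by field_simp]
        exact isIntegral_one.neg
      · simpa [hs, hij] using hi
  · have : D.φ (if i.val < m then D.π⁻¹ • D.e i else D.e i)
        (if j.val < m then D.π⁻¹ • D.e j else D.e j) = 0 := by
      split_ifs <;> simp [hs, hij, LinearMap.map_smulₛₗ]
    simp only [this, mul_zero]
    exact isIntegral_zero

/-- The symmetric form is integral on the standard lattice. -/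
theorem exists_symmForm_eq {x y : V} (hx : x ∈ D.lattice) (hy : y ∈ D.lattice) :
    ∃ a : O₀, algebraMap O₀ F₀ a = D.symmForm x y := by
  have hconj : ∀ {z : F}, IsIntegral O₀ z → IsIntegral O₀ (D.conj z) := fun hz =>
    hz.map (D.conj.toAlgHom.restrictScalars O₀)
  have h0 := D.π_ne_zero
  obtain ⟨w, hw⟩ := D.isUnit_two.exists_right_inv
  have hw' : algebraMap O₀ F₀ w = 2⁻¹ := by
    apply eq_inv_of_mul_eq_one_right
    rw [← map_ofNat (algebraMap O₀ F₀) 2, ← map_mul, hw, map_one]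
  set c := D.π * D.φ x y with hc
  have hci : IsIntegral O₀ c := D.isIntegral_π_mul_φ hx hy
  set T := Algebra.trace F₀ F (D.φ x y) with hT
  have h1 : D.π * algebraMap F₀ F T = c - D.conj c := by
    rw [hT, D.trace_eq, hc, map_mul, D.conj_π]
    ring
  have h2 : IsIntegral O₀ (D.π * algebraMap F₀ F T) := h1 ▸ hci.sub (hconj hci)
  have h3 : IsIntegral O₀ (algebraMap O₀ F₀ D.π₀ * T ^ 2) := by
    rw [← isIntegral_algebraMap_iff (algebraMap F₀ F).injective (B := F)]
    rw [map_mul, map_pow, ← D.π_sq, ← mul_pow]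
    exact h2.pow 2
  have h4 : IsIntegral O₀ (algebraMap O₀ F₀ D.π₀ * T) := by
    refine IsIntegral.of_pow (n := 2) two_pos ?_
    rw [show (algebraMap O₀ F₀ D.π₀ * T) ^ 2 =
      algebraMap O₀ F₀ D.π₀ * (algebraMap O₀ F₀ D.π₀ * T ^ 2) by ring]
    exact isIntegral_algebraMap.mul h3
  obtain ⟨u, hu⟩ := IsIntegrallyClosed.isIntegral_iff.1 h3
  obtain ⟨v, hv⟩ := IsIntegrallyClosed.isIntegral_iff.1 h4
  have h5 : v ^ 2 = D.π₀ * u := by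
    apply IsFractionRing.injective O₀ F₀
    rw [map_pow, map_mul, hu, hv]
    ring
  obtain ⟨q, hq⟩ := D.irreducible_π₀.prime.dvd_of_dvd_pow (Dvd.intro _ h5.symm)
  refine ⟨w * q, ?_⟩
  have h6 : algebraMap O₀ F₀ q = T := by
    have hne : algebraMap O₀ F₀ D.π₀ ≠ 0 := by
      rw [Ne, IsFractionRing.to_map_eq_zero_iff]
      exact D.irreducible_π₀.ne_zero
    apply mul_left_cancel₀ hne
    rw [← map_mul, ← hq, hv]
  rw [map_mul, hw', h6, symmForm]

theorem algebraMap_choose (x y : D.lattice) :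
    algebraMap O₀ F₀ (D.exists_symmForm_eq x.2 y.2).choose = D.symmForm x y :=
  (D.exists_symmForm_eq x.2 y.2).choose_spec

theorem trace_smul (a : O₀) (x : F) :
    Algebra.trace F₀ F (algebraMap O₀ F a * x) = algebraMap O₀ F₀ a * Algebra.trace F₀ F x := by
  rw [IsScalarTower.algebraMap_apply O₀ F₀ F, ← Algebra.smul_def, map_smul, smul_eq_mul]

/-- The symmetric form `(x, y) = ½ Tr_{F / F₀} φ(x, y)` as an `O₀`-valued `O₀`-bilinear form on the
standard lattice. -/
noncomputable def latticeForm : LinearMap.BilinForm O₀ D.lattice :=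
  LinearMap.mk₂ O₀ (fun x y => (D.exists_symmForm_eq x.2 y.2).choose)
    (fun x x' y => IsFractionRing.injective O₀ F₀ (by
      rw [map_add, algebraMap_choose, algebraMap_choose, algebraMap_choose]
      simp only [symmForm, Submodule.coe_add, map_add, LinearMap.add_apply, mul_add]))
    (fun a x y => IsFractionRing.injective O₀ F₀ (by
      rw [smul_eq_mul, map_mul, algebraMap_choose, algebraMap_choose, symmForm, symmForm,
        Submodule.coe_smul_of_tower, ← algebraMap_smul F a (x : V), map_smul, LinearMap.smul_apply,
        smul_eq_mul, trace_smul, mul_left_comm]))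
    (fun x y y' => IsFractionRing.injective O₀ F₀ (by
      rw [map_add, algebraMap_choose, algebraMap_choose, algebraMap_choose]
      simp only [symmForm, Submodule.coe_add, map_add, mul_add]))
    (fun a x y => IsFractionRing.injective O₀ F₀ (by
      rw [smul_eq_mul, map_mul, algebraMap_choose, algebraMap_choose, symmForm, symmForm,
        Submodule.coe_smul_of_tower, ← algebraMap_smul F a (y : V), LinearMap.map_smulₛₗ,
        smul_eq_mul, RingHom.coe_coe, IsScalarTower.algebraMap_apply O₀ F₀ F, AlgEquiv.commutes,
        ← IsScalarTower.algebraMap_apply O₀ F₀ F, trace_smul, mul_left_comm]))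

theorem algebraMap_latticeForm (x y : D.lattice) :
    algebraMap O₀ F₀ (D.latticeForm x y) = D.symmForm x y :=
  (D.exists_symmForm_eq x.2 y.2).choose_spec

/-- Multiplication by `π` on the standard lattice. -/
noncomputable def mulπ : D.lattice →ₗ[O₀] D.lattice :=
  (LinearMap.lsmul D.integers D.lattice D.unif).restrictScalars O₀

/-- The functor defining the naive splitting model for the signature `(2 * m - s, s)`: it sends an
algebra `A` over the ring of integers `O_F` of `F` to the set of pairs `𝓕₀ ⊆ 𝓕₁ ⊆ Λ_m ⊗ A` (tensor
product over `O₀`) of Zariski locally direct summands of ranks `s` and `2 * m`, with `𝓕₁` totally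
isotropic for `( , )`, `(t + π) 𝓕₁ ⊆ 𝓕₀` and `(t - π) 𝓕₀ = 0`, where `t` is induced by the
multiplication by `π` on `Λ_m`. We write `Λ_m ⊗ A` as `A ⊗[O_F] (O_F ⊗[O₀] Λ_m)`. -/
noncomputable def naiveSplittingFunctor (s : ℕ) : CommAlgCat.{u} D.integers ⥤ Type u :=
  splitPairFunctor (R := D.integers) (L := D.integers ⊗[O₀] D.lattice) D.unif
    (D.mulπ.baseChange D.integers) (D.latticeForm.baseChange D.integers) (2 * m) s

end SplitHermitianSpace

end NaiveSplitting

/-! ### Zariski sheaves on affine schemes and their representability -/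

namespace ZariskiRepresentability

open Opposite Limits

/-! Failure of flatness is a parity phenomenon for Lagrangian subspaces. Let `K` be a field over
`O_F` in which the image `ϖ` of `π` is nonzero. On the base change of `Λ_m` to `K` one has `t² =
ϖ²`, and `t` is skew for the symmetric form, so the eigenspace `E = ker (t - ϖ)` is its own
orthogonal complement, of dimension `2m`. On `E` the operator `t + ϖ` is the invertible scalar `2ϖ`,
so the conditions on a pair force `𝓕₀ = E ∩ 𝓕₁`, and `dim (E ∩ 𝓕₁) = s`. Now let `C` be an isotropic
complement of `𝓕₁` and `P` the projection onto `𝓕₁` along `C`. The form `(x, y) ↦ (P x, y)` on `E`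
is alternating with kernel `(E ∩ 𝓕₁) ⊕ (E ∩ C)`, and alternating forms have even rank. Hence `s +
dim (E ∩ C)` is even: this is `even_finrank_of_isotropic_isCompl`, applied to coordinate subspaces
in `even_of_isSplit`.

Where `ϖ = 0` the link between `s` and the family of Lagrangians containing `𝓕₁` is lost.
`specialPoint` is a pair of coordinate subspaces over a residue field of `O_F` whose `𝓕₁` has a
coordinate complement `C` of the wrong parity (`odd_card`). Transversality to `C` is an open
condition, so the special point has an affine neighbourhood with no point at which `ϖ ≠ 0`
(`exists_affineOpen`). On that neighbourhood `ϖ` is nilpotent, whereas flatness over a domain would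
make its powers regular (`not_flat_of_affineOpen`).

Representability is the usual Grassmannian argument. Once a basis is chosen, pairs of submodules
form a Zariski sheaf on rings. The pairs transverse to two given coordinate subspaces form an open
subfunctor, represented by an explicit quotient of a polynomial ring, and every pair over a field
lies in one of these charts. `ZariskiRepresentability.exists_scheme` turns such data into a scheme:
the sheaf is extended from affine schemes to all schemes, and the charts become open immersions. The
bridge to the lattice is `ofBasis_eq`, which computes the operator and the form in the basis `f_i, π
f_i` of `Λ_m`. -/

/-- The localization map `A → A_a` in the category of commutative rings. -/
abbrev loc (A : CommRingCat.{u}) (a : A) : A ⟶ CommRingCat.of (Localization.Away a) :=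
  CommRingCat.ofHom (algebraMap A (Localization.Away a))

/-- The sheaf condition for finite covers of affine schemes by basic open sets. -/
def IsZariskiSheaf (G : CommRingCat.{u} ⥤ Type u) : Prop :=
  ∀ (A : CommRingCat.{u}) (s : Finset A), Ideal.span (s : Set A) = ⊤ →
    ∀ x : ∀ a : s, G.obj (CommRingCat.of (Localization.Away a.1)),
    (∀ (a b : s) (B : CommRingCat.{u}) (φ : CommRingCat.of (Localization.Away a.1) ⟶ B)
      (ψ : CommRingCat.of (Localization.Away b.1) ⟶ B),
      loc A a.1 ≫ φ = loc A b.1 ≫ ψ → G.map φ (x a) = G.map ψ (x b)) →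
    ∃! y : G.obj A, ∀ a : s, G.map (loc A a.1) y = x a

/-- Quasi-compactness of `Spec A`: the elements satisfying `Q` lie together in no maximal ideal, and
`1` is a combination of finitely many of them. -/
theorem exists_finset_span_eq_top {A : Type u} [CommRing A] (Q : A → Prop)
    (h : ∀ p : PrimeSpectrum A, ∃ a ∉ p.asIdeal, Q a) :
    ∃ s : Finset A, Ideal.span (s : Set A) = ⊤ ∧ ∀ a ∈ s, Q a := by
  have h1 : Ideal.span {a | Q a} = ⊤ := by
    by_contra hne
    obtain ⟨m, hm, hle⟩ := Ideal.exists_le_maximal _ hne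
    obtain ⟨a, ha, hQ⟩ := h ⟨m, hm.isPrime⟩
    exact ha (hle (Ideal.subset_span hQ))
  obtain ⟨s, hs, hs'⟩ := (Ideal.span_eq_top_iff_finite _).1 h1
  exact ⟨s, hs', fun a ha => hs ha⟩

theorem IsZariskiSheaf.ext {G : CommRingCat.{u} ⥤ Type u} (hG : IsZariskiSheaf G)
    {A : CommRingCat.{u}} {x y : G.obj A}
    (h : ∀ p : PrimeSpectrum A, ∃ a ∉ p.asIdeal, G.map (loc A a) x = G.map (loc A a) y) :
    x = y := by
  obtain ⟨s, hs, hQ⟩ := exists_finset_span_eq_top _ h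
  refine (hG A s hs (fun a => G.map (loc A a.1) x) ?_).unique (fun a => rfl)
    (fun a => (hQ a.1 a.2).symm)
  intro a b B φ ψ hφ
  rw [← Functor.map_comp_apply, ← Functor.map_comp_apply, hφ]

/-- A family of sections of `G` over all affine schemes mapping to `S`, compatible with
pullback. -/
@[ext] structure NatFam (G : CommRingCat.{u} ⥤ Type u) (S : Scheme.{u}) where
  app : ∀ {A : CommRingCat.{u}}, (Spec A ⟶ S) → G.obj A
  nat : ∀ {A B : CommRingCat.{u}} (φ : A ⟶ B) (g : Spec A ⟶ S),
    app (Spec.map φ ≫ g) = G.map φ (app g)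

theorem notMem_of_loc {A : CommRingCat.{u}} {a : A}
    (q : PrimeSpectrum (Localization.Away a)) :
    a ∉ (Spec.map (loc A a) q : PrimeSpectrum A).asIdeal := by
  intro h
  have h1 : algebraMap A (Localization.Away a) a ∈ q.asIdeal := h
  exact q.2.ne_top (Ideal.eq_top_of_isUnit_mem _ h1
    (IsLocalization.Away.algebraMap_isUnit a))

theorem exists_loc_comp_eq {A B : CommRingCat.{u}} {a : A} (φ : A ⟶ B)
    (h : IsUnit (φ.hom a)) : ∃ ψ : CommRingCat.of (Localization.Away a) ⟶ B,
      loc A a ≫ ψ = φ := by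
  refine ⟨CommRingCat.ofHom (IsLocalization.Away.lift a h), ?_⟩
  ext z
  exact IsLocalization.Away.lift_eq a h z

theorem exists_factor {A : CommRingCat.{u}} {X S : Scheme.{u}} (f : X ⟶ S) [IsOpenImmersion f]
    (g : Spec A ⟶ S) (p : PrimeSpectrum A) (hp : g p ∈ Set.range f) :
    ∃ a ∉ p.asIdeal, ∃ h : Spec (CommRingCat.of (Localization.Away a)) ⟶ X,
      h ≫ f = Spec.map (loc A a) ≫ g := by
  have ho : IsOpen (g ⁻¹' Set.range f) :=
    f.isOpenEmbedding.isOpen_range.preimage g.continuous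
  obtain ⟨_, ⟨_, ⟨a, rfl⟩, rfl⟩, ha, hsub⟩ :=
    PrimeSpectrum.isBasis_basic_opens.exists_subset_of_mem_open (u := g ⁻¹' Set.range f) hp ho
  refine ⟨a, ha, IsOpenImmersion.lift f (Spec.map (loc A a) ≫ g) ?_, IsOpenImmersion.lift_fac ..⟩
  rintro _ ⟨q, rfl⟩
  rw [Scheme.Hom.comp_apply]
  exact hsub (notMem_of_loc q)

/-! ### Extending a Zariski sheaf from affine schemes to all schemes. -/

section Extension

variable {G : CommRingCat.{u} ⥤ Type u}

namespace NatFam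

/-- Pullback of a natural family. -/
noncomputable def pullback {S T : Scheme.{u}} (x : NatFam G S) (f : T ⟶ S) : NatFam G T where
  app g := x.app (g ≫ f)
  nat φ g := by rw [Category.assoc, x.nat]

/-- The family associated with a section over an affine scheme. -/
noncomputable def ofSection {P : CommRingCat.{u}} (u : G.obj P) : NatFam G (Spec P) where
  app g := G.map (Spec.preimage g) u
  nat φ g := by
    rw [← Functor.map_comp_apply]
    congr 2
    rw [Spec.preimage_comp, Spec.preimage_map]

theorem ext_of_cover (hG : IsZariskiSheaf G) {S : Scheme.{u}} {x y : NatFam G S}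
    (h : ∀ s : S, ∃ U : S.Opens, s ∈ U ∧ ∀ (A : CommRingCat.{u}) (g : Spec A ⟶ S),
      Set.range g ⊆ U → x.app g = y.app g) : x = y := by
  ext A g
  apply hG.ext
  intro p
  obtain ⟨U, hU, hx⟩ := h (g p)
  obtain ⟨a, ha, k, hk⟩ := exists_factor U.ι g p (by simpa using hU)
  refine ⟨a, ha, ?_⟩
  rw [← x.nat, ← y.nat]
  apply hx
  rw [← hk]
  rintro _ ⟨q, rfl⟩
  rw [Scheme.Hom.comp_apply]
  exact (k q).2

/-- A natural family ranges over all rings and so lives one universe too high. It is determined by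
its values on the affine opens of `S`, which form a small set; this is what lets `extension` take
values in `Type u`. -/
theorem small (hG : IsZariskiSheaf G) (S : Scheme.{u}) : Small.{u} (NatFam G S) := by
  refine small_of_injective (β := ∀ U : S.affineOpens, G.obj Γ(S, U))
    (f := fun x U => x.app U.2.fromSpec) ?_
  intro x y hxy
  apply ext_of_cover hG
  intro s
  obtain ⟨U, hU, hs⟩ : ∃ U : S.Opens, IsAffineOpen U ∧ s ∈ U := by
    obtain ⟨_, ⟨U, hU, rfl⟩, hs, -⟩ :=
      S.isBasis_affineOpens.exists_subset_of_mem_open (Set.mem_univ s) isOpen_univ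
    exact ⟨U, hU, hs⟩
  refine ⟨U, hs, fun A g hg => ?_⟩
  have hg' : Set.range g ⊆ Set.range hU.fromSpec := by rwa [hU.range_fromSpec]
  rw [← IsOpenImmersion.lift_fac hU.fromSpec g hg', ← Spec.map_preimage
    (IsOpenImmersion.lift hU.fromSpec g hg'), x.nat, y.nat]
  exact congrArg _ (congrFun hxy ⟨U, hU⟩)

/-- Each `g : Spec A ⟶ S` factors through the cover locally on `Spec A`, so the sheaf condition on
`A` produces the value at `g`. -/
theorem exists_glue (hG : IsZariskiSheaf G) {S : Scheme.{u}} {I : Type*} {X : I → Scheme.{u}}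
    (f : ∀ i, X i ⟶ S) [∀ i, IsOpenImmersion (f i)] (hf : ∀ s : S, ∃ i, s ∈ Set.range (f i))
    (x : ∀ i, NatFam G (X i))
    (hx : ∀ i j (B : CommRingCat.{u}) (h : Spec B ⟶ X i) (k : Spec B ⟶ X j),
      h ≫ f i = k ≫ f j → (x i).app h = (x j).app k) :
    ∃ y : NatFam G S, ∀ i, y.pullback (f i) = x i := by
  -- The value is characterised by agreement with the `x i` after every base change, not only on one
  -- chosen cover of `Spec A`. This makes it independent of choices, and naturality then follows
  -- from uniqueness.
  have key : ∀ (A : CommRingCat.{u}) (g : Spec A ⟶ S), ∃ y : G.obj A,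
      ∀ (B : CommRingCat.{u}) (φ : A ⟶ B) i (h : Spec B ⟶ X i),
        h ≫ f i = Spec.map φ ≫ g → (x i).app h = G.map φ y := by
    intro A g
    obtain ⟨s, hs, hQ⟩ := exists_finset_span_eq_top
      (fun a : A => ∃ i, ∃ h : Spec (CommRingCat.of (Localization.Away a)) ⟶ X i,
        h ≫ f i = Spec.map (loc A a) ≫ g) (fun p => by
          obtain ⟨i, hi⟩ := hf (g p)
          obtain ⟨a, ha, h⟩ := exists_factor (f i) g p hi
          exact ⟨a, ha, i, h⟩)
    choose i h hh using fun a : s => hQ a.1 a.2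
    obtain ⟨y, hy, -⟩ := hG A s hs (fun a => (x (i a)).app (h a)) (by
      intro a b B φ ψ hφ
      rw [← (x (i a)).nat, ← (x (i b)).nat]
      apply hx
      rw [Category.assoc, Category.assoc, hh, hh, ← Category.assoc, ← Category.assoc,
        ← Spec.map_comp, ← Spec.map_comp, hφ])
    refine ⟨y, fun B φ j k hk => hG.ext fun p => ?_⟩
    -- The images of a cover of `Spec A` still generate the unit ideal of `B`.
    have hex : ∃ a : s, φ a.1 ∉ p.asIdeal := by
      by_contra! hall
      apply p.2.ne_top
      rw [Ideal.eq_top_iff_one, ← map_one φ.hom]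
      have : (1 : A) ∈ Ideal.span (s : Set A) := hs ▸ Submodule.mem_top
      exact (Ideal.span_le.2 (fun a ha => hall ⟨a, ha⟩) : Ideal.span (s : Set A) ≤
        Ideal.comap φ.hom p.asIdeal) this
    obtain ⟨a, ha⟩ := hex
    refine ⟨φ a.1, ha, ?_⟩
    obtain ⟨ψ, hψ⟩ := exists_loc_comp_eq (a := a.1) (φ ≫ loc B (φ a.1))
      (IsLocalization.Away.algebraMap_isUnit (φ a.1))
    rw [← Functor.map_comp_apply, ← hψ, Functor.map_comp_apply, hy, ← (x (i a)).nat,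
      ← (x j).nat]
    apply hx
    rw [Category.assoc, Category.assoc, hh, hk, ← Category.assoc, ← Category.assoc,
      ← Spec.map_comp, ← Spec.map_comp, hψ]
  choose app happ using key
  have huniq : ∀ (A : CommRingCat.{u}) (g : Spec A ⟶ S) (y y' : G.obj A),
      (∀ (B : CommRingCat.{u}) (φ : A ⟶ B) i (h : Spec B ⟶ X i),
        h ≫ f i = Spec.map φ ≫ g → (x i).app h = G.map φ y) →
      (∀ (B : CommRingCat.{u}) (φ : A ⟶ B) i (h : Spec B ⟶ X i),
        h ≫ f i = Spec.map φ ≫ g → (x i).app h = G.map φ y') → y = y' := by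
    intro A g y y' hy hy'
    refine hG.ext fun p => ?_
    obtain ⟨i, hi⟩ := hf (g p)
    obtain ⟨a, ha, h, hh⟩ := exists_factor (f i) g p hi
    exact ⟨a, ha, by rw [← hy _ _ i h hh, ← hy' _ _ i h hh]⟩
  refine ⟨⟨fun {A} g => app A g, fun {A B} φ g => ?_⟩, fun i => ?_⟩
  · refine huniq B (Spec.map φ ≫ g) _ _ (happ B _) fun C ψ i h hh => ?_
    rw [← Functor.map_comp_apply]
    apply happ
    rw [hh, Spec.map_comp, Category.assoc]
  · ext A g
    have := happ A (g ≫ f i) A (𝟙 A) i g (by simp)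
    rw [this, Functor.map_id_apply]
    rfl

end NatFam

/-- The presheaf on schemes of all natural families. -/
noncomputable def natFamPresheaf (G : CommRingCat.{u} ⥤ Type u) : Scheme.{u}ᵒᵖ ⥤ Type (u + 1) where
  obj S := NatFam G S.unop
  map f := TypeCat.ofHom fun x => x.pullback f.unop
  map_id S := by
    refine ConcreteCategory.hom_ext _ _ fun x => ?_
    ext A g
    simp [NatFam.pullback]
  map_comp f g := by
    refine ConcreteCategory.hom_ext _ _ fun x => ?_
    ext A g
    simp [NatFam.pullback]

/-- The extension to schemes of a Zariski sheaf on affine schemes. -/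
noncomputable def extension (hG : IsZariskiSheaf G) : Scheme.{u}ᵒᵖ ⥤ Type u :=
  haveI : FunctorToTypes.Small.{u} (natFamPresheaf G) := fun S => NatFam.small hG S.unop
  FunctorToTypes.shrink.{u} (natFamPresheaf G)

/-- Sections of the extension are natural families. -/
noncomputable def extensionEquiv (hG : IsZariskiSheaf G) (S : Scheme.{u}) :
    (extension hG).obj (op S) ≃ NatFam G S :=
  haveI := NatFam.small hG S
  (equivShrink (NatFam G S)).symm

theorem extensionEquiv_map (hG : IsZariskiSheaf G) {S T : Scheme.{u}} (f : T ⟶ S)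
    (x : (extension hG).obj (op S)) :
    extensionEquiv hG T ((extension hG).map f.op x) = (extensionEquiv hG S x).pullback f := by
  have := NatFam.small hG T
  exact (equivShrink (NatFam G T)).symm_apply_apply _

/-- It is enough to test on open covers, since these are stable under base change; there
`exists_glue` gives existence and `ext_of_cover` uniqueness. -/
theorem isSheaf_extension (hG : IsZariskiSheaf G) :
    Presieve.IsSheaf Scheme.zariskiTopology (extension hG) := by
  rw [Precoverage.isSheaf_toGrothendieck_iff_of_isStableUnderBaseChange]
  rintro S R hR x hx
  obtain ⟨(𝓤 : Scheme.OpenCover S), rfl⟩ := Scheme.exists_cover_of_mem_pretopology hR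
  obtain ⟨y, hy⟩ := NatFam.exists_glue hG 𝓤.f (fun s => ⟨_, 𝓤.covers s⟩)
    (fun i => extensionEquiv hG _ (x (𝓤.f i) (.mk i))) (by
      intro i j B h k hk
      have := congrArg (extensionEquiv hG _) (hx h k (.mk i) (.mk j) hk)
      rw [extensionEquiv_map, extensionEquiv_map] at this
      have := congrArg (fun z => z.app (𝟙 _)) this
      simpa [NatFam.pullback] using this)
  refine ⟨(extensionEquiv hG S).symm y, ?_, ?_⟩
  · rintro T _ ⟨i⟩
    apply (extensionEquiv hG _).injective
    rw [extensionEquiv_map, Equiv.apply_symm_apply, hy]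
  · intro z hz
    rw [Equiv.eq_symm_apply]
    refine NatFam.ext_of_cover hG fun s => ⟨(𝓤.f (𝓤.idx s)).opensRange, 𝓤.covers s, ?_⟩
    intro A g hg
    replace hg : Set.range g ⊆ Set.range (𝓤.f (𝓤.idx s)) := hg
    have h1 := congrArg (extensionEquiv hG _) (hz (𝓤.f (𝓤.idx s)) (.mk _))
    rw [extensionEquiv_map, ← hy] at h1
    have := congrArg (fun z => z.app (IsOpenImmersion.lift (𝓤.f (𝓤.idx s)) g hg)) h1
    change NatFam.app _ (_ ≫ _) = NatFam.app _ (_ ≫ _) at this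
    rwa [IsOpenImmersion.lift_fac] at this

theorem hom_ext_of_loc {A : CommRingCat.{u}} {X : Scheme.{u}} {f g : Spec A ⟶ X}
    (h : ∀ p : PrimeSpectrum A, ∃ a ∉ p.asIdeal,
      Spec.map (loc A a) ≫ f = Spec.map (loc A a) ≫ g) : f = g := by
  obtain ⟨s, hs, hQ⟩ := exists_finset_span_eq_top _ h
  refine Scheme.Cover.hom_ext (Scheme.affineOpenCoverOfSpanRangeEqTop (fun a : s => a.1)
    (by simpa using hs)).openCover _ _ fun a => hQ a.1 a.2

/-- A compatible family of maps between functors of points is induced by a morphism. -/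
theorem exists_hom_of_family {T X : Scheme.{u}}
    (α : ∀ {A : CommRingCat.{u}}, (Spec A ⟶ T) → (Spec A ⟶ X))
    (hα : ∀ {A B : CommRingCat.{u}} (φ : A ⟶ B) (g : Spec A ⟶ T),
      α (Spec.map φ ≫ g) = Spec.map φ ≫ α g) :
    ∃ f : T ⟶ X, ∀ (A : CommRingCat.{u}) (g : Spec A ⟶ T), g ≫ f = α g := by
  have hα' : ∀ {A B : CommRingCat.{u}} (φ : Spec B ⟶ Spec A) (g : Spec A ⟶ T),
      α (φ ≫ g) = φ ≫ α g := by
    intro A B φ g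
    rw [← Spec.map_preimage φ, hα]
  let 𝓤 := T.affineOpenCover
  have hc : ∀ (i j : 𝓤.I₀) (B : CommRingCat.{u}) (a : Spec B ⟶ Spec (𝓤.X i))
      (b : Spec B ⟶ Spec (𝓤.X j)), a ≫ 𝓤.f i = b ≫ 𝓤.f j →
      a ≫ α (𝓤.f i) = b ≫ α (𝓤.f j) := by
    intro i j B a b h
    rw [← hα', h, hα']
  let f : T ⟶ X := 𝓤.openCover.glueMorphisms (fun i => α (𝓤.f i)) (by
    intro i j
    refine Scheme.Cover.hom_ext (pullback (𝓤.openCover.f i)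
      (𝓤.openCover.f j)).affineOpenCover.openCover _ _ fun k => ?_
    refine (Category.assoc _ _ _).symm.trans ((hc i j _ _ _ ?_).trans (Category.assoc _ _ _))
    refine (Category.assoc _ _ _).trans (Eq.trans ?_ (Category.assoc _ _ _).symm)
    exact congrArg _ pullback.condition)
  have hf : ∀ i, 𝓤.f i ≫ f = α (𝓤.f i) := fun i => 𝓤.openCover.ι_glueMorphisms _ _ i
  refine ⟨f, fun A g => hom_ext_of_loc fun p => ?_⟩
  obtain ⟨a, ha, h, hh⟩ := exists_factor (𝓤.f (𝓤.idx (g p))) g p (𝓤.covers (g p))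
  exact ⟨a, ha, by rw [← Category.assoc, ← hh, Category.assoc, hf, ← hα', ← hα', hh]⟩

/-- The natural family of a section of `G` over `Spec P`, as a map from the functor of points. -/
noncomputable def chartMap (hG : IsZariskiSheaf G) {P : CommRingCat.{u}} (u : G.obj P) :
    yoneda.obj (Spec P) ⟶ extension hG :=
  yonedaEquiv.symm ((extensionEquiv hG _).symm (NatFam.ofSection u))

theorem extensionEquiv_chartMap (hG : IsZariskiSheaf G) {P : CommRingCat.{u}} (u : G.obj P)
    {T : Scheme.{u}} (f : T ⟶ Spec P) :
    extensionEquiv hG T ((chartMap hG u).app (op T) f) = (NatFam.ofSection u).pullback f := by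
  exact (extensionEquiv_map hG f _).trans (by rw [Equiv.apply_symm_apply])

/-- `y` is obtained from `u` by base change. -/
def InChart {P : CommRingCat.{u}} (u : G.obj P) {B : CommRingCat.{u}} (y : G.obj B) : Prop :=
  ∃ ψ : P ⟶ B, G.map ψ u = y

/-- The largest open subscheme on which a natural family is obtained from `u` by base change. -/
def chartOpens {P : CommRingCat.{u}} (u : G.obj P) {S : Scheme.{u}} (x : NatFam G S) : S.Opens :=
  sSup {W | ∀ (B : CommRingCat.{u}) (h : Spec B ⟶ S), Set.range h ⊆ W → InChart u (x.app h)}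

/-! ### Openness of the locus where a family comes from a given chart. -/

section Chart

variable {P : CommRingCat.{u}} {u : G.obj P}
  (hopen : ∀ (A : CommRingCat.{u}) (y : G.obj A), ∃ J : Ideal A, ∀ (B : CommRingCat.{u})
    (φ : A ⟶ B), InChart u (G.map φ y) ↔ J.map φ.hom = ⊤)
include hopen

/-- Lying in the chart means that an ideal `J` of `B` is the unit ideal. Around each point the map
lands in one of the opens defining `chartOpens`, so `J` becomes the unit ideal after a localization
there and lies in no maximal ideal. -/
theorem inChart_of_range_subset {S : Scheme.{u}} {x : NatFam G S} {B : CommRingCat.{u}}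
    (h : Spec B ⟶ S) (hh : Set.range h ⊆ chartOpens u x) : InChart u (x.app h) := by
  obtain ⟨J, hJ⟩ := hopen B (x.app h)
  have h1 := (hJ B (𝟙 B)).2
  rw [Functor.map_id_apply] at h1
  apply h1
  rw [CommRingCat.hom_id, Ideal.map_id]
  by_contra hne
  obtain ⟨m, hm, hle⟩ := Ideal.exists_le_maximal _ hne
  let p : PrimeSpectrum B := ⟨m, hm.isPrime⟩
  obtain ⟨W, hW, hpW⟩ : ∃ W : S.Opens, (∀ (C : CommRingCat.{u}) (k : Spec C ⟶ S),
      Set.range k ⊆ W → InChart u (x.app k)) ∧ h p ∈ W :=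
    TopologicalSpace.Opens.mem_sSup.1 (hh ⟨p, rfl⟩)
  obtain ⟨a, ha, k, hk⟩ := exists_factor W.ι h p (by simpa using hpW)
  have h2 := hW _ (Spec.map (loc B a) ≫ h) (by
    rw [← hk]
    rintro _ ⟨q, rfl⟩
    rw [Scheme.Hom.comp_apply]
    exact (k q).2)
  rw [x.nat, hJ] at h2
  have h3 := (IsLocalization.map_algebraMap_ne_top_iff_disjoint (Submonoid.powers a)
    (Localization.Away a) J).2 (by
      rw [Set.disjoint_left]
      rintro _ ⟨n, rfl⟩ hn
      exact ha (hm.isPrime.mem_of_pow_mem n (hle hn)))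
  exact h3 h2

/-- The map `h` need not be open, so an open neighbourhood of `h p` must be found in `S`. On an
affine open `V` around `h p` the chart condition is given by an ideal `J`; some `a ∈ J` does not
vanish at `h p`, and the basic open of `a` works. -/
theorem range_subset_of_inChart {S : Scheme.{u}} {x : NatFam G S} {B : CommRingCat.{u}}
    (h : Spec B ⟶ S) (hh : InChart u (x.app h)) : Set.range h ⊆ chartOpens u x := by
  rintro _ ⟨p, rfl⟩
  obtain ⟨_, ⟨V, hV : IsAffineOpen V, rfl⟩, hpV, -⟩ :=
    S.isBasis_affineOpens.exists_subset_of_mem_open (Set.mem_univ (h p)) isOpen_univ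
  obtain ⟨J, hJ⟩ := hopen _ (x.app hV.fromSpec)
  obtain ⟨b, hb, k, hk⟩ := exists_factor hV.fromSpec h p (by rw [hV.range_fromSpec]; exact hpV)
  obtain ⟨κ, rfl⟩ := Spec.map_surjective k
  have h1 : InChart u (x.app (Spec.map κ ≫ hV.fromSpec)) := by
    obtain ⟨ψ, hψ⟩ := hh
    exact ⟨ψ ≫ loc B b, by rw [hk, x.nat, ← hψ, Functor.map_comp_apply]⟩
  rw [x.nat, hJ] at h1
  -- the prime of `B_b` over `p`
  obtain ⟨q, hq⟩ : ∃ q : PrimeSpectrum (Localization.Away b),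
      Spec.map (loc B b) q = p := by
    have : p ∈ Set.range (PrimeSpectrum.comap (algebraMap B (Localization.Away b))) := by
      rw [PrimeSpectrum.localization_away_comap_range (Localization.Away b) b]
      exact hb
    exact this
  have h2 : ∃ a ∈ J, κ.hom a ∉ q.asIdeal := by
    by_contra! hall
    exact q.2.ne_top (top_le_iff.1 (h1 ▸ Ideal.map_le_iff_le_comap.2 hall))
  obtain ⟨a, haJ, ha⟩ := h2
  have hpa : h p ∈ S.basicOpen a := by
    have e1 : h p = hV.fromSpec (Spec.map κ q) := by
      have h3 := Scheme.Hom.comp_apply (Spec.map κ) hV.fromSpec q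
      rw [hk] at h3
      exact (congrArg h hq.symm).trans
        ((Scheme.Hom.comp_apply (Spec.map (loc B b)) h q).symm.trans h3)
    rw [e1]
    have : Spec.map κ q ∈ hV.fromSpec ⁻¹ᵁ S.basicOpen a := by
      rw [hV.fromSpec_preimage_basicOpen]
      exact ha
    exact this
  refine TopologicalSpace.Opens.mem_sSup.2 ⟨S.basicOpen a, fun C g hg => ?_, hpa⟩
  have hg' : Set.range g ⊆ Set.range hV.fromSpec := by
    rw [hV.range_fromSpec]
    exact hg.trans (S.basicOpen_le a)
  obtain ⟨l, hl⟩ := Spec.map_surjective (IsOpenImmersion.lift hV.fromSpec g hg')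
  have hl' : Spec.map l ≫ hV.fromSpec = g := by
    rw [hl, IsOpenImmersion.lift_fac]
  rw [← hl', x.nat, hJ]
  by_contra hne
  obtain ⟨m, hm, hle⟩ := Ideal.exists_le_maximal _ hne
  let r : PrimeSpectrum C := ⟨m, hm.isPrime⟩
  have h3 : Spec.map l r ∈ hV.fromSpec ⁻¹ᵁ S.basicOpen a := by
    change hV.fromSpec (Spec.map l r) ∈ S.basicOpen a
    have h4 := Scheme.Hom.comp_apply (Spec.map l) hV.fromSpec r
    rw [hl'] at h4
    exact h4 ▸ hg ⟨r, rfl⟩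
  rw [hV.fromSpec_preimage_basicOpen] at h3
  exact h3 (hle (Ideal.mem_map_of_mem _ haJ))

variable (hinj : ∀ (B : CommRingCat.{u}) (φ ψ : P ⟶ B), G.map φ u = G.map ψ u → φ = ψ)
include hinj

/-- By `hinj` the map `ψ` exhibiting a value as a base change of `u` is unique, hence natural, so
the local choices come from one morphism. -/
theorem exists_chart_hom {S : Scheme.{u}} (x : NatFam G S) :
    ∃ f : (chartOpens u x).toScheme ⟶ Spec P,
      (NatFam.ofSection u).pullback f = x.pullback (chartOpens u x).ι := by
  have h1 : ∀ (B : CommRingCat.{u}) (h : Spec B ⟶ (chartOpens u x).toScheme),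
      ∃ ψ : P ⟶ B, G.map ψ u = x.app (h ≫ (chartOpens u x).ι) := by
    intro B h
    apply inChart_of_range_subset hopen
    rintro _ ⟨q, rfl⟩
    rw [Scheme.Hom.comp_apply]
    exact (h q).2
  choose ψ hψ using h1
  obtain ⟨f, hf⟩ := exists_hom_of_family (T := (chartOpens u x).toScheme) (X := Spec P)
    (fun {B} h => Spec.map (ψ B h)) (by
      intro A B φ g
      rw [← Spec.map_comp]
      congr 1
      apply hinj
      rw [hψ, Functor.map_comp_apply, hψ, Category.assoc, x.nat])
  refine ⟨f, ?_⟩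
  ext A g
  change G.map (Spec.preimage (g ≫ f)) u = x.app (g ≫ _)
  rw [hf, Spec.preimage_map, hψ]

/-- The fibre product of the chart with any `S` is the open subscheme `chartOpens u s`; the two
preceding inclusions show that a map `T ⟶ S` lifts to the chart exactly when its image lies there.
-/
theorem chartMap_isOpenImmersion (hG : IsZariskiSheaf G) :
    IsOpenImmersion.presheaf (chartMap hG u) := by
  apply MorphismProperty.relative.of_exists
  intro S g
  let s := extensionEquiv hG S (yonedaEquiv g)
  have hs : ∀ {T : Scheme.{u}} (b : T ⟶ S),
      extensionEquiv hG T (g.app (op T) b) = s.pullback b := by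
    intro T b
    rw [← extensionEquiv_map, yonedaEquiv_apply, ← NatTrans.naturality_apply]
    simp
  obtain ⟨f, hf⟩ := exists_chart_hom hopen hinj s
  refine ⟨(chartOpens u s).toScheme, yoneda.map f, (chartOpens u s).ι, ?_, inferInstance⟩
  apply IsPullback.of_forall_isPullback_app
  rintro ⟨T⟩
  rw [Types.isPullback_iff]
  refine ⟨?_, ?_, ?_⟩
  · ext c
    apply (extensionEquiv hG T).injective
    change extensionEquiv hG T ((chartMap hG u).app (op T) (c ≫ f)) =
      extensionEquiv hG T (g.app (op T) (c ≫ _))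
    rw [extensionEquiv_chartMap, hs]
    ext A h
    have := congrArg (fun z => z.app (h ≫ c)) hf
    simpa [NatFam.pullback] using this
  · intro c d hcd
    exact (cancel_mono (chartOpens u s).ι).1 hcd.2
  · intro (a : T ⟶ Spec P) (b : T ⟶ S) hab
    have h1 := congrArg (extensionEquiv hG T) hab
    rw [extensionEquiv_chartMap, hs] at h1
    have h2 : ∀ {B : CommRingCat.{u}} (h : Spec B ⟶ T),
        G.map (Spec.preimage (h ≫ a)) u = s.app (h ≫ b) := fun h =>
      congrArg (fun z => z.app h) h1
    have h3 : Set.range b ⊆ Set.range (chartOpens u s).ι := by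
      rw [Scheme.Opens.range_ι]
      rintro _ ⟨t, rfl⟩
      obtain ⟨p, hp⟩ := T.affineOpenCover.covers t
      rw [← hp, ← Scheme.Hom.comp_apply]
      exact range_subset_of_inChart hopen _ ⟨_, h2 _⟩ ⟨p, rfl⟩
    refine ⟨IsOpenImmersion.lift (chartOpens u s).ι b h3, ?_, IsOpenImmersion.lift_fac ..⟩
    refine Scheme.Cover.hom_ext T.affineOpenCover.openCover _ _ fun i => ?_
    apply Spec.homEquiv.injective
    apply hinj
    refine Eq.trans ?_ (h2 _).symm
    have := congrArg (fun z => z.app (T.affineOpenCover.f i ≫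
      IsOpenImmersion.lift (chartOpens u s).ι b h3)) hf
    change G.map (Spec.preimage ((_ ≫ _) ≫ f)) u = s.app ((_ ≫ _) ≫ _) at this
    rw [Category.assoc, Category.assoc, IsOpenImmersion.lift_fac] at this
    exact this

end Chart

end Extension

/-- A Zariski sheaf on affine schemes covered by affine open subfunctors is the functor of points
of a scheme. -/
theorem exists_scheme (G : CommRingCat.{u} ⥤ Type u) (hG : IsZariskiSheaf G) {I : Type u}
    (P : I → CommRingCat.{u}) (u : ∀ i, G.obj (P i))
    (hinj : ∀ i (B : CommRingCat.{u}) (φ ψ : P i ⟶ B), G.map φ (u i) = G.map ψ (u i) → φ = ψ)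
    (hopen : ∀ i (A : CommRingCat.{u}) (y : G.obj A), ∃ J : Ideal A, ∀ (B : CommRingCat.{u})
      (φ : A ⟶ B), InChart (u i) (G.map φ y) ↔ J.map φ.hom = ⊤)
    (hcov : ∀ (K : CommRingCat.{u}) (y : G.obj K), IsField K → ∃ i, InChart (u i) y) :
    ∃ M : Scheme.{u}, ∃ e : ∀ A : CommRingCat.{u}, (Spec A ⟶ M) ≃ G.obj A,
      ∀ (A B : CommRingCat.{u}) (φ : A ⟶ B) (g : Spec A ⟶ M),
        e B (Spec.map φ ≫ g) = G.map φ (e A g) := by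
  let F : Sheaf Scheme.zariskiTopology.{u} (Type u) :=
    ⟨extension hG, (isSheaf_iff_isSheaf_of_type _ _).2 (isSheaf_extension hG)⟩
  let f : ∀ i, yoneda.obj (Spec (P i)) ⟶ F.1 := fun i => chartMap hG (u i)
  have hf : ∀ i, IsOpenImmersion.presheaf (f i) := fun i =>
    chartMap_isOpenImmersion (hopen i) (hinj i) hG
  have hsurj : Presheaf.IsLocallySurjective Scheme.zariskiTopology (Sigma.desc f) := by
    constructor
    intro S s
    let x : NatFam G S := extensionEquiv hG S s
    have hx : ∀ z : S, ∃ i, z ∈ chartOpens (u i) x := by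
      intro z
      -- Coverage is known only over fields, so it is applied to the residue field at `z`; openness
      -- of the chart locus extends it to a neighbourhood.
      obtain ⟨i, hi⟩ := hcov _ (x.app (S.fromSpecResidueField z)) (Field.toIsField _)
      obtain ⟨q⟩ : Nonempty (Spec (S.residueField z)) := inferInstance
      have := range_subset_of_inChart (hopen i) _ hi ⟨q, rfl⟩
      rw [Scheme.fromSpecResidueField_apply] at this
      exact ⟨i, this⟩
    rw [Scheme.mem_grothendieckTopology_iff]
    refine ⟨S.openCoverOfIsOpenCover (fun i => chartOpens (u i) x) ?_, ?_⟩
    · rw [TopologicalSpace.IsOpenCover, eq_top_iff]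
      intro z _
      obtain ⟨i, hi⟩ := hx z
      exact TopologicalSpace.Opens.mem_iSup.2 ⟨i, hi⟩
    · rintro _ _ ⟨i⟩
      change I at i
      obtain ⟨k, hk⟩ := exists_chart_hom (hopen i) (hinj i) x
      refine ⟨(Sigma.ι (fun i => yoneda.obj (Spec (P i))) i).app (op _) k, ?_⟩
      have h1 : Sigma.ι (fun i => yoneda.obj (Spec (P i))) i ≫ Sigma.desc f = f i :=
        Sigma.ι_desc f i
      refine (congrArg (fun z => z.app (op (chartOpens (u i) x).toScheme) k) h1).trans ?_
      apply (extensionEquiv hG _).injective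
      exact ((extensionEquiv_chartMap hG (u i) k).trans hk).trans
        (extensionEquiv_map hG (chartOpens (u i) x).ι s).symm
  obtain ⟨M, ⟨r⟩⟩ := Scheme.LocalRepresentability.isRepresentable hf
  refine ⟨M, fun A => (r.homEquiv.trans (extensionEquiv hG (Spec A))).trans
    ⟨fun x => x.app (𝟙 _), NatFam.ofSection, fun x => ?_, fun y => ?_⟩, ?_⟩
  · ext B g
    change G.map (Spec.preimage g) _ = _
    rw [← x.nat, Spec.map_preimage, Category.comp_id]
  · change G.map (Spec.preimage (𝟙 _)) y = y
    rw [Spec.preimage_id, Functor.map_id_apply]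
  · intro A B φ g
    change (extensionEquiv hG _ (r.homEquiv _)).app _ = G.map φ ((extensionEquiv hG _
      (r.homEquiv _)).app _)
    rw [r.homEquiv_comp, extensionEquiv_map, ← NatFam.nat]
    simp [NatFam.pullback]

end ZariskiRepresentability

/-! ### Submodules of `A ^ κ` and their base change -/

namespace CoordinateSpace

variable {κ : Type} [Fintype κ] [DecidableEq κ]

/-! ### Functoriality of base change for submodules of `A ^ κ`. -/

section Extend

variable {A B C : Type u} [CommRing A] [CommRing B] [CommRing C]

/-- The submodule of `B ^ κ` spanned by the image of a submodule of `A ^ κ`. -/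
def extend (φ : A →+* B) (N : Submodule A (κ → A)) : Submodule B (κ → B) :=
  Submodule.span B ((fun v => φ ∘ v) '' (N : Set (κ → A)))

theorem mem_extend (φ : A →+* B) {N : Submodule A (κ → A)} {v : κ → A} (hv : v ∈ N) :
    φ ∘ v ∈ extend φ N :=
  Submodule.subset_span ⟨v, hv, rfl⟩

theorem extend_le {φ : A →+* B} {N : Submodule A (κ → A)} {P : Submodule B (κ → B)} :
    extend φ N ≤ P ↔ ∀ v ∈ N, φ ∘ v ∈ P := by
  rw [extend, Submodule.span_le]
  exact ⟨fun h v hv => h ⟨v, hv, rfl⟩, by rintro h _ ⟨v, hv, rfl⟩; exact h v hv⟩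

theorem extend_mono (φ : A →+* B) {N P : Submodule A (κ → A)} (h : N ≤ P) :
    extend φ N ≤ extend φ P :=
  extend_le.2 fun _ hv => mem_extend φ (h hv)

theorem extend_id (N : Submodule A (κ → A)) : extend (RingHom.id A) N = N :=
  le_antisymm (extend_le.2 fun _ hv => hv) fun _ hv => mem_extend (RingHom.id A) hv

theorem comp_add (φ : A →+* B) (v w : κ → A) : φ ∘ (v + w) = φ ∘ v + φ ∘ w := by
  ext i
  simp

theorem comp_smul (φ : A →+* B) (a : A) (v : κ → A) : φ ∘ (a • v) = φ a • (φ ∘ v) := by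
  ext i
  simp

theorem comp_zero (φ : A →+* B) : φ ∘ (0 : κ → A) = 0 := by
  ext i
  simp

theorem extend_span (φ : A →+* B) (s : Set (κ → A)) :
    extend φ (Submodule.span A s) = Submodule.span B ((fun v => φ ∘ v) '' s) := by
  apply le_antisymm
  · rw [extend_le]
    intro v hv
    induction hv using Submodule.span_induction with
    | mem x hx => exact Submodule.subset_span ⟨x, hx, rfl⟩
    | zero => rw [comp_zero]; exact Submodule.zero_mem _
    | add x y _ _ hx hy => rw [comp_add]; exact Submodule.add_mem _ hx hy
    | smul a x _ hx => rw [comp_smul]; exact Submodule.smul_mem _ _ hx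
  · rw [Submodule.span_le]
    rintro _ ⟨v, hv, rfl⟩
    exact mem_extend φ (Submodule.subset_span hv)

theorem extend_comp (φ : A →+* B) (ψ : B →+* C) (N : Submodule A (κ → A)) :
    extend (ψ.comp φ) N = extend ψ (extend φ N) := by
  conv_rhs => rw [extend.eq_1 φ, extend_span, ← Set.image_comp]
  rfl

theorem extend_sup (φ : A →+* B) (N P : Submodule A (κ → A)) :
    extend φ (N ⊔ P) = extend φ N ⊔ extend φ P := by
  apply le_antisymm
  · rw [extend_le]
    intro v hv
    obtain ⟨x, hx, y, hy, rfl⟩ := Submodule.mem_sup.1 hv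
    rw [comp_add]
    exact Submodule.add_mem_sup (mem_extend φ hx) (mem_extend φ hy)
  · exact sup_le (extend_mono φ le_sup_left) (extend_mono φ le_sup_right)

end Extend

/-! ### Localization and gluing of submodules. -/

section Localization

variable {A : Type u} [CommRing A]

/-- The localization map on `A ^ κ`. -/
noncomputable def locVec (A S : Type u) [CommRing A] [CommRing S] [Algebra A S] :
    (κ → A) →ₗ[A] (κ → S) :=
  LinearMap.pi fun i => Algebra.linearMap A S ∘ₗ LinearMap.proj i

instance (S : Type u) [CommRing S] [Algebra A S] (p : Submonoid A) [IsLocalization p S] :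
    IsLocalizedModule p (locVec (κ := κ) A S) := by
  unfold locVec
  infer_instance

theorem extend_eq_localized' (S : Type u) [CommRing S] [Algebra A S] (p : Submonoid A)
    [IsLocalization p S] (N : Submodule A (κ → A)) :
    extend (algebraMap A S) N = N.localized' S p (locVec A S) := by
  rw [Submodule.localized'_eq_span]
  rfl

theorem exists_pow_smul_mem {S : Type u} [CommRing S] [Algebra A S] {a : A}
    [IsLocalization.Away a S] {N : Submodule A (κ → A)} {v : κ → A}
    (hv : algebraMap A S ∘ v ∈ extend (algebraMap A S) N) :
    ∃ n : ℕ, a ^ n • v ∈ N := by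
  rw [extend_eq_localized' S (Submonoid.powers a)] at hv
  have h1 : N.toLocalizedQuotient' S (Submonoid.powers a)
      (locVec (κ := κ) A S) (Submodule.Quotient.mk v) = 0 := by
    rw [Submodule.toLocalizedQuotient'_mk, Submodule.Quotient.mk_eq_zero]
    exact hv
  obtain ⟨⟨_, n, rfl⟩, hn⟩ := (IsLocalizedModule.eq_zero_iff (Submonoid.powers a) _).1 h1
  exact ⟨n, (Submodule.Quotient.mk_eq_zero N).1 hn⟩

theorem exists_pow_smul_eq {S : Type u} [CommRing S] [Algebra A S] (a : A)
    [IsLocalization.Away a S] (w : κ → S) :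
    ∃ (n : ℕ) (v : κ → A), algebraMap A S a ^ n • w = algebraMap A S ∘ v := by
  obtain ⟨⟨v, ⟨_, n, rfl⟩⟩, h⟩ := IsLocalizedModule.surj (Submonoid.powers a)
    (locVec (κ := κ) A S) w
  refine ⟨n, v, ?_⟩
  rw [← map_pow, algebraMap_smul]
  exact h

/-- Compatibility is used only over the overlap, the localization of `T` at the image of `a`.
Membership there holds in `T` after multiplying by a power of `a`. -/
theorem exists_pow_smul_mem_of_compatible {S T : Type u} [CommRing S] [CommRing T] [Algebra A S]
    [Algebra A T] (a : A) [IsLocalization.Away a S] {N : Submodule S (κ → S)}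
    {P : Submodule T (κ → T)}
    (h : ∀ (B : Type u) [CommRing B] (φ : S →+* B) (ψ : T →+* B),
      φ.comp (algebraMap A S) = ψ.comp (algebraMap A T) → extend φ N = extend ψ P)
    {v : κ → A} (hv : algebraMap A S ∘ v ∈ N) : ∃ k : ℕ, algebraMap A T ∘ (a ^ k • v) ∈ P := by
  have hu : IsUnit ((algebraMap T (Localization.Away (algebraMap A T a))).comp
      (algebraMap A T) a) := IsLocalization.Away.algebraMap_isUnit (algebraMap A T a)
  obtain ⟨φ, hφ⟩ : ∃ φ : S →+* Localization.Away (algebraMap A T a), φ.comp (algebraMap A S) =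
      (algebraMap T _).comp (algebraMap A T) :=
    ⟨IsLocalization.Away.lift a hu, IsLocalization.Away.lift_comp a hu⟩
  have h2 := mem_extend φ hv
  have h3 : φ ∘ algebraMap A S ∘ v = algebraMap T _ ∘ algebraMap A T ∘ v :=
    congrArg (fun χ : A →+* Localization.Away (algebraMap A T a) => χ ∘ v) hφ
  rw [h _ _ _ hφ, h3] at h2
  obtain ⟨k, hk⟩ := exists_pow_smul_mem (a := algebraMap A T a) h2
  refine ⟨k, ?_⟩
  rwa [comp_smul, map_pow]

theorem mem_of_exists_pow_smul_mem {S : Type u} [CommRing S] [Algebra A S] {a : A}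
    [IsLocalization.Away a S] {P : Submodule A (κ → A)} {w : κ → S} {v : κ → A} {m n : ℕ}
    (hw : algebraMap A S a ^ n • w = algebraMap A S ∘ v) (hv : a ^ m • v ∈ P) :
    w ∈ extend (algebraMap A S) P := by
  have hu : IsUnit (algebraMap A S a ^ (m + n)) :=
    (IsLocalization.Away.algebraMap_isUnit a).pow _
  rw [← Submodule.smul_mem_iff_of_isUnit _ hu, pow_add, mul_smul, hw, ← map_pow, ← comp_smul]
  exact mem_extend _ hv

theorem mem_of_forall_loc {s : Finset A} (hs : Ideal.span (s : Set A) = ⊤)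
    {N : Submodule A (κ → A)} {v : κ → A}
    (h : ∀ a ∈ s, algebraMap A (Localization.Away a) ∘ v ∈ extend (algebraMap A _) N) : v ∈ N :=
  Submodule.mem_of_span_eq_top_of_smul_pow_mem N s hs v fun a => exists_pow_smul_mem (h a a.2)

theorem eq_zero_of_forall_loc {s : Finset A} (hs : Ideal.span (s : Set A) = ⊤) {x : A}
    (h : ∀ a ∈ s, algebraMap A (Localization.Away a) x = 0) : x = 0 := by
  have := mem_of_forall_loc (κ := Unit) hs (N := ⊥) (v := fun _ => x) (fun a ha => by
    convert Submodule.zero_mem _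
    ext
    exact h a ha)
  exact congrFun ((Submodule.mem_bot A).1 this) ()

/-- Gluing of submodules of free modules along a cover by basic open sets. -/
theorem exists_glue_submodule {s : Finset A}
    (N : ∀ a : s, Submodule (Localization.Away a.1) (κ → Localization.Away a.1))
    (hN : ∀ (a b : s) (B : Type u) [CommRing B] (φ : Localization.Away a.1 →+* B)
      (ψ : Localization.Away b.1 →+* B), φ.comp (algebraMap A _) = ψ.comp (algebraMap A _) →
      extend φ (N a) = extend ψ (N b)) :
    ∃ P : Submodule A (κ → A), (∀ a : s, extend (algebraMap A _) P = N a) ∧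
      ∀ v, v ∈ P ↔ ∀ a : s, algebraMap A (Localization.Away a.1) ∘ v ∈ N a := by
  classical
  let P : Submodule A (κ → A) := ⨅ a : s, ((N a).restrictScalars A).comap (locVec A _)
  have hP : ∀ v, v ∈ P ↔ ∀ a : s, algebraMap A (Localization.Away a.1) ∘ v ∈ N a := by
    intro v
    simp only [P, Submodule.mem_iInf, Submodule.mem_comap]
    rfl
  refine ⟨P, fun a => le_antisymm (extend_le.2 fun v hv => (hP v).1 hv a) fun w hw => ?_, hP⟩
  obtain ⟨n, v, hv⟩ := exists_pow_smul_eq a.1 w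
  have hv' : algebraMap A (Localization.Away a.1) ∘ v ∈ N a := hv ▸ Submodule.smul_mem _ _ hw
  choose k hk using fun b : s => exists_pow_smul_mem_of_compatible a.1 (hN a b) hv'
  -- Each `b` needs its own power of `a`; the cover is finite, so the sum of the exponents serves
  -- for all of them at once.
  refine mem_of_exists_pow_smul_mem (m := ∑ b, k b) hv ((hP _).2 fun b => ?_)
  rw [← Finset.sum_erase_add _ _ (Finset.mem_univ b), pow_add, mul_smul, comp_smul]
  exact Submodule.smul_mem _ _ (hk b)

theorem extend_ext {s : Finset A} (hs : Ideal.span (s : Set A) = ⊤) {N P : Submodule A (κ → A)}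
    (h : ∀ a ∈ s, extend (algebraMap A (Localization.Away a)) N = extend (algebraMap A _) P) :
    N = P := by
  apply le_antisymm
  · exact fun v hv => mem_of_forall_loc hs fun a ha => h a ha ▸ mem_extend _ hv
  · exact fun v hv => mem_of_forall_loc hs fun a ha => (h a ha).symm ▸ mem_extend _ hv

end Localization

/-- The quotient of `A ^ κ` by `N` is locally free of rank `k`. -/
structure IsGrassmannian {A : Type u} [CommRing A] (k : ℕ) (N : Submodule A (κ → A)) : Prop where
  finite : Module.Finite A ((κ → A) ⧸ N)
  projective : Module.Projective A ((κ → A) ⧸ N)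
  rank : ∀ p, Module.rankAtStalk (R := A) ((κ → A) ⧸ N) p = k

/-! ### Being locally free of rank `k` is Zariski local. -/

section Grassmannian

variable {A : Type u} [CommRing A]

/-- Finite presentation and flatness both descend from the localizations, and a finitely presented
flat module is projective. The rank at a prime is read off in a localization containing it. -/
theorem locallyFree_of_forall_away {k : ℕ} {s : Set A} (hs : Ideal.span s = ⊤)
    (S : s → Type u) [∀ a, CommRing (S a)] [∀ a, Algebra A (S a)]
    [∀ a : s, IsLocalization.Away a.1 (S a)] {Q : Type u} [AddCommGroup Q] [Module A Q]
    (P : s → Type u) [∀ a, AddCommGroup (P a)] [∀ a, Module A (P a)] [∀ a, Module (S a) (P a)]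
    [∀ a, IsScalarTower A (S a) (P a)] (f : ∀ a, Q →ₗ[A] P a)
    [∀ a, IsLocalizedModule (Submonoid.powers a.1) (f a)]
    (hfin : ∀ a, Module.Finite (S a) (P a)) (hproj : ∀ a, Module.Projective (S a) (P a))
    (hrank : ∀ a p, Module.rankAtStalk (R := S a) (P a) p = k) :
    Module.Finite A Q ∧ Module.Projective A Q ∧ ∀ p, Module.rankAtStalk (R := A) Q p = k := by
  have hfp : Module.FinitePresentation A Q :=
    Module.FinitePresentation.of_localizationSpan' s hs (Rₚ := S) f
      (fun a => Module.finitePresentation_of_projective _ _)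
  have hflat : Module.Flat A Q := by
    refine Module.flat_of_isLocalized_span A _ s hs _ f fun a => ?_
    have : Module.Flat A (S a) := IsLocalization.flat _ (Submonoid.powers a.1)
    exact Module.Flat.trans A (S a) _
  refine ⟨inferInstance, Module.Flat.projective_of_finitePresentation, fun p => ?_⟩
  obtain ⟨a, hap⟩ : ∃ a : s, a.1 ∉ p.asIdeal := by
    by_contra! hall
    exact p.2.ne_top (top_le_iff.1 (hs ▸ Ideal.span_le.2 fun a ha => hall ⟨a, ha⟩))
  obtain ⟨q, hq⟩ : p ∈ Set.range (PrimeSpectrum.comap (algebraMap A (S a))) := by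
    rw [PrimeSpectrum.localization_away_comap_range (S a) a.1]
    exact hap
  have h1 := Module.rankAtStalk_isBaseChange (S := S a) (f := f a)
    (IsLocalizedModule.isBaseChange (Submonoid.powers a.1) _ _) q
  rw [hrank, hq] at h1
  exact h1.symm

theorem isGrassmannian_of_forall_away {k : ℕ} {s : Set A} (hs : Ideal.span s = ⊤)
    (S : s → Type u) [∀ a, CommRing (S a)] [∀ a, Algebra A (S a)]
    [∀ a : s, IsLocalization.Away a.1 (S a)] {N : Submodule A (κ → A)}
    (h : ∀ a, IsGrassmannian k (extend (algebraMap A (S a)) N)) :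
    IsGrassmannian k N := by
  have hl : ∀ a, IsGrassmannian k (N.localized' (S a) (Submonoid.powers a.1) (locVec A (S a))) :=
    fun a => extend_eq_localized' (S a) (Submonoid.powers a.1) N ▸ h a
  let f : ∀ a : s, ((κ → A) ⧸ N) →ₗ[A]
      (κ → S a) ⧸ N.localized' (S a) (Submonoid.powers a.1) (locVec A (S a)) :=
    fun a => N.toLocalizedQuotient' (S a) (Submonoid.powers a.1) (locVec A (S a))
  have hf : ∀ a : s, IsLocalizedModule (Submonoid.powers a.1) (f a) := fun a =>
    IsLocalizedModule.toLocalizedQuotient' (S a) (Submonoid.powers a.1) (locVec A (S a)) N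
  obtain ⟨h1, h2, h3⟩ := locallyFree_of_forall_away hs S _ f (fun a => (hl a).finite)
    (fun a => (hl a).projective) (fun a => (hl a).rank)
  exact ⟨h1, h2, h3⟩

theorem isGrassmannian_of_forall_loc {k : ℕ} {s : Finset A} (hs : Ideal.span (s : Set A) = ⊤)
    {N : Submodule A (κ → A)}
    (h : ∀ a : s, IsGrassmannian k (extend (algebraMap A (Localization.Away a.1)) N)) :
    IsGrassmannian k N :=
  isGrassmannian_of_forall_away hs (fun a => Localization.Away a.1) h

end Grassmannian

/-! ### Passage between `A ⊗ L` and `A ^ κ`. -/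

section Coordinates

variable {R L : Type u} [CommRing R] [AddCommGroup L] [Module R L] (b : Module.Basis κ R L)

/-- Coordinates on the base change of a free module. -/
noncomputable def coord (A : Type u) [CommRing A] [Algebra R A] : A ⊗[R] L ≃ₗ[A] (κ → A) :=
  (b.baseChange A).equivFun

theorem coord_tmul (A : Type u) [CommRing A] [Algebra R A] (a : A) (l : L) (i : κ) :
    coord b A (a ⊗ₜ l) i = b.repr l i • a := by
  simp [coord, Module.Basis.equivFun_apply, Module.Basis.baseChange_repr_tmul]

variable {A B : Type u} [CommRing A] [Algebra R A] [CommRing B] [Algebra R B]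

theorem coord_map (f : A →ₐ[R] B) (z : A ⊗[R] L) :
    coord b B (TensorProduct.map f.toLinearMap (LinearMap.id : L →ₗ[R] L) z) =
      f ∘ coord b A z := by
  induction z using TensorProduct.induction_on with
  | zero => ext; simp
  | tmul a l => ext i; simp [coord_tmul]
  | add x y hx hy => ext i; simp [hx, hy]

theorem map_coord {k : ℕ} (f : A →ₐ[R] B) (N : Module.Grassmannian A (A ⊗[R] L) k) :
    (N.map f).toSubmodule.map (coord b B).toLinearMap =
      extend (f : A →+* B) (N.toSubmodule.map (coord b A).toLinearMap) := by
  rw [NaiveSplitting.map_eq_span, Submodule.map_span, extend, ← Set.image_comp]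
  congr 1
  ext v
  simp only [Set.mem_image, Submodule.map_coe, Function.comp_apply, SetLike.mem_coe,
    LinearEquiv.coe_coe, exists_exists_and_eq_and, coord_map]
  rfl

theorem isGrassmannian_map_coord {k : ℕ} (N : Module.Grassmannian A (A ⊗[R] L) k) :
    IsGrassmannian k (N.toSubmodule.map (coord b A).toLinearMap) := by
  let e := Submodule.Quotient.equiv N.toSubmodule _ (coord b A) rfl
  exact ⟨Module.Finite.equiv e, Module.Projective.of_equiv e, fun p => by
    rw [← Module.rankAtStalk_eq_of_equiv e, N.rankAtStalk_eq]⟩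

/-- The point of the Grassmannian of `A ⊗ L` given by a submodule in coordinates. -/
noncomputable def toGrassmannian {k : ℕ} {N : Submodule A (κ → A)} (h : IsGrassmannian k N) :
    Module.Grassmannian A (A ⊗[R] L) k :=
  have e := Submodule.Quotient.equiv (N.map (coord b A).symm.toLinearMap) N (coord b A) (by
    rw [← Submodule.map_comp]; simp)
  { toSubmodule := N.map (coord b A).symm.toLinearMap
    finite_quotient := have := h.finite; Module.Finite.equiv e.symm
    projective_quotient := have := h.projective; Module.Projective.of_equiv e.symm
    rankAtStalk_eq := fun p => by
      have := h.finite
      have := h.projective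
      rw [Module.rankAtStalk_eq_of_equiv e, h.rank] }

theorem map_coord_toGrassmannian {k : ℕ} {N : Submodule A (κ → A)} (h : IsGrassmannian k N) :
    (toGrassmannian b h).toSubmodule.map (coord b A).toLinearMap = N := by
  change (N.map (coord b A).symm.toLinearMap).map _ = N
  rw [← Submodule.map_comp]
  simp

end Coordinates

theorem IsGrassmannian.extend {A B : Type u} [CommRing A] [CommRing B] {k : ℕ}
    {N : Submodule A (κ → A)} (h : IsGrassmannian k N) (φ : A →+* B) :
    IsGrassmannian k (extend φ N) := by
  let : Algebra A B := φ.toAlgebra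
  have := isGrassmannian_map_coord (Pi.basisFun A κ)
    ((toGrassmannian (Pi.basisFun A κ) h).map (Algebra.ofId A B))
  rwa [map_coord, map_coord_toGrassmannian] at this

end CoordinateSpace

/-! ### Affine charts of the Grassmannian -/

namespace CoordinateSpace

open Matrix

variable {κ : Type} [Fintype κ] [DecidableEq κ] {k : ℕ}

/-! ### Submodules given by normalised matrices. -/

section Kernel

variable {A B : Type u} [CommRing A] [CommRing B]

/-- The coordinate submodule spanned by the vectors `e_{c i}`. -/
def stdSpan (A : Type u) [CommRing A] (c : Fin k → κ) : Submodule A (κ → A) :=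
  Submodule.span A (Set.range fun i => Pi.single (c i) 1)

theorem extend_stdSpan (φ : A →+* B) (c : Fin k → κ) :
    extend φ (stdSpan A c) = stdSpan B c := by
  rw [stdSpan, extend_span, ← Set.range_comp]
  congr 2
  ext i j
  simp [Pi.single_apply, apply_ite φ]

/-- The row vectors killed by a matrix. -/
def rowKer (X : Matrix κ (Fin k) A) : Submodule A (κ → A) := X.vecMulLinear.ker

theorem mem_rowKer {X : Matrix κ (Fin k) A} {v : κ → A} : v ∈ rowKer X ↔ v ᵥ* X = 0 :=
  LinearMap.mem_ker

/-- The matrix with rows `e_{c i}`. -/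
def stdRows (A : Type u) [CommRing A] (c : Fin k → κ) : Matrix (Fin k) κ A :=
  (1 : Matrix κ κ A).submatrix c id

/-- A projection onto `rowKer X`. -/
def proj (c : Fin k → κ) (X : Matrix κ (Fin k) A) : Matrix κ κ A := 1 - X * stdRows A c

theorem stdRows_map (φ : A →+* B) (c : Fin k → κ) : (stdRows A c).map φ = stdRows B c := by
  ext i j
  simp [stdRows, Matrix.one_apply, apply_ite φ]

theorem stdRows_mul (c : Fin k → κ) (X : Matrix κ (Fin k) A) :
    stdRows A c * X = X.submatrix c id := by
  ext i j
  simp [stdRows, Matrix.mul_apply, Matrix.one_apply]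

theorem proj_map (φ : A →+* B) (c : Fin k → κ) (X : Matrix κ (Fin k) A) :
    (proj c X).map φ = proj c (X.map φ) := by
  rw [proj, proj, Matrix.map_sub _ (map_sub φ), Matrix.map_mul, stdRows_map,
    Matrix.map_one _ (map_zero φ) (map_one φ)]

variable {c : Fin k → κ} {X : Matrix κ (Fin k) A}

theorem vecMul_proj_of_mem {v : κ → A} (hv : v ∈ rowKer X) : v ᵥ* proj c X = v := by
  rw [proj, Matrix.vecMul_sub, Matrix.vecMul_one, ← Matrix.vecMul_vecMul, mem_rowKer.1 hv,
    Matrix.zero_vecMul, sub_zero]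

theorem vecMul_proj_mem (hX : X.submatrix c id = 1) (w : κ → A) : w ᵥ* proj c X ∈ rowKer X := by
  rw [mem_rowKer, Matrix.vecMul_vecMul, proj, Matrix.sub_mul, Matrix.one_mul, Matrix.mul_assoc,
    stdRows_mul, hX, Matrix.mul_one, sub_self, Matrix.vecMul_zero]

/-- The row kernel is the image of the idempotent `proj c X`, so a condition on its elements becomes
a condition on arbitrary vectors, and hence a matrix identity. -/
theorem forall_mem_rowKer (hX : X.submatrix c id = 1) {p : (κ → A) → Prop} :
    (∀ v ∈ rowKer X, p v) ↔ ∀ w, p (w ᵥ* proj c X) :=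
  ⟨fun h w => h _ (vecMul_proj_mem hX w), fun h v hv => vecMul_proj_of_mem (c := c) hv ▸ h v⟩

theorem rowKer_sup_stdSpan (hX : X.submatrix c id = 1) : rowKer X ⊔ stdSpan A c = ⊤ := by
  rw [eq_top_iff]
  intro v _
  have h1 : v = v ᵥ* proj c X + ∑ i, (v ᵥ* X) i • (Pi.single (c i) 1 : κ → A) := by
    have h2 : (v ᵥ* X) ᵥ* stdRows A c = ∑ i, (v ᵥ* X) i • (Pi.single (c i) 1 : κ → A) := by
      rw [Matrix.vecMul_eq_sum]
      refine Finset.sum_congr rfl fun i _ => congrArg _ ?_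
      ext j
      simp [stdRows, Matrix.one_apply, Pi.single_apply, eq_comm]
    rw [proj, Matrix.vecMul_sub, Matrix.vecMul_one, ← Matrix.vecMul_vecMul, h2, sub_add_cancel]
  rw [h1]
  exact Submodule.add_mem_sup (vecMul_proj_mem hX v) (Submodule.sum_mem _ fun i _ =>
    Submodule.smul_mem _ _ (Submodule.subset_span ⟨i, rfl⟩))

theorem isGrassmannian_rowKer (hX : X.submatrix c id = 1) : IsGrassmannian k (rowKer X) := by
  have hs : Function.Surjective X.vecMulLinear := fun y =>
    ⟨y ᵥ* stdRows A c, by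
      rw [Matrix.vecMulLinear_apply, Matrix.vecMul_vecMul, stdRows_mul, hX, Matrix.vecMul_one]⟩
  let e : ((κ → A) ⧸ rowKer X) ≃ₗ[A] (Fin k → A) := X.vecMulLinear.quotKerEquivOfSurjective hs
  refine ⟨Module.Finite.equiv e.symm, Module.Projective.of_equiv e.symm, fun p => ?_⟩
  have := p.2.ne_top
  have : Nontrivial A := by
    by_contra h
    rw [not_nontrivial_iff_subsingleton] at h
    exact this (Subsingleton.elim _ _)
  rw [Module.rankAtStalk_eq_of_equiv e, Module.rankAtStalk_eq_finrank_of_free]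
  simp

theorem extend_rowKer (φ : A →+* B) (hX : X.submatrix c id = 1) :
    extend φ (rowKer X) = rowKer (X.map φ) := by
  have hX' : (X.map φ).submatrix c id = 1 := by
    change (X.submatrix c id).map φ = 1
    rw [hX, Matrix.map_one _ (map_zero φ) (map_one φ)]
  apply le_antisymm
  · rw [extend_le]
    intro v hv
    rw [mem_rowKer] at hv ⊢
    have := RingHom.map_vecMul φ X v
    ext i
    rw [← RingHom.map_vecMul, hv]
    simp
  · intro v hv
    rw [← vecMul_proj_of_mem (c := c) hv, ← proj_map, Matrix.vecMul_eq_sum]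
    refine Submodule.sum_mem _ fun i _ => Submodule.smul_mem _ _ ?_
    have h1 : (proj c X).row i ∈ rowKer X := by
      have := vecMul_proj_mem hX (Pi.single i 1)
      rwa [Matrix.single_one_vecMul] at this
    exact mem_extend φ h1

/-- If `proj c X` lands in the kernel of `Y`, then `0 = (1 - X * stdRows A c) * Y = Y - X`, because
`Y` is the identity on the rows `c`. -/
theorem eq_of_rowKer_eq {Y : Matrix κ (Fin k) A} (hX : X.submatrix c id = 1)
    (hY : Y.submatrix c id = 1) (h : rowKer X = rowKer Y) : X = Y := by
  have h1 : proj c X * Y = 0 := by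
    ext i j
    have h2 := vecMul_proj_mem hX (Pi.single i 1)
    rw [h, mem_rowKer, Matrix.vecMul_vecMul, Matrix.single_one_vecMul] at h2
    exact congrFun h2 j
  rw [proj, Matrix.sub_mul, Matrix.one_mul, Matrix.mul_assoc, stdRows_mul, hY, Matrix.mul_one,
    sub_eq_zero] at h1
  exact h1.symm

end Kernel

/-! ### Which submodules lie in a Grassmannian chart. -/

section Chart

variable {A B : Type u} [CommRing A] [CommRing B]

/-- Transversality makes the map from `A ^ k` to the quotient surjective. Both sides are locally
free of rank `k`, so it is bijective; its inverse applied to the classes of the standard vectors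
gives the rows of `X`. -/
theorem IsGrassmannian.exists_eq_rowKer {N : Submodule A (κ → A)} (h : IsGrassmannian k N)
    {c : Fin k → κ} (hc : N ⊔ stdSpan A c = ⊤) :
    ∃ X : Matrix κ (Fin k) A, X.submatrix c id = 1 ∧ N = rowKer X := by
  have := h.finite
  have := h.projective
  let f : (Fin k → A) →ₗ[A] ((κ → A) ⧸ N) := N.mkQ ∘ₗ (stdRows A c).vecMulLinear
  have hf1 : ∀ i, f (Pi.single i 1) = N.mkQ (Pi.single (c i) 1) := by
    intro i
    simp only [f, LinearMap.comp_apply, Matrix.vecMulLinear_apply, Matrix.single_one_vecMul]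
    congr 1
    ext j
    simp [stdRows, Matrix.one_apply, Pi.single_apply, eq_comm]
  have hsurj : Function.Surjective f := by
    rw [← LinearMap.range_eq_top, eq_top_iff, ← Submodule.range_mkQ N, LinearMap.range_eq_map,
      ← hc, Submodule.map_sup]
    refine sup_le ?_ ?_
    · rw [Submodule.mkQ_map_self]
      exact bot_le
    · rw [stdSpan, Submodule.map_span, Submodule.span_le]
      rintro _ ⟨_, ⟨i, rfl⟩, rfl⟩
      exact ⟨_, hf1 i⟩
  have hbij : Function.Bijective f := by
    apply Module.bijective_of_surjective_of_rankAtStalk_eq hsurj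
    intro m hm
    have : Nontrivial A := nontrivial_of_ne (0 : A) 1 fun h0 => hm.ne_top
      ((Ideal.eq_top_iff_one m).2 (h0 ▸ m.zero_mem))
    rw [h.rank, Module.rankAtStalk_eq_finrank_of_free]
    simp
  let e := LinearEquiv.ofBijective f hbij
  let X : Matrix κ (Fin k) A := Matrix.of fun j => e.symm (N.mkQ (Pi.single j 1))
  have hX : ∀ v : κ → A, v ᵥ* X = e.symm (N.mkQ v) := by
    intro v
    conv_rhs => rw [pi_eq_sum_univ' v]
    rw [Matrix.vecMul_eq_sum, map_sum, map_sum]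
    refine Finset.sum_congr rfl fun j _ => ?_
    rw [map_smul, map_smul]
    congr 3
  refine ⟨X, ?_, ?_⟩
  · ext i j
    have : e.symm (N.mkQ (Pi.single (c i) 1)) = Pi.single i 1 := by
      rw [← hf1, LinearEquiv.symm_apply_eq]
      rfl
    change e.symm (N.mkQ (Pi.single (c i) 1)) j = _
    rw [this]
    simp [Matrix.one_apply, Pi.single_apply, eq_comm]
  · ext v
    rw [mem_rowKer, hX, LinearEquiv.map_eq_zero_iff, Submodule.mkQ_apply,
      Submodule.Quotient.mk_eq_zero]

/-- The classes of the standard basis vectors span the quotient, so `k` of them form a basis of it.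
-/
theorem IsGrassmannian.exists_stdSpan_of_field {K : Type u} [Field K] {N : Submodule K (κ → K)}
    (h : IsGrassmannian k N) : ∃ c : Fin k → κ, N ⊔ stdSpan K c = ⊤ := by
  have hk : Module.finrank K ((κ → K) ⧸ N) = k := by
    rw [← h.rank ⊥, Module.rankAtStalk_eq_finrank_of_free]
    rfl
  let v : κ → ((κ → K) ⧸ N) := fun j => N.mkQ (Pi.single j 1)
  have hv : Submodule.span K (Set.range v) = ⊤ := by
    have h1 : Set.range v = N.mkQ '' Set.range (fun j => (Pi.single j 1 : κ → K)) := by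
      rw [← Set.range_comp]
      rfl
    rw [h1, ← Submodule.map_span]
    have h2 := (Pi.basisFun K κ).span_eq
    simp only [Pi.basisFun_apply, Set.range] at h2 ⊢
    rw [h2, Submodule.map_top, Submodule.range_mkQ]
  obtain ⟨t, ht, hts, hli⟩ := exists_linearIndependent K (Set.range v)
  let b : Module.Basis t K ((κ → K) ⧸ N) := Module.Basis.mk hli (by simp [hts, hv])
  have hfin : Fintype t := FiniteDimensional.fintypeBasisIndex b
  have hcard : Fintype.card t = k := by rw [← Module.finrank_eq_card_basis b, hk]
  let e : Fin k ≃ t := (Fintype.equivFinOfCardEq hcard).symm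
  choose c hc using fun i => ht (e i).2
  refine ⟨c, ?_⟩
  have h3 : (stdSpan K c).map N.mkQ = ⊤ := by
    rw [stdSpan, Submodule.map_span, ← Set.range_comp, ← hv, ← hts]
    congr 1
    ext x
    constructor
    · rintro ⟨i, rfl⟩
      have := (e i).2
      rw [← hc i] at this
      exact this
    · intro hx
      exact ⟨e.symm ⟨x, hx⟩, by simpa [v] using hc (e.symm ⟨x, hx⟩)⟩
  rw [eq_top_iff]
  intro x _
  have h4 : N.mkQ x ∈ (stdSpan K c).map N.mkQ := h3 ▸ Submodule.mem_top
  obtain ⟨y, hy, hyx⟩ := h4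
  rw [← sub_add_cancel x y]
  refine Submodule.add_mem_sup ?_ hy
  rw [← Submodule.Quotient.mk_eq_zero, Submodule.Quotient.mk_sub, sub_eq_zero]
  exact hyx.symm

/-- A proper subspace is killed by a nonzero functional, whose coefficients remain nonzero in the
larger field. -/
theorem eq_top_of_extend_field_eq_top {K K' : Type u} [Field K] [Field K'] (φ : K →+* K')
    {W : Submodule K (κ → K)} (h : extend φ W = ⊤) : W = ⊤ := by
  by_contra hne
  obtain ⟨f, hf, hW⟩ := Submodule.exists_le_ker_of_lt_top W (lt_top_iff_ne_top.2 hne)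
  let a : κ → K := fun j => f (Pi.single j 1)
  have ha : ∀ v, f v = v ⬝ᵥ a := by
    intro v
    conv_lhs => rw [pi_eq_sum_univ' v]
    rw [map_sum]
    refine Finset.sum_congr rfl fun j _ => ?_
    rw [map_smul, smul_eq_mul]
  have h1 : extend φ W ≤ LinearMap.ker ((LinearMap.lsum K' (fun _ => K') K')
      fun j => LinearMap.mulRight K' (φ (a j))) := by
    rw [extend_le]
    intro v hv
    rw [LinearMap.mem_ker]
    have h2 : v ⬝ᵥ a = 0 := by rw [← ha]; exact hW hv
    have h3 := congrArg φ h2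
    simpa [dotProduct] using h3
  apply hf
  ext j
  rw [h] at h1
  have h2 := h1 (Submodule.mem_top (x := Pi.single j 1))
  rw [LinearMap.mem_ker] at h2
  simpa [Pi.single_apply, a] using h2

theorem subsingleton_tensor_of_extend_eq_top [Algebra A B] {W : Submodule A (κ → A)}
    (h : extend (algebraMap A B) W = ⊤) : Subsingleton (B ⊗[A] ((κ → A) ⧸ W)) := by
  let g : (κ → B) →ₗ[B] B ⊗[A] ((κ → A) ⧸ W) :=
    (LinearMap.lsum B (fun _ => B) B)
      fun j => LinearMap.toSpanSingleton B _ (1 ⊗ₜ W.mkQ (Pi.single j 1))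
  have hg : ∀ v : κ → A, g (algebraMap A B ∘ v) = 1 ⊗ₜ W.mkQ v := by
    intro v
    conv_rhs => rw [pi_eq_sum_univ' v]
    rw [map_sum, TensorProduct.tmul_sum]
    simp only [g, LinearMap.lsum_apply, LinearMap.sum_apply, LinearMap.comp_apply,
      LinearMap.proj_apply, LinearMap.toSpanSingleton_apply, Function.comp_apply]
    refine Finset.sum_congr rfl fun j _ => ?_
    rw [map_smul, TensorProduct.tmul_smul, algebraMap_smul]
  have hg0 : ∀ v, g v = 0 := by
    have : extend (algebraMap A B) W ≤ LinearMap.ker g := by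
      rw [extend_le]
      intro v hv
      rw [LinearMap.mem_ker, hg, Submodule.mkQ_apply, (Submodule.Quotient.mk_eq_zero W).2 hv,
        TensorProduct.tmul_zero]
    intro v
    rw [h] at this
    exact this Submodule.mem_top
  refine ⟨fun x y => ?_⟩
  have hx : ∀ x : B ⊗[A] ((κ → A) ⧸ W), x = 0 := by
    intro x
    induction x using TensorProduct.induction_on with
    | zero => rfl
    | add x y hx hy => rw [hx, hy, add_zero]
    | tmul b q =>
      obtain ⟨v, rfl⟩ := W.mkQ_surjective q
      have := hg v
      rw [hg0] at this
      rw [← mul_one b, ← smul_eq_mul, ← TensorProduct.smul_tmul', ← this, smul_zero]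
  rw [hx x, hx y]

theorem extend_top (φ : A →+* B) : extend φ (⊤ : Submodule A (κ → A)) = ⊤ := by
  rw [eq_top_iff]
  intro v _
  rw [pi_eq_sum_univ' v]
  refine Submodule.sum_mem _ fun j _ => Submodule.smul_mem _ _ ?_
  convert mem_extend φ (Submodule.mem_top (x := (Pi.single j 1 : κ → A))) using 1
  ext i
  simp [Pi.single_apply, eq_comm, apply_ite φ]

/-- The quotient is finite, so its support is the zero locus of its annihilator; `extend φ W` is
everything exactly when `φ` avoids that support. If a maximal ideal of `B` lay over the support, the
fibre there would vanish over its residue field, hence already over the residue field of the prime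
below. This supplies the ideals that make the charts open. -/
theorem extend_eq_top_iff (φ : A →+* B) (W : Submodule A (κ → A)) :
    extend φ W = ⊤ ↔ (Module.annihilator A ((κ → A) ⧸ W)).map φ = ⊤ := by
  constructor
  · intro h
    by_contra hne
    obtain ⟨m, hm, hle⟩ := Ideal.exists_le_maximal _ hne
    have hle' : Module.annihilator A ((κ → A) ⧸ W) ≤ m.comap φ := Ideal.map_le_iff_le_comap.1 hle
    let p : PrimeSpectrum A := ⟨m.comap φ, hm.isPrime.comap φ⟩
    have hp : p ∈ Module.support A ((κ → A) ⧸ W) := by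
      rw [Module.support_eq_zeroLocus]
      exact hle'
    rw [Module.mem_support_iff_nontrivial_residueField_tensorProduct] at hp
    have hmp := hm.isPrime
    let ψ : p.asIdeal.ResidueField →+* m.ResidueField :=
      Ideal.ResidueField.map p.asIdeal m φ rfl
    have h1 : extend (algebraMap A p.asIdeal.ResidueField) W = ⊤ := by
      apply eq_top_of_extend_field_eq_top ψ
      rw [← extend_comp]
      have h2 : ψ.comp (algebraMap A p.asIdeal.ResidueField) =
          (algebraMap B m.ResidueField).comp φ := by
        ext a
        exact Ideal.ResidueField.map_algebraMap _ _ _ _ _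
      rw [h2, extend_comp, h, extend_top]
    have := subsingleton_tensor_of_extend_eq_top h1
    exact not_subsingleton _ this
  · intro h
    have h1 : ∀ x ∈ (Module.annihilator A ((κ → A) ⧸ W)).map φ, ∀ v : κ → B,
        x • v ∈ extend φ W := by
      intro x hx v
      induction hx using Submodule.span_induction with
      | zero => rw [zero_smul]; exact Submodule.zero_mem _
      | add x y _ _ hx hy => rw [add_smul]; exact Submodule.add_mem _ hx hy
      | smul b x _ hx => rw [smul_assoc]; exact Submodule.smul_mem _ _ hx
      | mem x hx =>
        obtain ⟨a, ha, rfl⟩ := hx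
        rw [pi_eq_sum_univ' v, Finset.smul_sum]
        refine Submodule.sum_mem _ fun j _ => ?_
        rw [smul_comm]
        refine Submodule.smul_mem _ _ ?_
        have h3 : a • (Pi.single j 1 : κ → A) ∈ W := by
          rw [← Submodule.Quotient.mk_eq_zero, Submodule.Quotient.mk_smul]
          exact Module.mem_annihilator.1 ha _
        convert mem_extend φ h3 using 1
        ext i
        simp [Pi.single_apply, eq_comm, apply_ite φ]
    rw [eq_top_iff]
    intro v _
    simpa using h1 1 (h ▸ Submodule.mem_top) v

end Chart

end CoordinateSpace

/-! ### Pairs of submodules of a coordinate space satisfying bilinear conditions -/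

namespace ZariskiRepresentability

/-- Maps `R ⟶ A` are morphisms `Spec A ⟶ Spec R`, and these glue along basic opens. -/
theorem exists_glue_hom {A R : CommRingCat.{u}} {s : Finset A} (hs : Ideal.span (s : Set A) = ⊤)
    (ρ : ∀ a : s, R ⟶ CommRingCat.of (Localization.Away a.1))
    (hρ : ∀ (a b : s) (B : CommRingCat.{u}) (φ : CommRingCat.of (Localization.Away a.1) ⟶ B)
      (ψ : CommRingCat.of (Localization.Away b.1) ⟶ B),
      loc A a.1 ≫ φ = loc A b.1 ≫ ψ → ρ a ≫ φ = ρ b ≫ ψ) :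
    ∃ σ : R ⟶ A, ∀ a : s, σ ≫ loc A a.1 = ρ a := by
  let 𝒰 : (Spec A).OpenCover := (Scheme.affineOpenCoverOfSpanRangeEqTop (fun a : s => a.1)
    (by simpa using hs)).openCover
  let f : ∀ a : s, Spec (CommRingCat.of (Localization.Away a.1)) ⟶ Spec R :=
    fun a => Spec.map (ρ a)
  let F : Spec A ⟶ Spec R := 𝒰.glueMorphisms f (by
    intro a b
    refine Scheme.Cover.hom_ext (Limits.pullback (𝒰.f a) (𝒰.f b)).affineCover _ _ fun i => ?_
    let ι := (Limits.pullback (𝒰.f a) (𝒰.f b)).affineCover.f i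
    have h := hρ a b _ (Spec.preimage (ι ≫ Limits.pullback.fst (𝒰.f a) (𝒰.f b)))
      (Spec.preimage (ι ≫ Limits.pullback.snd (𝒰.f a) (𝒰.f b))) (by
        apply Spec.map_injective
        rw [Spec.map_comp, Spec.map_comp, Spec.map_preimage, Spec.map_preimage]
        have := congrArg (ι ≫ ·) (Limits.pullback.condition (f := 𝒰.f a) (g := 𝒰.f b))
        exact (Category.assoc _ _ _).trans (this.trans (Category.assoc _ _ _).symm))
    have h2 := congrArg Spec.map h
    rw [Spec.map_comp, Spec.map_comp, Spec.map_preimage, Spec.map_preimage] at h2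
    exact (Category.assoc _ _ _).symm.trans (h2.trans (Category.assoc _ _ _)))
  refine ⟨Spec.preimage F, fun a => Spec.map_injective ?_⟩
  rw [Spec.map_comp, Spec.map_preimage]
  exact 𝒰.ι_glueMorphisms f _ a

end ZariskiRepresentability

namespace CoordinateSpace

open Matrix ZariskiRepresentability

variable {R : Type u} [CommRing R] {κ : Type} [Fintype κ] [DecidableEq κ]

/-- The matrices defining the conditions on a pair of submodules of a coordinate space: the
operators `t + ϖ` and `t - ϖ` and the bilinear form, for row vectors. -/
structure SplitData (R : Type u) (κ : Type) where
  plus : Matrix κ κ R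
  minus : Matrix κ κ R
  form : Matrix κ κ R

/-- `N₀ ⊆ N₁`, with `N₁` isotropic, `plus` mapping `N₁` to `N₀` and `minus` killing `N₀`. -/
structure IsSplit (D : SplitData R κ) {A : Type u} [CommRing A] (ρ : R →+* A)
    (N₀ N₁ : Submodule A (κ → A)) : Prop where
  le : N₀ ≤ N₁
  isotropic : ∀ x ∈ N₁, ∀ y ∈ N₁, (x ᵥ* D.form.map ρ) ⬝ᵥ y = 0
  plus_mem : ∀ x ∈ N₁, x ᵥ* D.plus.map ρ ∈ N₀
  minus_eq_zero : ∀ x ∈ N₀, x ᵥ* D.minus.map ρ = 0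

/-! ### Base change and locality of the conditions on a pair. -/

section Comp

variable {A B : Type u} [CommRing A] [CommRing B]

theorem comp_vecMul (φ : A →+* B) {ι : Type} (M : Matrix κ ι A) (v : κ → A) :
    φ ∘ (v ᵥ* M) = (φ ∘ v) ᵥ* M.map φ :=
  funext fun i => RingHom.map_vecMul φ M v i

theorem map_comp_ringHom {ι : Type} {ι' : Type} (ρ : R →+* A) (φ : A →+* B) (M : Matrix ι ι' R) :
    M.map (φ.comp ρ) = (M.map ρ).map φ := rfl

theorem forall_mem_extend {φ : A →+* B} {N : Submodule A (κ → A)} (P : Submodule B (κ → B)) :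
    (∀ v ∈ extend φ N, v ∈ P) ↔ ∀ v ∈ N, φ ∘ v ∈ P := extend_le

theorem IsSplit.extend {D : SplitData R κ} {ρ : R →+* A} {N₀ N₁ : Submodule A (κ → A)}
    (h : IsSplit D ρ N₀ N₁) (φ : A →+* B) :
    IsSplit D (φ.comp ρ) (extend φ N₀) (extend φ N₁) := by
  refine ⟨extend_mono φ h.le, fun x hx y hy => ?_, fun x hx => ?_, fun x hx => ?_⟩
  · rw [map_comp_ringHom]
    induction hx using Submodule.span_induction with
    | zero => simp
    | add x x' _ _ hx hx' => rw [Matrix.add_vecMul, add_dotProduct, hx, hx', add_zero]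
    | smul b x _ hx => rw [Matrix.smul_vecMul, smul_dotProduct, hx, smul_zero]
    | mem x hx =>
      obtain ⟨v, hv, rfl⟩ := hx
      induction hy using Submodule.span_induction with
      | zero => simp
      | add y y' _ _ hy hy' => rw [dotProduct_add, hy, hy', add_zero]
      | smul b y _ hy => rw [dotProduct_smul, hy, smul_zero]
      | mem y hy =>
        obtain ⟨w, hw, rfl⟩ := hy
        have h1 := congrArg φ (h.isotropic v hv w hw)
        rw [map_zero, RingHom.map_dotProduct, comp_vecMul] at h1
        exact h1
  · rw [map_comp_ringHom]
    refine (forall_mem_extend ((CoordinateSpace.extend φ N₀).comap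
      ((D.plus.map ρ).map φ).vecMulLinear)).2 (fun v hv => ?_) x hx
    rw [Submodule.mem_comap, Matrix.vecMulLinear_apply, ← comp_vecMul]
    exact mem_extend φ (h.plus_mem v hv)
  · rw [map_comp_ringHom]
    refine (forall_mem_extend (LinearMap.ker
      ((D.minus.map ρ).map φ).vecMulLinear)).2 (fun v hv => ?_) x hx
    rw [LinearMap.mem_ker, Matrix.vecMulLinear_apply, ← comp_vecMul, h.minus_eq_zero v hv,
      comp_zero]

theorem isSplit_of_forall_loc {D : SplitData R κ} {ρ : R →+* A} {N₀ N₁ : Submodule A (κ → A)}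
    {s : Finset A} (hs : Ideal.span (s : Set A) = ⊤)
    (h : ∀ a ∈ s, IsSplit D ((algebraMap A (Localization.Away a)).comp ρ)
      (CoordinateSpace.extend (algebraMap A (Localization.Away a)) N₀)
      (CoordinateSpace.extend (algebraMap A (Localization.Away a)) N₁)) :
    IsSplit D ρ N₀ N₁ := by
  refine ⟨fun x hx => mem_of_forall_loc hs fun a ha => (h a ha).le (mem_extend _ hx),
    fun x hx y hy => eq_zero_of_forall_loc hs fun a ha => ?_,
    fun x hx => mem_of_forall_loc hs fun a ha => ?_, fun x hx => funext fun j =>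
      eq_zero_of_forall_loc hs fun a ha => ?_⟩
  · have := (h a ha).isotropic _ (mem_extend _ hx) _ (mem_extend _ hy)
    rwa [map_comp_ringHom, ← comp_vecMul, ← RingHom.map_dotProduct] at this
  · have := (h a ha).plus_mem _ (mem_extend _ hx)
    rwa [map_comp_ringHom, ← comp_vecMul] at this
  · have := (h a ha).minus_eq_zero _ (mem_extend _ hx)
    rw [map_comp_ringHom, ← comp_vecMul] at this
    exact congrFun this j

end Comp

/-- A ring homomorphism `R → A` and a pair of points of Grassmannians satisfying `IsSplit`. -/
@[ext]
structure SplitPoint (D : SplitData R κ) (k₀ k₁ : ℕ) (A : Type u) [CommRing A] where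
  str : R →+* A
  N₀ : Submodule A (κ → A)
  N₁ : Submodule A (κ → A)
  gr₀ : IsGrassmannian k₀ N₀
  gr₁ : IsGrassmannian k₁ N₁
  split : IsSplit D str N₀ N₁

namespace SplitPoint

variable {D : SplitData R κ} {k₀ k₁ : ℕ} {A B : Type u} [CommRing A] [CommRing B]

/-- Base change of a point. -/
@[simps]
def map (φ : A →+* B) (x : SplitPoint D k₀ k₁ A) : SplitPoint D k₀ k₁ B where
  str := φ.comp x.str
  N₀ := extend φ x.N₀
  N₁ := extend φ x.N₁
  gr₀ := x.gr₀.extend φ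
  gr₁ := x.gr₁.extend φ
  split := x.split.extend φ

variable (D k₀ k₁) in
/-- The functor of points on commutative rings. -/
def functor : CommRingCat.{u} ⥤ Type u where
  obj A := SplitPoint D k₀ k₁ A
  map φ := TypeCat.ofHom fun x => x.map φ.hom
  map_id A := by
    refine ConcreteCategory.hom_ext _ _ fun x => SplitPoint.ext ?_ ?_ ?_
    · exact RingHom.id_comp x.str
    · exact extend_id x.N₀
    · exact extend_id x.N₁
  map_comp φ ψ := by
    refine ConcreteCategory.hom_ext _ _ fun x => SplitPoint.ext ?_ ?_ ?_
    · exact RingHom.comp_assoc x.str φ.hom ψ.hom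
    · exact extend_comp φ.hom ψ.hom x.N₀
    · exact extend_comp φ.hom ψ.hom x.N₁

theorem isZariskiSheaf : IsZariskiSheaf (functor D k₀ k₁) := by
  intro A s hs x hx
  change ∀ a : s, SplitPoint D k₀ k₁ (Localization.Away a.1) at x
  have hx' : ∀ (a b : s) (B : Type u) [CommRing B] (φ : Localization.Away a.1 →+* B)
      (ψ : Localization.Away b.1 →+* B),
      φ.comp (algebraMap A _) = ψ.comp (algebraMap A _) → (x a).map φ = (x b).map ψ := by
    intro a b B _ φ ψ h
    exact hx a b (CommRingCat.of B) (CommRingCat.ofHom φ) (CommRingCat.ofHom ψ)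
      (CommRingCat.hom_ext h)
  obtain ⟨σ, hσ⟩ := exists_glue_hom (R := CommRingCat.of R) hs
    (fun a => CommRingCat.ofHom (x a).str) (fun a b B φ ψ h => CommRingCat.hom_ext
      (congrArg SplitPoint.str (hx' a b B φ.hom ψ.hom (congrArg CommRingCat.Hom.hom h))))
  obtain ⟨P₀, hP₀, -⟩ := exists_glue_submodule (fun a : s => (x a).N₀)
    (fun a b B _ φ ψ h => congrArg SplitPoint.N₀ (hx' a b B φ ψ h))
  obtain ⟨P₁, hP₁, -⟩ := exists_glue_submodule (fun a : s => (x a).N₁)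
    (fun a b B _ φ ψ h => congrArg SplitPoint.N₁ (hx' a b B φ ψ h))
  have hσ' : ∀ a : s, (algebraMap A (Localization.Away a.1)).comp σ.hom = (x a).str :=
    fun a => congrArg CommRingCat.Hom.hom (hσ a)
  let y : SplitPoint D k₀ k₁ A :=
    { str := σ.hom
      N₀ := P₀
      N₁ := P₁
      gr₀ := isGrassmannian_of_forall_loc hs fun a => by rw [hP₀ a]; exact (x a).gr₀
      gr₁ := isGrassmannian_of_forall_loc hs fun a => by rw [hP₁ a]; exact (x a).gr₁
      split := isSplit_of_forall_loc hs fun a ha => by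
        rw [hP₀ ⟨a, ha⟩, hP₁ ⟨a, ha⟩, hσ' ⟨a, ha⟩]
        exact (x ⟨a, ha⟩).split }
  refine ⟨y, fun a => SplitPoint.ext (hσ' a) (hP₀ a) (hP₁ a), ?_⟩
  intro z hz
  change SplitPoint D k₀ k₁ A at z
  have hz' : ∀ a : s, z.map (algebraMap A (Localization.Away a.1)) = x a := hz
  refine SplitPoint.ext ?_ ?_ ?_
  · ext r
    rw [← sub_eq_zero]
    refine eq_zero_of_forall_loc hs fun a ha => ?_
    rw [map_sub, sub_eq_zero]
    exact (DFunLike.congr_fun (congrArg SplitPoint.str (hz' ⟨a, ha⟩)) r).trans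
      (DFunLike.congr_fun (hσ' ⟨a, ha⟩) r).symm
  · exact extend_ext hs fun a ha => (congrArg SplitPoint.N₀ (hz' ⟨a, ha⟩)).trans
      (hP₀ ⟨a, ha⟩).symm
  · exact extend_ext hs fun a ha => (congrArg SplitPoint.N₁ (hz' ⟨a, ha⟩)).trans
      (hP₁ ⟨a, ha⟩).symm

end SplitPoint

end CoordinateSpace

/-! ### Affine charts of the space of split pairs -/

namespace CoordinateSpace

open Matrix ZariskiRepresentability

variable {R : Type u} [CommRing R] {κ : Type} [Fintype κ] [DecidableEq κ]

/-- The set of entries of a matrix. -/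
def entries {A : Type u} {ι ι' : Type} (M : Matrix ι ι' A) : Set A :=
  Set.range fun p : ι × ι' => M p.1 p.2

theorem forall_entries {A B : Type u} [CommRing A] [CommRing B] (φ : A →+* B) {ι ι' : Type}
    (M : Matrix ι ι' A) : (∀ x ∈ entries M, φ x = 0) ↔ M.map φ = 0 := by
  constructor
  · intro h
    ext i j
    exact h _ ⟨(i, j), rfl⟩
  · rintro h _ ⟨⟨i, j⟩, rfl⟩
    exact congrFun (congrFun h i) j

namespace SplitPoint

/-! ### The conditions on a pair as polynomial equations in a chart. -/

section Equations

variable {k₀ k₁ : ℕ} (D : SplitData R κ) (c₀ : Fin k₀ → κ) (c₁ : Fin k₁ → κ)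
  {A B : Type u} [CommRing A] [CommRing B]

/-- The equations for `rowKer X₀` and `rowKer X₁` to be a split pair in a chart. -/
structure Equations (ρ : R →+* A) (X₀ : Matrix κ (Fin k₀) A) (X₁ : Matrix κ (Fin k₁) A) : Prop where
  std₀ : X₀.submatrix c₀ id - 1 = 0
  std₁ : X₁.submatrix c₁ id - 1 = 0
  le : proj c₀ X₀ * X₁ = 0
  isotropic : proj c₁ X₁ * D.form.map ρ * (proj c₁ X₁)ᵀ = 0
  plus : proj c₁ X₁ * D.plus.map ρ * X₀ = 0
  minus : proj c₀ X₀ * D.minus.map ρ = 0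

/-- The set of relations corresponding to `Equations`. -/
def relations (ρ : R →+* A) (X₀ : Matrix κ (Fin k₀) A) (X₁ : Matrix κ (Fin k₁) A) : Set A :=
  entries (X₀.submatrix c₀ id - 1) ∪ entries (X₁.submatrix c₁ id - 1) ∪
    entries (proj c₀ X₀ * X₁) ∪ entries (proj c₁ X₁ * D.form.map ρ * (proj c₁ X₁)ᵀ) ∪
    entries (proj c₁ X₁ * D.plus.map ρ * X₀) ∪ entries (proj c₀ X₀ * D.minus.map ρ)

theorem forall_relations (φ : A →+* B) (ρ : R →+* A) (X₀ : Matrix κ (Fin k₀) A)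
    (X₁ : Matrix κ (Fin k₁) A) : (∀ x ∈ relations D c₀ c₁ ρ X₀ X₁, φ x = 0) ↔
      Equations D c₀ c₁ (φ.comp ρ) (X₀.map φ) (X₁.map φ) := by
  have h1 : ∀ {k : ℕ} (c : Fin k → κ) (X : Matrix κ (Fin k) A),
      (X.submatrix c id - 1).map φ = (X.map φ).submatrix c id - 1 := by
    intro k c X
    rw [Matrix.map_sub _ (map_sub φ), Matrix.map_one _ (map_zero φ) (map_one φ)]
    rfl
  have h2 : (proj c₁ X₁)ᵀ.map φ = (proj c₁ (X₁.map φ))ᵀ := by rw [Matrix.transpose_map, proj_map]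
  simp only [relations, Set.mem_union, or_imp, forall_and, forall_entries, h1, h2, Matrix.map_mul,
    proj_map, ← map_comp_ringHom]
  constructor
  · rintro ⟨⟨⟨⟨⟨h1, h2⟩, h3⟩, h4⟩, h5⟩, h6⟩
    exact ⟨h1, h2, h3, h4, h5, h6⟩
  · rintro ⟨h1, h2, h3, h4, h5, h6⟩
    exact ⟨⟨⟨⟨⟨h1, h2⟩, h3⟩, h4⟩, h5⟩, h6⟩

theorem forall_vecMul_eq_zero {ι ι' : Type} [Fintype ι] [DecidableEq ι] (M : Matrix ι ι' A) :
    (∀ v, v ᵥ* M = 0) ↔ M = 0 := by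
  constructor
  · intro h
    ext i j
    have := congrFun (h (Pi.single i 1)) j
    rwa [Matrix.single_one_vecMul] at this
  · rintro rfl v
    exact Matrix.vecMul_zero v

variable {D c₀ c₁}

/-- Each condition quantifies over a row kernel, so `forall_mem_rowKer` converts it into the
vanishing of a matrix product; isotropy uses the projection on both sides of the form. -/
theorem isSplit_rowKer_iff {ρ : R →+* A} {X₀ : Matrix κ (Fin k₀) A} {X₁ : Matrix κ (Fin k₁) A}
    (h₀ : X₀.submatrix c₀ id = 1) (h₁ : X₁.submatrix c₁ id = 1) :
    IsSplit D ρ (rowKer X₀) (rowKer X₁) ↔ Equations D c₀ c₁ ρ X₀ X₁ := by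
  have hle : rowKer X₀ ≤ rowKer X₁ ↔ proj c₀ X₀ * X₁ = 0 := by
    rw [← forall_vecMul_eq_zero, SetLike.le_def]
    refine (forall_mem_rowKer h₀ (p := fun v => v ∈ rowKer X₁)).trans ?_
    simp only [mem_rowKer, Matrix.vecMul_vecMul]
  have hiso : (∀ x ∈ rowKer X₁, ∀ y ∈ rowKer X₁, (x ᵥ* D.form.map ρ) ⬝ᵥ y = 0) ↔
      proj c₁ X₁ * D.form.map ρ * (proj c₁ X₁)ᵀ = 0 := by
    rw [← forall_vecMul_eq_zero]
    refine (forall_mem_rowKer h₁ (p := fun x => ∀ y ∈ rowKer X₁,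
      (x ᵥ* D.form.map ρ) ⬝ᵥ y = 0)).trans (forall_congr' fun v => ?_)
    refine (forall_mem_rowKer h₁ (p := fun y =>
      ((v ᵥ* proj c₁ X₁) ᵥ* D.form.map ρ) ⬝ᵥ y = 0)).trans ?_
    have : ∀ w, ((v ᵥ* proj c₁ X₁) ᵥ* D.form.map ρ) ⬝ᵥ (w ᵥ* proj c₁ X₁) =
        (v ᵥ* (proj c₁ X₁ * D.form.map ρ * (proj c₁ X₁)ᵀ)) ⬝ᵥ w := by
      intro w
      rw [← Matrix.mulVec_transpose (proj c₁ X₁) w, Matrix.dotProduct_mulVec, Matrix.vecMul_vecMul,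
        Matrix.vecMul_vecMul, Matrix.mul_assoc]
    simp only [this]
    exact ⟨fun h => dotProduct_eq_zero _ h, fun h w => by rw [h, zero_dotProduct]⟩
  have hplus : (∀ x ∈ rowKer X₁, x ᵥ* D.plus.map ρ ∈ rowKer X₀) ↔
      proj c₁ X₁ * D.plus.map ρ * X₀ = 0 := by
    rw [← forall_vecMul_eq_zero]
    refine (forall_mem_rowKer h₁ (p := fun v => v ᵥ* D.plus.map ρ ∈ rowKer X₀)).trans ?_
    simp only [mem_rowKer, Matrix.vecMul_vecMul]
  have hminus : (∀ x ∈ rowKer X₀, x ᵥ* D.minus.map ρ = 0) ↔ proj c₀ X₀ * D.minus.map ρ = 0 := by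
    rw [← forall_vecMul_eq_zero]
    refine (forall_mem_rowKer h₀ (p := fun v => v ᵥ* D.minus.map ρ = 0)).trans ?_
    simp only [Matrix.vecMul_vecMul]
  exact ⟨fun h => ⟨sub_eq_zero.2 h₀, sub_eq_zero.2 h₁, hle.1 h.le, hiso.1 h.isotropic,
    hplus.1 h.plus_mem, hminus.1 h.minus_eq_zero⟩, fun h => ⟨hle.2 h.le, hiso.2 h.isotropic,
    hplus.2 h.plus, hminus.2 h.minus⟩⟩

/-- The point defined by a solution of the equations. -/
def ofEquations {ρ : R →+* A} {X₀ : Matrix κ (Fin k₀) A} {X₁ : Matrix κ (Fin k₁) A}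
    (h : Equations D c₀ c₁ ρ X₀ X₁) : SplitPoint D k₀ k₁ A where
  str := ρ
  N₀ := rowKer X₀
  N₁ := rowKer X₁
  gr₀ := isGrassmannian_rowKer (sub_eq_zero.1 h.std₀)
  gr₁ := isGrassmannian_rowKer (sub_eq_zero.1 h.std₁)
  split := (isSplit_rowKer_iff (sub_eq_zero.1 h.std₀) (sub_eq_zero.1 h.std₁)).2 h

end Equations

/-! ### The coordinate ring of a chart and its universal pair. -/

section Chart

variable {k₀ k₁ : ℕ} (D : SplitData R κ) (c₀ : Fin k₀ → κ) (c₁ : Fin k₁ → κ)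

/-- The coordinate ring of the space of pairs of matrices. -/
abbrev PolyRing (R : Type u) [CommRing R] (κ : Type) (k₀ k₁ : ℕ) : Type u :=
  MvPolynomial ((κ × Fin k₀) ⊕ (κ × Fin k₁)) R

/-- The generic first matrix. -/
noncomputable def generic₀ (R : Type u) [CommRing R] (κ : Type) (k₀ k₁ : ℕ) :
    Matrix κ (Fin k₀) (PolyRing R κ k₀ k₁) := Matrix.of fun i j => MvPolynomial.X (Sum.inl (i, j))

/-- The generic second matrix. -/
noncomputable def generic₁ (R : Type u) [CommRing R] (κ : Type) (k₀ k₁ : ℕ) :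
    Matrix κ (Fin k₁) (PolyRing R κ k₀ k₁) := Matrix.of fun i j => MvPolynomial.X (Sum.inr (i, j))

/-- The ideal of the equations in the generic matrices. -/
noncomputable def chartIdeal : Ideal (PolyRing R κ k₀ k₁) :=
  Ideal.span (relations D c₀ c₁ MvPolynomial.C (generic₀ R κ k₀ k₁) (generic₁ R κ k₀ k₁))

/-- The coordinate ring of a chart. -/
abbrev ChartRing : Type u := PolyRing R κ k₀ k₁ ⧸ chartIdeal D c₀ c₁

/-- The universal point of a chart. -/
noncomputable def chartPoint : SplitPoint D k₀ k₁ (ChartRing D c₀ c₁) :=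
  ofEquations ((forall_relations D c₀ c₁ (Ideal.Quotient.mk (chartIdeal D c₀ c₁))
    MvPolynomial.C (generic₀ R κ k₀ k₁) (generic₁ R κ k₀ k₁)).1 fun _ hx =>
      Ideal.Quotient.eq_zero_iff_mem.2 (Ideal.subset_span hx))

variable {D c₀ c₁} {A B : Type u} [CommRing A] [CommRing B]

theorem chartPoint_std₀ : ((generic₀ R κ k₀ k₁).map
    (Ideal.Quotient.mk (chartIdeal D c₀ c₁))).submatrix c₀ id = 1 :=
  sub_eq_zero.1 ((forall_relations D c₀ c₁ (Ideal.Quotient.mk (chartIdeal D c₀ c₁))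
    MvPolynomial.C (generic₀ R κ k₀ k₁) (generic₁ R κ k₀ k₁)).1 fun _ hx =>
      Ideal.Quotient.eq_zero_iff_mem.2 (Ideal.subset_span hx)).std₀

theorem chartPoint_std₁ : ((generic₁ R κ k₀ k₁).map
    (Ideal.Quotient.mk (chartIdeal D c₀ c₁))).submatrix c₁ id = 1 :=
  sub_eq_zero.1 ((forall_relations D c₀ c₁ (Ideal.Quotient.mk (chartIdeal D c₀ c₁))
    MvPolynomial.C (generic₀ R κ k₀ k₁) (generic₁ R κ k₀ k₁)).1 fun _ hx =>
      Ideal.Quotient.eq_zero_iff_mem.2 (Ideal.subset_span hx)).std₁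

theorem submatrix_map_eq_one (φ : A →+* B) {k : ℕ} {c : Fin k → κ} {X : Matrix κ (Fin k) A}
    (h : X.submatrix c id = 1) : (X.map φ).submatrix c id = 1 := by
  change (X.submatrix c id).map φ = 1
  rw [h, Matrix.map_one _ (map_zero φ) (map_one φ)]

theorem map_chartPoint_N₀ (φ : ChartRing D c₀ c₁ →+* B) :
    ((chartPoint D c₀ c₁).map φ).N₀ = rowKer ((generic₀ R κ k₀ k₁).map
      (φ.comp (Ideal.Quotient.mk (chartIdeal D c₀ c₁)))) :=
  extend_rowKer φ chartPoint_std₀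

theorem map_chartPoint_N₁ (φ : ChartRing D c₀ c₁ →+* B) :
    ((chartPoint D c₀ c₁).map φ).N₁ = rowKer ((generic₁ R κ k₀ k₁).map
      (φ.comp (Ideal.Quotient.mk (chartIdeal D c₀ c₁)))) :=
  extend_rowKer φ chartPoint_std₁

/-- The structure map fixes the constants, and a row kernel determines its normalised matrix, hence
the images of all the variables. -/
theorem chartRing_hom_ext {φ ψ : ChartRing D c₀ c₁ →+* B}
    (h : (chartPoint D c₀ c₁).map φ = (chartPoint D c₀ c₁).map ψ) : φ = ψ := by
  refine Ideal.Quotient.ringHom_ext (MvPolynomial.ringHom_ext (fun r => ?_) ?_)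
  · exact DFunLike.congr_fun (congrArg SplitPoint.str h) r
  · have h₀ := congrArg SplitPoint.N₀ h
    have h₁ := congrArg SplitPoint.N₁ h
    rw [map_chartPoint_N₀, map_chartPoint_N₀] at h₀
    rw [map_chartPoint_N₁, map_chartPoint_N₁] at h₁
    have e₀ := eq_of_rowKer_eq (submatrix_map_eq_one φ chartPoint_std₀)
      (submatrix_map_eq_one ψ chartPoint_std₀) h₀
    have e₁ := eq_of_rowKer_eq (submatrix_map_eq_one φ chartPoint_std₁)
      (submatrix_map_eq_one ψ chartPoint_std₁) h₁
    rintro (⟨i, j⟩ | ⟨i, j⟩)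
    · exact congrFun (congrFun e₀ i) j
    · exact congrFun (congrFun e₁ i) j

theorem exists_map_chartPoint_iff (y : SplitPoint D k₀ k₁ B) :
    (∃ ψ : ChartRing D c₀ c₁ →+* B, (chartPoint D c₀ c₁).map ψ = y) ↔
      y.N₀ ⊔ stdSpan B c₀ = ⊤ ∧ y.N₁ ⊔ stdSpan B c₁ = ⊤ := by
  constructor
  · rintro ⟨ψ, rfl⟩
    rw [map_chartPoint_N₀, map_chartPoint_N₁]
    exact ⟨rowKer_sup_stdSpan (submatrix_map_eq_one ψ chartPoint_std₀),
      rowKer_sup_stdSpan (submatrix_map_eq_one ψ chartPoint_std₁)⟩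
  · rintro ⟨h₀, h₁⟩
    obtain ⟨X₀, hX₀, e₀⟩ := y.gr₀.exists_eq_rowKer h₀
    obtain ⟨X₁, hX₁, e₁⟩ := y.gr₁.exists_eq_rowKer h₁
    have hs := y.split
    rw [e₀, e₁, isSplit_rowKer_iff hX₀ hX₁] at hs
    let ψ : PolyRing R κ k₀ k₁ →+* B := MvPolynomial.eval₂Hom y.str
      (Sum.elim (fun p => X₀ p.1 p.2) (fun p => X₁ p.1 p.2))
    have hψC : ψ.comp MvPolynomial.C = y.str := RingHom.ext fun r => MvPolynomial.eval₂_C _ _ r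
    have hψ₀ : (generic₀ R κ k₀ k₁).map ψ = X₀ := by
      ext i j
      exact MvPolynomial.eval₂_X _ _ _
    have hψ₁ : (generic₁ R κ k₀ k₁).map ψ = X₁ := by
      ext i j
      exact MvPolynomial.eval₂_X _ _ _
    have hker : ∀ x ∈ chartIdeal D c₀ c₁, ψ x = 0 := by
      have : chartIdeal D c₀ c₁ ≤ RingHom.ker ψ := by
        rw [chartIdeal, Ideal.span_le]
        refine (forall_relations D c₀ c₁ ψ _ _ _).2 ?_
        rwa [hψC, hψ₀, hψ₁]
      exact this
    refine ⟨Ideal.Quotient.lift _ ψ hker, SplitPoint.ext hψC ?_ ?_⟩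
    · rw [map_chartPoint_N₀, e₀, ← hψ₀]
      rfl
    · rw [map_chartPoint_N₁, e₁, ← hψ₁]
      rfl

end Chart

/-- The functor of split pairs is represented by a scheme. -/
theorem exists_scheme (D : SplitData R κ) (k₀ k₁ : ℕ) :
    ∃ M : Scheme.{u}, ∃ e : ∀ A : CommRingCat.{u}, (Spec A ⟶ M) ≃ SplitPoint D k₀ k₁ A,
      ∀ (A B : CommRingCat.{u}) (φ : A ⟶ B) (g : Spec A ⟶ M),
        e B (Spec.map φ ≫ g) = (e A g).map φ.hom := by
  let I := ULift.{u} ((Fin k₀ → κ) × (Fin k₁ → κ))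
  have hchart : ∀ (i : I) (B : CommRingCat.{u}) (y : SplitPoint D k₀ k₁ B),
      InChart (G := functor D k₀ k₁) (P := CommRingCat.of (ChartRing D i.down.1 i.down.2))
        (chartPoint D i.down.1 i.down.2) y ↔
      y.N₀ ⊔ stdSpan B i.down.1 = ⊤ ∧ y.N₁ ⊔ stdSpan B i.down.2 = ⊤ := by
    intro i B y
    rw [← exists_map_chartPoint_iff]
    exact ⟨fun ⟨ψ, h⟩ => ⟨ψ.hom, h⟩, fun ⟨ψ, h⟩ => ⟨CommRingCat.ofHom ψ, h⟩⟩
  refine ZariskiRepresentability.exists_scheme (functor D k₀ k₁) isZariskiSheaf (I := I)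
    (fun i => CommRingCat.of (ChartRing D i.down.1 i.down.2))
    (fun i => chartPoint D i.down.1 i.down.2) ?_ ?_ ?_
  · intro i B φ ψ h
    exact CommRingCat.hom_ext (chartRing_hom_ext h)
  · intro i A y
    change SplitPoint D k₀ k₁ A at y
    -- A chart imposes two transversality conditions, each an open locus; the product of the two
    -- ideals cuts out their intersection.
    refine ⟨Module.annihilator A ((κ → A) ⧸ (y.N₀ ⊔ stdSpan A i.down.1)) *
      Module.annihilator A ((κ → A) ⧸ (y.N₁ ⊔ stdSpan A i.down.2)), fun B φ => ?_⟩
    refine (hchart i B (y.map φ.hom)).trans ?_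
    rw [map_N₀, map_N₁, ← extend_stdSpan φ.hom, ← extend_stdSpan φ.hom, ← extend_sup,
      ← extend_sup, extend_eq_top_iff, extend_eq_top_iff, Ideal.map_mul]
    constructor
    · rintro ⟨h1, h2⟩
      rw [h1, h2, Ideal.top_mul]
    · intro h
      exact ⟨top_le_iff.1 (h ▸ Ideal.mul_le_left), top_le_iff.1 (h ▸ Ideal.mul_le_right)⟩
  · intro K y hK
    change SplitPoint D k₀ k₁ K at y
    let _ := hK.toField
    obtain ⟨c₀, h₀⟩ := y.gr₀.exists_stdSpan_of_field
    obtain ⟨c₁, h₁⟩ := y.gr₁.exists_stdSpan_of_field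
    exact ⟨⟨(c₀, c₁)⟩, (hchart _ K y).2 ⟨h₀, h₁⟩⟩

end SplitPoint

end CoordinateSpace

/-! ### Representability over a base ring -/

namespace CoordinateSpace

open Matrix ZariskiRepresentability

variable {R : Type u} [CommRing R] {κ : Type} [Fintype κ] [DecidableEq κ]

namespace SplitPoint

variable (D : SplitData R κ) (k₀ k₁ : ℕ)

/-- Split pairs over `R`-algebras. -/
def overFunctor : CommAlgCat.{u} R ⥤ Type u where
  obj A := {x : SplitPoint D k₀ k₁ A // x.str = algebraMap R A}
  map f := TypeCat.ofHom fun x => ⟨x.1.map f.hom.toRingHom, by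
    rw [map_str, x.2]
    exact f.hom.comp_algebraMap⟩
  map_id A := by
    refine ConcreteCategory.hom_ext _ _ fun x => Subtype.ext (SplitPoint.ext ?_ ?_ ?_)
    · exact RingHom.id_comp x.1.str
    · exact extend_id x.1.N₀
    · exact extend_id x.1.N₁
  map_comp f g := by
    refine ConcreteCategory.hom_ext _ _ fun x => Subtype.ext (SplitPoint.ext ?_ ?_ ?_)
    · exact RingHom.comp_assoc x.1.str f.hom.toRingHom g.hom.toRingHom
    · exact extend_comp f.hom.toRingHom g.hom.toRingHom x.1.N₀
    · exact extend_comp f.hom.toRingHom g.hom.toRingHom x.1.N₁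

/-- A `SplitPoint` carries its own map `R →+* A`, so the scheme represents an absolute functor.
Sending a point to `str` is natural and yields the structure morphism to `Spec R`; points over `R`
are those with the prescribed `str`. -/
theorem exists_over : ∃ M : Over (Spec (CommRingCat.of R)),
    Nonempty (NaiveSplitting.pointsFunctor M ≅ overFunctor D k₀ k₁) := by
  obtain ⟨M, e, he⟩ := exists_scheme D k₀ k₁
  obtain ⟨p, hp⟩ := exists_hom_of_family (T := M) (X := Spec (CommRingCat.of R))
    (fun {A} g => Spec.map (CommRingCat.ofHom (e A g).str)) (by
      intro A B φ g
      rw [he, ← Spec.map_comp]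
      rfl)
  have hstr : ∀ (A : CommAlgCat.{u} R) (g : Spec (CommRingCat.of A) ⟶ M),
      g ≫ p = Spec.map (CommRingCat.ofHom (algebraMap R A)) ↔
        (e (CommRingCat.of A) g).str = algebraMap R A := by
    intro A g
    rw [hp]
    exact ⟨fun h => congrArg CommRingCat.Hom.hom (Spec.map_injective h), fun h => by rw [h]⟩
  let f : ∀ A : CommAlgCat.{u} R, ((NaiveSplitting.pointsFunctor (Over.mk p)).obj A) →
      (overFunctor D k₀ k₁).obj A := fun A h =>
    ⟨e (CommRingCat.of A) (CommaMorphism.left h), (hstr A _).1 (Over.w h)⟩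
  have hf : ∀ A, Function.Bijective (f A) := by
    intro A
    constructor
    · intro h h' hh
      exact Over.OverMorphism.ext ((e (CommRingCat.of A)).injective (congrArg Subtype.val hh))
    · rintro ⟨x, hx⟩
      refine ⟨Over.homMk ((e (CommRingCat.of A)).symm x) ((hstr A _).2 ?_), Subtype.ext ?_⟩
      · rw [Equiv.apply_symm_apply, hx]
      · exact Equiv.apply_symm_apply _ x
  exact ⟨Over.mk p, ⟨NatIso.ofComponents (fun A => (Equiv.ofBijective (f A) (hf A)).toIso) (by
    intro A B φ
    refine ConcreteCategory.hom_ext _ _ fun h => Subtype.ext ?_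
    exact he (CommRingCat.of A) (CommRingCat.of B) (CommRingCat.ofHom φ.hom.toRingHom) _)⟩⟩

end SplitPoint

/-! ### From a form and an operator on a free module to matrices. -/

section Comparison

variable {L : Type u} [AddCommGroup L] [Module R L] (b : Module.Basis κ R L)
  (ϖ : R) (t : L →ₗ[R] L) (β : LinearMap.BilinForm R L)

/-- The matrices of `t + ϖ`, `t - ϖ` and `β` in a basis. -/
noncomputable def SplitData.ofBasis : SplitData R κ where
  plus := Matrix.of (fun i => b.equivFun (t (b i))) + ϖ • 1
  minus := Matrix.of (fun i => b.equivFun (t (b i))) - ϖ • 1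
  form := Matrix.of fun i j => β (b i) (b j)

variable (A : Type u) [CommRing A] [Algebra R A]

theorem coord_one_tmul (i : κ) : coord b A (1 ⊗ₜ b i) = Pi.single i 1 := by
  ext j
  simp [coord_tmul, Finsupp.single_apply, Pi.single_apply, eq_comm]

theorem coord_baseChange (z : A ⊗[R] L) : coord b A (t.baseChange A z) =
    coord b A z ᵥ* (Matrix.of fun i => b.equivFun (t (b i))).map (algebraMap R A) := by
  have : (coord b A).toLinearMap ∘ₗ t.baseChange A =
      ((Matrix.of fun i => b.equivFun (t (b i))).map (algebraMap R A)).vecMulLinear ∘ₗ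
        (coord b A).toLinearMap := by
    refine (b.baseChange A).ext fun i => ?_
    rw [Module.Basis.baseChange_apply]
    simp only [LinearMap.comp_apply, LinearEquiv.coe_coe, LinearMap.baseChange_tmul,
      coord_one_tmul, Matrix.vecMulLinear_apply, Matrix.single_one_vecMul]
    ext j
    simp [coord_tmul, Algebra.smul_def]
  exact LinearMap.congr_fun this z

theorem baseChange_form_apply (z w : A ⊗[R] L) : β.baseChange A z w =
    (coord b A z ᵥ* (Matrix.of fun i j => β (b i) (b j)).map (algebraMap R A)) ⬝ᵥ
      coord b A w := by
  conv_lhs => rw [← (b.baseChange A).sum_equivFun z, ← (b.baseChange A).sum_equivFun w]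
  simp only [map_sum, LinearMap.sum_apply, map_smul, LinearMap.smul_apply,
    Module.Basis.baseChange_apply, LinearMap.BilinForm.baseChange_tmul, smul_eq_mul]
  refine Finset.sum_congr rfl fun j _ => ?_
  rw [mul_comm]
  refine congrArg (· * _) (Finset.sum_congr rfl fun i _ => congrArg (_ * ·) ?_)
  rw [Algebra.smul_def, mul_one, mul_one]
  rfl

theorem map_smul_one (c : R) :
    ((c • 1 : Matrix κ κ R)).map (algebraMap R A) = algebraMap R A c • 1 := by
  ext i j
  by_cases h : i = j <;> simp [h]

theorem vecMul_plus (z : A ⊗[R] L) :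
    coord b A z ᵥ* (SplitData.ofBasis b ϖ t β).plus.map (algebraMap R A) =
      coord b A (t.baseChange A z + ϖ • z) := by
  rw [SplitData.ofBasis, Matrix.map_add _ (map_add _), Matrix.vecMul_add, ← coord_baseChange,
    map_add, map_smul_one, Matrix.vecMul_smul, Matrix.vecMul_one, ← algebraMap_smul A ϖ z,
    map_smul]

theorem vecMul_minus (z : A ⊗[R] L) :
    coord b A z ᵥ* (SplitData.ofBasis b ϖ t β).minus.map (algebraMap R A) =
      coord b A (t.baseChange A z - ϖ • z) := by
  rw [SplitData.ofBasis, Matrix.map_sub _ (map_sub _), Matrix.vecMul_sub, ← coord_baseChange,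
    map_sub, map_smul_one, Matrix.vecMul_smul, Matrix.vecMul_one, ← algebraMap_smul A ϖ z,
    map_smul]

theorem isSplit_map_coord_iff {F₀ F₁ : Submodule A (A ⊗[R] L)} :
    IsSplit (SplitData.ofBasis b ϖ t β) (algebraMap R A) (F₀.map (coord b A).toLinearMap)
      (F₁.map (coord b A).toLinearMap) ↔ NaiveSplitting.IsSplitPair ϖ t β F₀ F₁ := by
  have hmem : ∀ (F : Submodule A (A ⊗[R] L)) z, coord b A z ∈ F.map (coord b A).toLinearMap ↔
      z ∈ F := fun F z => by
    rw [Submodule.mem_map]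
    exact ⟨fun ⟨y, hy, h⟩ => (coord b A).injective h ▸ hy, fun h => ⟨z, h, rfl⟩⟩
  constructor
  · intro h
    refine ⟨fun z hz => (hmem _ _).1 (h.le ((hmem _ _).2 hz)), fun z hz w hw => ?_,
      fun z hz => ?_, fun z hz => ?_⟩
    · rw [baseChange_form_apply b]
      exact h.isotropic _ ((hmem _ _).2 hz) _ ((hmem _ _).2 hw)
    · rw [← hmem, ← vecMul_plus b ϖ t β]
      exact h.plus_mem _ ((hmem _ _).2 hz)
    · rw [← (coord b A).map_eq_zero_iff, ← vecMul_minus b ϖ t β]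
      exact h.minus_eq_zero _ ((hmem _ _).2 hz)
  · intro h
    refine ⟨Submodule.map_mono h.le, ?_, ?_, ?_⟩
    · rintro _ ⟨z, hz, rfl⟩ _ ⟨w, hw, rfl⟩
      exact (baseChange_form_apply b β A z w).symm.trans (h.isotropic z hz w hw)
    · rintro _ ⟨z, hz, rfl⟩
      exact vecMul_plus b ϖ t β A z ▸ (hmem _ _).2 (h.add_mem z hz)
    · rintro _ ⟨z, hz, rfl⟩
      refine (vecMul_minus b ϖ t β A z).trans ?_
      rw [h.apply_sub_eq_zero z hz, map_zero]

/-- In coordinates, the functor of split pairs is `SplitPoint.overFunctor`. -/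
theorem nonempty_iso_overFunctor (n s : ℕ) :
    Nonempty (NaiveSplitting.splitPairFunctor ϖ t β n s ≅
      SplitPoint.overFunctor (SplitData.ofBasis b ϖ t β) (2 * n - s) n) := by
  let f : ∀ A : CommAlgCat.{u} R, (NaiveSplitting.splitPairFunctor ϖ t β n s).obj A →
      (SplitPoint.overFunctor (SplitData.ofBasis b ϖ t β) (2 * n - s) n).obj A := fun A N =>
    ⟨{  str := algebraMap R A
        N₀ := N.1.1.toSubmodule.map (coord b A).toLinearMap
        N₁ := N.1.2.toSubmodule.map (coord b A).toLinearMap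
        gr₀ := isGrassmannian_map_coord b N.1.1
        gr₁ := isGrassmannian_map_coord b N.1.2
        split := (isSplit_map_coord_iff b ϖ t β A).2 N.2 }, rfl⟩
  have hf : ∀ A, Function.Bijective (f A) := by
    intro A
    constructor
    · intro N N' h
      have h₀ : N.1.1.toSubmodule.map (coord b A).toLinearMap =
        N'.1.1.toSubmodule.map (coord b A).toLinearMap := congrArg (fun x => x.1.N₀) h
      have h₁ : N.1.2.toSubmodule.map (coord b A).toLinearMap =
        N'.1.2.toSubmodule.map (coord b A).toLinearMap := congrArg (fun x => x.1.N₁) h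
      exact Subtype.ext (Prod.ext
        (Module.Grassmannian.ext (Submodule.map_injective_of_injective (coord b A).injective h₀))
        (Module.Grassmannian.ext (Submodule.map_injective_of_injective (coord b A).injective h₁)))
    · rintro ⟨x, hx⟩
      have h₀ := map_coord_toGrassmannian b x.gr₀
      have h₁ := map_coord_toGrassmannian b x.gr₁
      refine ⟨⟨(toGrassmannian b x.gr₀, toGrassmannian b x.gr₁),
        (isSplit_map_coord_iff b ϖ t β A).1 ?_⟩, Subtype.ext (SplitPoint.ext hx.symm h₀ h₁)⟩
      rw [h₀, h₁, ← hx]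
      exact x.split
  exact ⟨NatIso.ofComponents (fun A => (Equiv.ofBijective (f A) (hf A)).toIso) (by
    intro A B φ
    refine ConcreteCategory.hom_ext _ _ fun N => Subtype.ext (SplitPoint.ext ?_ ?_ ?_)
    · exact φ.hom.comp_algebraMap.symm
    · exact map_coord b φ.hom N.1.1
    · exact map_coord b φ.hom N.1.2)⟩

end Comparison

end CoordinateSpace

/-! ### A parity obstruction for isotropic subspaces -/

namespace IsotropicParity

variable {K V : Type*} [Field K] [AddCommGroup V] [Module K V]

/-- The Gram matrix is skew, so in odd dimension its determinant equals its own negative, which is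
impossible for a nonzero determinant when `2 ≠ 0`. -/
theorem even_finrank_of_isAlt_of_nondegenerate [FiniteDimensional K V] (h2 : (2 : K) ≠ 0)
    {B : LinearMap.BilinForm K V} (hB : B.IsAlt) (hnd : B.Nondegenerate) : Even (Module.finrank K V) := by
  classical
  let b := Module.finBasis K V
  let M := LinearMap.BilinForm.toMatrix b B
  have hdet : M.det ≠ 0 := (LinearMap.BilinForm.nondegenerate_iff_det_ne_zero b).1 hnd
  have hM : M.transpose = -M := by
    ext i j
    simp only [M, Matrix.transpose_apply, Matrix.neg_apply, LinearMap.BilinForm.toMatrix_apply]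
    exact (LinearMap.IsAlt.neg hB _ _).symm
  have h1 := congrArg Matrix.det hM
  rw [Matrix.det_transpose, Matrix.det_neg, Fintype.card_fin] at h1
  by_contra hodd
  rw [Nat.not_even_iff_odd] at hodd
  rw [hodd.neg_one_pow] at h1
  have h3 : 2 * M.det = 0 := by linear_combination h1
  exact (mul_ne_zero h2 hdet) h3

/-- On a complement of the kernel the form is nondegenerate, so that complement has even dimension.
-/
theorem even_finrank_add_finrank_ker_of_isAlt [FiniteDimensional K V] (h2 : (2 : K) ≠ 0)
    {B : LinearMap.BilinForm K V} (hB : B.IsAlt) :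
    Even (Module.finrank K V + Module.finrank K (LinearMap.ker B)) := by
  obtain ⟨W, hW⟩ := (LinearMap.ker B).exists_isCompl
  have hr : (B.domRestrict₁₂ W W).IsAlt := fun x => hB x
  have hnd : (B.domRestrict₁₂ W W).Nondegenerate := by
    rw [LinearMap.IsRefl.nondegenerate_iff_separatingLeft hr.isRefl]
    rintro ⟨x, hx⟩ h
    have hk : x ∈ LinearMap.ker B := by
      rw [LinearMap.mem_ker]
      ext y
      have hy : y ∈ LinearMap.ker B ⊔ W := hW.sup_eq_top ▸ Submodule.mem_top
      obtain ⟨k, hk, w, hw, rfl⟩ := Submodule.mem_sup.1 hy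
      have h3 : B x k = 0 := by
        rw [hB.eq_iff, LinearMap.mem_ker.1 hk, LinearMap.zero_apply]
      rw [map_add, h3, zero_add]
      exact h ⟨w, hw⟩
    have : x ∈ LinearMap.ker B ⊓ W := ⟨hk, hx⟩
    rw [hW.inf_eq_bot, Submodule.mem_bot] at this
    exact Subtype.ext this
  have h3 := even_finrank_of_isAlt_of_nondegenerate h2 hr hnd
  rw [← Submodule.finrank_add_eq_of_isCompl hW]
  obtain ⟨r, hr⟩ := h3
  exact ⟨Module.finrank K (LinearMap.ker B) + r, by omega⟩

variable [FiniteDimensional K V] {B : LinearMap.BilinForm K V} {t : V →ₗ[K] V} {ϖ : K}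

/-- The heart of the obstruction. The form `A x y = B (P x) y` on `E`, with `P` the projection onto
`N₁` along `C`, is alternating with kernel `N₀ ⊕ (E ∩ C)`, and its rank is even. -/
theorem even_finrank_of_isotropic_isCompl (h2 : (2 : K) ≠ 0) (hϖ : ϖ ≠ 0)
    (hsymm : ∀ x y, B x y = B y x) (hnd : ∀ x, (∀ y, B x y = 0) → x = 0)
    (ht : ∀ x, t (t x) = ϖ ^ 2 • x) (hskew : ∀ x y, B (t x) y = -B x (t y))
    {N₀ N₁ C E : Submodule K V} (hE : ∀ x, x ∈ E ↔ t x = ϖ • x) (hc : IsCompl N₁ C)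
    (hN : ∀ x ∈ N₁, ∀ y ∈ N₁, B x y = 0) (hC : ∀ x ∈ C, ∀ y ∈ C, B x y = 0) (hle : N₀ ≤ N₁)
    (hadd : ∀ x ∈ N₁, t x + ϖ • x ∈ N₀) (hsub : N₀ ≤ E) :
    Even (Module.finrank K E + (Module.finrank K N₀ + Module.finrank K (E ⊓ C : Submodule K V))) := by
  have h2ϖ : 2 * ϖ ≠ 0 := mul_ne_zero h2 hϖ
  have hN₀ : ∀ x, x ∈ N₀ ↔ x ∈ E ∧ x ∈ N₁ := by
    refine fun x => ⟨fun hx => ⟨hsub hx, hle hx⟩, fun ⟨hxE, hx⟩ => ?_⟩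
    have h3 := hadd x hx
    rw [(hE x).1 hxE, ← two_smul K, smul_smul] at h3
    exact (Submodule.smul_mem_iff _ h2ϖ).1 h3
  -- `E` is its own orthogonal complement
  have hEE : ∀ x, x ∈ E ↔ ∀ y ∈ E, B x y = 0 := by
    intro x
    constructor
    · intro hx y hy
      have h3 := hskew x y
      rw [(hE x).1 hx, (hE y).1 hy, map_smul, map_smul, LinearMap.smul_apply, smul_eq_mul] at h3
      have h4 : 2 * ϖ * B x y = 0 := by linear_combination h3
      exact (mul_eq_zero.1 h4).resolve_left h2ϖ
    · intro hx
      rw [hE, ← sub_eq_zero]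
      apply hnd
      intro y
      -- Since `t² = ϖ²`, the operator `t + ϖ` maps everything into `E`. Moving it across the skew
      -- relation gives `B (t x - ϖ x) y = 0` for all `y`.
      have h3 := hx (t y + ϖ • y) ((hE _).2 (by rw [map_add, ht, map_smul, smul_add, smul_smul,
        ← pow_two, add_comm]))
      rw [map_add, map_smul] at h3
      rw [map_sub, map_smul, LinearMap.sub_apply, hskew, LinearMap.smul_apply]
      linear_combination -h3
  let P : V →ₗ[K] V := Submodule.projection N₁ C hc
  have hP : ∀ x, P x ∈ N₁ := fun x => Submodule.projection_apply_mem hc x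
  have hP' : ∀ x, x - P x ∈ C := fun x => Submodule.sub_projection_mem hc x
  let A : LinearMap.BilinForm K E := LinearMap.compl₁₂ B (P ∘ₗ E.subtype) E.subtype
  have hA : ∀ x y : E, A x y = B (P x) y := fun _ _ => rfl
  -- Expanding `B x x = 0` along `x = P x + (x - P x)`, the isotropy of `N₁` and of `C` leaves `2 *
  -- B (P x) (x - P x) = 0`, which is twice `A x x`.
  have hAalt : A.IsAlt := by
    intro x
    rw [hA]
    have h3 := (hEE x).1 x.2 x x.2
    have h4 : (x : V) = P x + (x - P x) := by abel
    have h5 : B (P x) x = B (P x) (x - P x) := by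
      rw [map_sub, hN _ (hP _) _ (hP _), sub_zero]
    rw [h5]
    rw [h4, map_add, map_add, LinearMap.add_apply, LinearMap.add_apply, hN _ (hP _) _ (hP _),
      hC _ (hP' _) _ (hP' _), hsymm (x - P x) (P x), zero_add, add_zero, ← two_mul] at h3
    exact (mul_eq_zero.1 h3).resolve_left h2
  -- If `x` is in the kernel, `P x` is orthogonal to `E` and so lies in `E`; both components of `x`
  -- are then in `E`.
  have hker : (LinearMap.ker A).map E.subtype = N₀ ⊔ (E ⊓ C) := by
    apply le_antisymm
    · rintro _ ⟨x, hx, rfl⟩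
      have h3 : P x ∈ E := (hEE _).2 fun y hy => LinearMap.congr_fun (LinearMap.mem_ker.1 hx) ⟨y, hy⟩
      have h4 : (x : V) = P x + (x - P x) := by abel
      rw [Submodule.subtype_apply, h4]
      exact Submodule.add_mem_sup ((hN₀ _).2 ⟨h3, hP _⟩) ⟨E.sub_mem x.2 h3, hP' _⟩
    · refine sup_le (fun x hx => ?_) fun x hx => ?_
      · have h3 := (hN₀ x).1 hx
        refine ⟨⟨x, h3.1⟩, ?_, rfl⟩
        rw [SetLike.mem_coe, LinearMap.mem_ker]
        ext y
        have h4 : P x = x := Submodule.projection_apply_left hc ⟨x, h3.2⟩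
        rw [hA, h4]
        exact (hEE x).1 h3.1 y y.2
      · refine ⟨⟨x, hx.1⟩, ?_, rfl⟩
        rw [SetLike.mem_coe, LinearMap.mem_ker]
        ext y
        have h4 : P x = 0 := Submodule.projection_apply_right hc ⟨x, hx.2⟩
        rw [hA, h4, map_zero, LinearMap.zero_apply, LinearMap.zero_apply]
  have hinf : N₀ ⊓ (E ⊓ C) = ⊥ := by
    rw [eq_bot_iff, ← hc.inf_eq_bot]
    exact fun x hx => ⟨hle hx.1, hx.2.2⟩
  have h3 := even_finrank_add_finrank_ker_of_isAlt h2 hAalt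
  have h4 := Submodule.finrank_sup_add_finrank_inf_eq N₀ (E ⊓ C)
  rw [hinf, finrank_bot, add_zero, ← hker, Submodule.finrank_map_subtype_eq] at h4
  rwa [h4] at h3

end IsotropicParity

/-! ### Coordinate subspaces -/

namespace CoordinateSpace

open Matrix

section CoordKer

variable {κ : Type} [Fintype κ] [DecidableEq κ]

/-- The vectors whose coordinates in `S` vanish. -/
def coordKer (A : Type u) [CommRing A] (S : Finset κ) : Submodule A (κ → A) :=
  Submodule.pi (S : Set κ) fun _ => ⊥

theorem mem_coordKer {A : Type u} [CommRing A] {S : Finset κ} {v : κ → A} :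
    v ∈ coordKer A S ↔ ∀ j ∈ S, v j = 0 := by
  simp [coordKer, Submodule.mem_pi]

theorem coordKer_eq_rowKer (A : Type u) [CommRing A] (S : Finset κ) :
    ∃ (c : Fin S.card → κ) (X : Matrix κ (Fin S.card) A), X.submatrix c id = 1 ∧
      coordKer A S = rowKer X := by
  let c : Fin S.card → κ := fun i => (S.equivFin.symm i).1
  have hc : Function.Injective c := Subtype.val_injective.comp S.equivFin.symm.injective
  refine ⟨c, Matrix.of fun j i => if j = c i then 1 else 0, ?_, ?_⟩
  · ext i j
    simp [Matrix.one_apply, hc.eq_iff]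
  · ext v
    have : v ᵥ* (Matrix.of fun j i => if j = c i then 1 else 0) = fun i => v (c i) := by
      ext i
      simp [Matrix.vecMul, dotProduct]
    rw [mem_coordKer, mem_rowKer, this]
    constructor
    · intro h
      ext i
      exact h _ (S.equivFin.symm i).2
    · intro h j hj
      have := congrFun h (S.equivFin ⟨j, hj⟩)
      simpa [c] using this

theorem isGrassmannian_coordKer (A : Type u) [CommRing A] (S : Finset κ) :
    IsGrassmannian S.card (coordKer A S) := by
  obtain ⟨c, X, hX, h⟩ := coordKer_eq_rowKer A S
  exact h ▸ isGrassmannian_rowKer hX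

theorem IsGrassmannian.finrank_add {K : Type u} [Field K] {k : ℕ} {N : Submodule K (κ → K)}
    (h : IsGrassmannian k N) : k + Module.finrank K N = Fintype.card κ := by
  have hk : Module.finrank K ((κ → K) ⧸ N) = k := by
    rw [← h.rank ⊥, Module.rankAtStalk_eq_finrank_of_free]
    rfl
  rw [← hk, Submodule.finrank_quotient_add_finrank, Module.finrank_fintype_fun_eq_card]

theorem extend_coordKer {A B : Type u} [CommRing A] [CommRing B] (φ : A →+* B) (S : Finset κ) :
    extend φ (coordKer A S) = coordKer B S := by
  apply le_antisymm
  · rw [extend_le]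
    intro v hv
    rw [mem_coordKer] at hv ⊢
    intro j hj
    rw [Function.comp_apply, hv j hj, map_zero]
  · intro v hv
    rw [mem_coordKer] at hv
    rw [pi_eq_sum_univ' v]
    refine Submodule.sum_mem _ fun j _ => ?_
    by_cases hj : j ∈ S
    · rw [hv j hj, zero_smul]
      exact Submodule.zero_mem _
    · refine Submodule.smul_mem _ _ ?_
      have h1 : (Pi.single j 1 : κ → A) ∈ coordKer A S := mem_coordKer.2 fun i hi =>
        Pi.single_eq_of_ne (by rintro rfl; exact hj hi) _
      convert mem_extend φ h1 using 1
      ext i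
      simp [Pi.single_apply, eq_comm, apply_ite φ]

theorem coordKer_sup_compl (A : Type u) [CommRing A] (S : Finset κ) :
    coordKer A S ⊔ coordKer A Sᶜ = ⊤ := by
  rw [eq_top_iff]
  intro v _
  have : v = (fun j => if j ∈ S then 0 else v j) + fun j => if j ∈ S then v j else 0 := by
    ext j
    by_cases hj : j ∈ S <;> simp [hj]
  rw [this]
  refine Submodule.add_mem_sup (mem_coordKer.2 fun j hj => if_pos hj)
    (mem_coordKer.2 fun j hj => if_neg (Finset.mem_compl.1 hj))

end CoordKer

end CoordinateSpace

/-! ### The split model in coordinates -/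

namespace SplitModel

open Matrix CoordinateSpace

/-- The index set of a basis `f_i, π f_i` of the lattice; the index `(0, i)` stands for `f_i` and
`(1, i)` for `π f_i`. -/
abbrev Idx (m : ℕ) : Type := Fin 2 × Fin (2 * m)

variable {R : Type u} [CommRing R] {m : ℕ} (ϖ : R)

/-- The sign in the values of the form on basis vectors. -/
def sign (R : Type u) [CommRing R] (i : Fin (2 * m)) : R := if i.val < m then 1 else -1

/-- The matrix of multiplication by `π`. -/
def opMatrix (m : ℕ) : Matrix (Idx m) (Idx m) R :=
  Matrix.of fun a b => if a.2 = b.2 then !![0, 1; ϖ ^ 2, 0] a.1 b.1 else 0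

/-- The matrix of the symmetric form. -/
def formMatrix (R : Type u) [CommRing R] (m : ℕ) : Matrix (Idx m) (Idx m) R :=
  Matrix.of fun a b => if b.2 = a.2.rev then !![0, -1; 1, 0] a.1 b.1 * sign R a.2 else 0

/-- The matrices defining the naive splitting model. -/
def data (m : ℕ) : SplitData R (Idx m) where
  plus := opMatrix ϖ m + ϖ • 1
  minus := opMatrix ϖ m - ϖ • 1
  form := formMatrix R m

/-! ### Explicit action of the operator and the form. -/

section Formulas

variable {A : Type u} [CommRing A] (ρ : R →+* A)

theorem opMatrix_map : (opMatrix ϖ m).map ρ = opMatrix (ρ ϖ) m := by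
  ext ⟨a, i⟩ ⟨b, j⟩
  fin_cases a <;> fin_cases b <;> by_cases h : i = j <;> simp [opMatrix, h]

theorem sign_map (i : Fin (2 * m)) : ρ (sign R i) = sign A i := by
  simp [sign, apply_ite ρ]

theorem formMatrix_map : (formMatrix R m).map ρ = formMatrix A m := by
  ext ⟨a, i⟩ ⟨b, j⟩
  fin_cases a <;> fin_cases b <;> by_cases h : j = i.rev <;> simp [formMatrix, h, sign_map]

theorem smul_one_map : (ϖ • (1 : Matrix (Idx m) (Idx m) R)).map ρ = ρ ϖ • 1 := by
  ext i j
  by_cases h : i = j <;> simp [h]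

theorem plus_map : (data ϖ m).plus.map ρ = opMatrix (ρ ϖ) m + ρ ϖ • 1 := by
  rw [data, Matrix.map_add _ (map_add ρ), opMatrix_map, smul_one_map]

theorem minus_map : (data ϖ m).minus.map ρ = opMatrix (ρ ϖ) m - ρ ϖ • 1 := by
  rw [data, Matrix.map_sub _ (map_sub ρ), opMatrix_map, smul_one_map]

theorem vecMul_opMatrix_zero (x : Idx m → R) (i : Fin (2 * m)) :
    (x ᵥ* opMatrix ϖ m) (0, i) = ϖ ^ 2 * x (1, i) := by
  simp [Matrix.vecMul, dotProduct, Fintype.sum_prod_type, opMatrix, mul_comm]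

theorem vecMul_opMatrix_one (x : Idx m → R) (i : Fin (2 * m)) :
    (x ᵥ* opMatrix ϖ m) (1, i) = x (0, i) := by
  simp [Matrix.vecMul, dotProduct, Fintype.sum_prod_type, opMatrix]

theorem sign_rev (i : Fin (2 * m)) : sign R i.rev = -sign R i := by
  unfold sign
  rw [Fin.val_rev]
  have := i.2
  split_ifs <;> first | omega | simp

theorem sign_mul_self (i : Fin (2 * m)) : sign R i * sign R i = 1 := by
  unfold sign
  split_ifs <;> simp

theorem vecMul_formMatrix_zero (x : Idx m → R) (i : Fin (2 * m)) :
    (x ᵥ* formMatrix R m) (0, i) = x (1, i.rev) * sign R i.rev := by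
  have : ∀ j : Fin (2 * m), i = j.rev ↔ i.rev = j := fun j => by rw [← Fin.rev_inj, Fin.rev_rev]
  simp [Matrix.vecMul, dotProduct, Fintype.sum_prod_type, formMatrix, this]

theorem vecMul_formMatrix_one (x : Idx m → R) (i : Fin (2 * m)) :
    (x ᵥ* formMatrix R m) (1, i) = x (0, i.rev) * sign R i := by
  have : ∀ j : Fin (2 * m), i = j.rev ↔ i.rev = j := fun j => by rw [← Fin.rev_inj, Fin.rev_rev]
  simp [Matrix.vecMul, dotProduct, Fintype.sum_prod_type, formMatrix, this, sign_rev]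

theorem form_apply (x y : Idx m → R) : (x ᵥ* formMatrix R m) ⬝ᵥ y =
    ∑ i, sign R i * (x (1, i) * y (0, i.rev) + x (0, i.rev) * y (1, i)) := by
  rw [dotProduct, Fintype.sum_prod_type, Fin.sum_univ_two]
  simp only [vecMul_formMatrix_zero, vecMul_formMatrix_one]
  rw [← Equiv.sum_comp Fin.revPerm, ← Finset.sum_add_distrib]
  refine Finset.sum_congr rfl fun i _ => ?_
  simp only [Fin.revPerm_apply, Fin.rev_rev]
  ring

end Formulas

/-- A set of indices of a Lagrangian coordinate subspace. -/
def IsLagrangian (S : Finset (Idx m)) : Prop :=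
  ∀ i : Fin (2 * m), ((1 : Fin 2), i) ∈ S ↔ ((0 : Fin 2), i.rev) ∉ S

theorem IsLagrangian.isotropic {S : Finset (Idx m)} (hS : IsLagrangian S) {x y : Idx m → R}
    (hx : x ∈ coordKer R S) (hy : y ∈ coordKer R S) : (x ᵥ* formMatrix R m) ⬝ᵥ y = 0 := by
  rw [mem_coordKer] at hx hy
  rw [form_apply]
  refine Finset.sum_eq_zero fun i _ => ?_
  by_cases h : ((1 : Fin 2), i) ∈ S
  · rw [hx _ h, hy _ h]
    ring
  · have h' : ((0 : Fin 2), i.rev) ∈ S := by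
      by_contra h1
      exact h ((hS i).2 h1)
    rw [hx _ h', hy _ h']
    ring

theorem IsLagrangian.compl {S : Finset (Idx m)} (hS : IsLagrangian S) : IsLagrangian Sᶜ := by
  intro i
  have := hS i
  simp only [Finset.mem_compl]
  tauto

theorem IsLagrangian.card {S : Finset (Idx m)} (hS : IsLagrangian S) : S.card = 2 * m := by
  have h1 : S.card = ∑ a : Idx m, if a ∈ S then 1 else 0 := by simp
  rw [h1, Fintype.sum_prod_type, Fin.sum_univ_two, ← Equiv.sum_comp Fin.revPerm,
    ← Finset.sum_add_distrib]
  have h2 : ∀ i : Fin (2 * m), ((if ((0 : Fin 2), Fin.revPerm i) ∈ S then 1 else 0) +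
      if ((1 : Fin 2), i) ∈ S then 1 else 0) = 1 := by
    intro i
    rw [Fin.revPerm_apply]
    by_cases h : ((1 : Fin 2), i) ∈ S
    · simp [h, (hS i).1 h]
    · have h' : ((0 : Fin 2), i.rev) ∈ S := by
        by_contra h1
        exact h ((hS i).2 h1)
      simp [h, h']
  rw [Finset.sum_congr rfl fun i _ => h2 i]
  simp

/-! ### The parity constraint relative to coordinate Lagrangians. -/

section Parity

variable {K : Type u} [Field K] {ϖ : R}

/-- The parametrization of the eigenspace of `t` by the coordinates of `π f_i`. -/
def eigenMap (p : K) : (Fin (2 * m) → K) →ₗ[K] (Idx m → K) :=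
  LinearMap.pi fun a => if a.1 = 0 then p • LinearMap.proj a.2 else LinearMap.proj a.2

theorem eigenMap_zero (p : K) (v : Fin (2 * m) → K) (i : Fin (2 * m)) :
    eigenMap p v (0, i) = p * v i := by
  simp [eigenMap]

theorem eigenMap_one (p : K) (v : Fin (2 * m) → K) (i : Fin (2 * m)) :
    eigenMap p v (1, i) = v i := by
  simp [eigenMap]

theorem eigenMap_injective (p : K) : Function.Injective (eigenMap (m := m) p) := by
  intro v w h
  ext i
  rw [← eigenMap_one p v, h, eigenMap_one]

theorem ext_idx {A : Type u} {x y : Idx m → A} (h0 : ∀ i, x (0, i) = y (0, i))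
    (h1 : ∀ i, x (1, i) = y (1, i)) : x = y := by
  ext ⟨a, i⟩
  fin_cases a
  · exact h0 i
  · exact h1 i

theorem mem_range_eigenMap {p : K} {x : Idx m → K} :
    x ∈ LinearMap.range (eigenMap p) ↔ x ᵥ* opMatrix p m = p • x := by
  constructor
  · rintro ⟨v, rfl⟩
    refine ext_idx (fun i => ?_) fun i => ?_
    · rw [vecMul_opMatrix_zero, eigenMap_one, Pi.smul_apply, eigenMap_zero, smul_eq_mul]
      ring
    · rw [vecMul_opMatrix_one, eigenMap_zero, Pi.smul_apply, eigenMap_one, smul_eq_mul]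
  · intro h
    refine ⟨fun i => x (1, i), ext_idx (fun i => ?_) fun i => eigenMap_one _ _ _⟩
    have := congrFun h (1, i)
    rw [vecMul_opMatrix_one, Pi.smul_apply, smul_eq_mul] at this
    rw [eigenMap_zero, this]

/-- The indices of the basis of the intersection of the eigenspace of `t` with a coordinate
subspace. -/
def eigenIdx (S : Finset (Idx m)) : Finset (Fin (2 * m)) :=
  Finset.univ.filter fun i => ((0 : Fin 2), i) ∈ S ∧ ((1 : Fin 2), i) ∈ S

/-- An eigenvector has entries `p * v i` at `(0, i)` and `v i` at `(1, i)`. As `p ≠ 0`, being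
supported on `S` forces `v i = 0` unless both indices belong to `S`. -/
theorem range_eigenMap_inf {p : K} (hp : p ≠ 0) (S : Finset (Idx m)) :
    LinearMap.range (eigenMap p) ⊓ coordKer K Sᶜ =
      (coordKer K (eigenIdx S)ᶜ).map (eigenMap p) := by
  ext x
  constructor
  · rintro ⟨⟨v, rfl⟩, h⟩
    rw [SetLike.mem_coe, mem_coordKer] at h
    refine ⟨v, mem_coordKer.2 fun i hi => ?_, rfl⟩
    rw [Finset.mem_compl, eigenIdx, Finset.mem_filter] at hi
    by_cases h1 : ((1 : Fin 2), i) ∈ S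
    · have h2 := h (0, i) (Finset.mem_compl.2 fun h0 => hi ⟨Finset.mem_univ _, h0, h1⟩)
      rw [eigenMap_zero] at h2
      exact (mul_eq_zero.1 h2).resolve_left hp
    · have h2 := h (1, i) (Finset.mem_compl.2 h1)
      rwa [eigenMap_one] at h2
  · rintro ⟨v, hv, rfl⟩
    rw [SetLike.mem_coe, mem_coordKer] at hv
    refine ⟨⟨v, rfl⟩, mem_coordKer.2 ?_⟩
    have hv' : ∀ i, ¬(((0 : Fin 2), i) ∈ S ∧ ((1 : Fin 2), i) ∈ S) → v i = 0 := fun i hi =>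
      hv i (by simpa [eigenIdx] using hi)
    rintro ⟨a, i⟩ ha
    rw [Finset.mem_compl] at ha
    fin_cases a
    · refine (eigenMap_zero p v i).trans ?_
      rw [hv' i fun h => ha h.1, mul_zero]
    · exact (eigenMap_one p v i).trans (hv' i fun h => ha h.2)

/-- The abstract parity statement with `C` spanned by the coordinate vectors indexed by `S`.
Dimensions add up to that of the whole space, so transversality makes `C` a complement; the even
number `dim E = 2 * m` drops out. -/
theorem even_of_isSplit {ρ : R →+* K} (h2 : (2 : K) ≠ 0) (hp : ρ ϖ ≠ 0) {S : Finset (Idx m)}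
    (hS : IsLagrangian S) {s : ℕ} (hs : s ≤ 2 * (2 * m)) {N₀ N₁ : Submodule K (Idx m → K)}
    (h₀ : IsGrassmannian (2 * (2 * m) - s) N₀) (h₁ : IsGrassmannian (2 * m) N₁)
    (hN : IsSplit (data ϖ m) ρ N₀ N₁) (hc : N₁ ⊔ coordKer K Sᶜ = ⊤) :
    Even (s + (eigenIdx S).card) := by
  have hcard : Fintype.card (Idx m) = 2 * (2 * m) := by simp
  have d₀ := h₀.finrank_add
  have d₁ := h₁.finrank_add
  have dC := (isGrassmannian_coordKer K Sᶜ).finrank_add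
  rw [hS.compl.card] at dC
  rw [hcard] at d₀ d₁ dC
  have hc' : IsCompl N₁ (coordKer K Sᶜ) := by
    rw [isCompl_iff, codisjoint_iff, disjoint_iff]
    refine ⟨?_, hc⟩
    have h3 := Submodule.finrank_sup_add_finrank_inf_eq N₁ (coordKer K Sᶜ)
    rw [hc, finrank_top, Module.finrank_fintype_fun_eq_card, hcard] at h3
    rw [← Submodule.finrank_eq_zero (R := K)]
    omega
  let B : LinearMap.BilinForm K (Idx m → K) := Matrix.toBilin' (formMatrix K m)
  have hB : ∀ x y, B x y = (x ᵥ* formMatrix K m) ⬝ᵥ y := fun x y => by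
    rw [← Matrix.dotProduct_mulVec]
    exact Matrix.toBilin'_apply' _ _ _
  have hform := formMatrix_map (m := m) ρ
  have hev := IsotropicParity.even_finrank_of_isotropic_isCompl (B := B)
    (t := (opMatrix (ρ ϖ) m).vecMulLinear) (ϖ := ρ ϖ) (N₀ := N₀) (N₁ := N₁)
    (C := coordKer K Sᶜ) (E := LinearMap.range (eigenMap (ρ ϖ))) h2 hp ?_ ?_ ?_ ?_
    (fun x => mem_range_eigenMap) hc' ?_ ?_ hN.le ?_ ?_
  · rw [LinearMap.finrank_range_of_inj (eigenMap_injective _), range_eigenMap_inf hp,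
      ← (Submodule.equivMapOfInjective _ (eigenMap_injective _) _).finrank_eq,
      Module.finrank_fintype_fun_eq_card, Fintype.card_fin] at hev
    have d₃ := (isGrassmannian_coordKer K (eigenIdx S)ᶜ).finrank_add
    rw [Fintype.card_fin] at d₃
    have h4 := Finset.card_add_card_compl (eigenIdx S)
    rw [Fintype.card_fin] at h4
    have h5 : Module.finrank K N₀ = s := by omega
    have h6 : Module.finrank K (coordKer K (eigenIdx S)ᶜ) = (eigenIdx S).card := by omega
    rw [h5, h6] at hev
    exact (Nat.even_add.1 hev).1 (even_two_mul m)
  · intro x y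
    rw [hB, hB, form_apply, form_apply]
    exact Finset.sum_congr rfl fun i _ => by ring
  · intro x hx
    have hs0 : ∀ i : Fin (2 * m), sign K i ≠ 0 := fun i h => by
      have := sign_mul_self (R := K) i
      rw [h, mul_zero] at this
      exact zero_ne_one this
    have h3 : x ᵥ* formMatrix K m = 0 := dotProduct_eq_zero _ fun y => by rw [← hB, hx]
    refine ext_idx (fun i => ?_) fun i => ?_
    · have := congrFun h3 (1, i.rev)
      rw [vecMul_formMatrix_one, Fin.rev_rev] at this
      exact (mul_eq_zero.1 this).resolve_right (hs0 _)
    · have := congrFun h3 (0, i.rev)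
      rw [vecMul_formMatrix_zero, Fin.rev_rev] at this
      exact (mul_eq_zero.1 this).resolve_right (hs0 _)
  · intro x
    refine ext_idx (fun i => ?_) fun i => ?_
    · rw [Matrix.vecMulLinear_apply, Matrix.vecMulLinear_apply, vecMul_opMatrix_zero,
        vecMul_opMatrix_one, Pi.smul_apply, smul_eq_mul]
    · rw [Matrix.vecMulLinear_apply, Matrix.vecMulLinear_apply, vecMul_opMatrix_one,
        vecMul_opMatrix_zero, Pi.smul_apply, smul_eq_mul]
  · intro x y
    rw [hB, hB, form_apply, form_apply, ← Equiv.sum_comp Fin.revPerm, ← Finset.sum_neg_distrib]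
    refine Finset.sum_congr rfl fun i _ => ?_
    simp only [Matrix.vecMulLinear_apply, vecMul_opMatrix_one, vecMul_opMatrix_zero,
      Fin.revPerm_apply, Fin.rev_rev, sign_rev]
    ring
  · intro x hx y hy
    rw [hB, ← hform]
    exact hN.isotropic x hx y hy
  · intro x hx y hy
    rw [hB]
    exact hS.compl.isotropic hx hy
  · intro x hx
    have := hN.plus_mem x hx
    rwa [plus_map, Matrix.vecMul_add, Matrix.vecMul_smul, Matrix.vecMul_one] at this
  · intro x hx
    have := hN.minus_eq_zero x hx
    rwa [minus_map, Matrix.vecMul_sub, Matrix.vecMul_smul, Matrix.vecMul_one, sub_eq_zero,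
      ← mem_range_eigenMap] at this

end Parity

/-! ### A point over `ϖ = 0` violating the parity constraint. -/

section SpecialPoint

variable {s : ℕ}

/-- The indices of the coordinates vanishing on the first member of a special point. -/
def set₀ (m s : ℕ) : Finset (Idx m) := Finset.univ.filter fun a => a.1 = 0 ∨ s ≤ a.2.val

/-- The indices of the coordinates vanishing on the second member of a special point. -/
def set₁ (m s : ℕ) : Finset (Idx m) := Finset.univ.filter fun a =>
  (a.1 = 0 ∧ (Odd s ∨ a.2.val ≠ 0)) ∨ (a.1 = 1 ∧ Even s ∧ a.2.val + 1 = 2 * m)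

theorem card_set₀ (hs : s ≤ 2 * m) : (set₀ m s).card = 2 * (2 * m) - s := by
  have h1 : (set₀ m s).card = ∑ a : Idx m, if a ∈ set₀ m s then 1 else 0 := by simp
  have h2 : (∑ i : Fin (2 * m), if s ≤ i.val then 1 else 0) = 2 * m - s := by
    rw [Fin.sum_univ_eq_sum_range (fun i => if s ≤ i then 1 else 0), Finset.sum_boole]
    have : (Finset.range (2 * m)).filter (fun i => s ≤ i) = Finset.Ico s (2 * m) := by
      ext i
      simp [and_comm]
    simp [this]
  rw [h1, Fintype.sum_prod_type, Fin.sum_univ_two]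
  simp only [set₀, Finset.mem_filter, Finset.mem_univ, true_and, one_ne_zero, false_or, true_or,
    if_true, h2]
  simp
  omega

theorem isLagrangian_set₁ : IsLagrangian (set₁ m s) := by
  intro i
  have := i.2
  simp only [set₁, Finset.mem_filter, Finset.mem_univ, true_and, one_ne_zero, false_and, false_or,
    zero_ne_one, or_false, Fin.val_rev, ← Nat.not_even_iff_odd]
  rw [not_or, not_not, not_not]
  exact and_congr_right fun _ => by omega

/-- For odd `s` the second member is spanned by all `π f_i`, and no index occurs twice in `set₁`.
For even `s` the last vector `π f_i` is exchanged for the first `f_i`, so exactly the last index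
occurs twice. The total is odd in both cases. -/
theorem odd_card (hm : 0 < m) : ¬ Even (s + (eigenIdx (set₁ m s)).card) := by
  have hl : 2 * m - 1 < 2 * m := by omega
  by_cases h : Even s
  · have : eigenIdx (set₁ m s) = {⟨2 * m - 1, hl⟩} := by
      ext i
      simp only [eigenIdx, set₁, Finset.mem_filter, Finset.mem_univ, true_and, false_or,
        Finset.mem_singleton, Fin.ext_iff, h,
        ← Nat.not_even_iff_odd, not_true_eq_false]
      omega
    rw [this, Finset.card_singleton, Nat.even_add_one]
    exact not_not.2 h
  · have : eigenIdx (set₁ m s) = ∅ := by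
      ext i
      simp [eigenIdx, set₁, h]
    rwa [this, Finset.card_empty, add_zero]

/-- The special point, over a ring in which `ϖ` becomes zero. -/
def specialPoint {A : Type u} [CommRing A] (ρ : R →+* A) (hϖ : ρ ϖ = 0) (hs1 : 1 ≤ s)
    (hs : s < 2 * m) : SplitPoint (data ϖ m) (2 * (2 * m) - s) (2 * m) A where
  str := ρ
  N₀ := coordKer A (set₀ m s)
  N₁ := coordKer A (set₁ m s)
  gr₀ := card_set₀ hs.le ▸ isGrassmannian_coordKer A (set₀ m s)
  gr₁ := isLagrangian_set₁.card (S := set₁ m s) ▸ isGrassmannian_coordKer A (set₁ m s)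
  split := by
    refine ⟨fun x hx => ?_, fun x hx y hy => ?_, fun x hx => ?_, fun x hx => ?_⟩
    · rw [mem_coordKer] at hx ⊢
      rintro ⟨a, i⟩ ha
      refine hx _ ?_
      simp only [set₀, set₁, Finset.mem_filter, Finset.mem_univ, true_and] at ha ⊢
      rcases ha with ⟨h, -⟩ | ⟨-, -, h⟩
      · exact Or.inl h
      -- The exchanged index is `2 * m - 1`, and `s < 2 * m` keeps it out of the first member.
      · exact Or.inr (by omega)
    · have : (data ϖ m).form.map ρ = formMatrix A m := formMatrix_map ρ
      rw [this]
      exact isLagrangian_set₁.isotropic hx hy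
    · rw [mem_coordKer] at hx ⊢
      rw [plus_map, hϖ, zero_smul, add_zero]
      rintro ⟨a, i⟩ ha
      simp only [set₀, Finset.mem_filter, Finset.mem_univ, true_and] at ha
      fin_cases a
      · refine (vecMul_opMatrix_zero _ _ _).trans ?_
        ring
      · refine (vecMul_opMatrix_one _ _ _).trans (hx _ ?_)
        have : s ≤ i.val := by simpa using ha
        simp only [set₁, Finset.mem_filter, Finset.mem_univ, true_and]
        -- Here `1 ≤ s ≤ i` excludes index `0`: the one vector `f_0` that may lie in the second
        -- member is sent to `π f_0`, which is in the first since `s ≥ 1`.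
        exact Or.inl (Or.inr (by omega))
    · rw [mem_coordKer] at hx
      rw [minus_map, hϖ, zero_smul, sub_zero]
      refine ext_idx (fun i => ?_) fun i => ?_
      · refine (vecMul_opMatrix_zero _ _ _).trans ?_
        rw [Pi.zero_apply]
        ring
      · refine (vecMul_opMatrix_one _ _ _).trans (hx _ ?_)
        simp [set₀]

end SpecialPoint

end SplitModel

/-! ### Points of a scheme over `R` representing split pairs -/

namespace CoordinateSpace.SplitPoint

open ZariskiRepresentability

variable {R : Type u} [CommRing R] {κ : Type} [Fintype κ] [DecidableEq κ]
  {D : SplitData R κ} {k₀ k₁ : ℕ} {M : Over (Spec (CommRingCat.of R))}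

/-- A compatible family of surjections from the points of `M` with values in rings to split
pairs. -/
structure PointMap (D : SplitData R κ) (k₀ k₁ : ℕ) (M : Over (Spec (CommRingCat.of R))) where
  toFun : ∀ {A : CommRingCat.{u}}, (Spec A ⟶ M.left) → SplitPoint D k₀ k₁ A
  comp : ∀ {A B : CommRingCat.{u}} (φ : A ⟶ B) (g : Spec A ⟶ M.left),
    toFun (Spec.map φ ≫ g) = (toFun g).map φ.hom
  comp_hom : ∀ {A : CommRingCat.{u}} (g : Spec A ⟶ M.left),
    g ≫ M.hom = Spec.map (CommRingCat.ofHom (toFun g).str)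
  surjective : ∀ {A : CommRingCat.{u}}, Function.Surjective (toFun (A := A))

/-- The map on points given by an isomorphism of functors. -/
noncomputable def evalAt (Φ : NaiveSplitting.pointsFunctor M ≅ overFunctor D k₀ k₁)
    (A : CommRingCat.{u}) (ρ : R →+* A) (g : Spec A ⟶ M.left)
    (hg : g ≫ M.hom = Spec.map (CommRingCat.ofHom ρ)) : SplitPoint D k₀ k₁ A :=
  letI := ρ.toAlgebra
  (Φ.hom.app (CommAlgCat.of R A) (Over.homMk (U := (algSpec (CommRingCat.of R)).obj
    (Opposite.op (CommAlgCat.of R A))) g hg)).1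

theorem evalAt_str (Φ : NaiveSplitting.pointsFunctor M ≅ overFunctor D k₀ k₁)
    (A : CommRingCat.{u}) (ρ : R →+* A) (g : Spec A ⟶ M.left)
    (hg : g ≫ M.hom = Spec.map (CommRingCat.ofHom ρ)) : (evalAt Φ A ρ g hg).str = ρ :=
  letI := ρ.toAlgebra
  (Φ.hom.app (CommAlgCat.of R A) (Over.homMk (U := (algSpec (CommRingCat.of R)).obj
    (Opposite.op (CommAlgCat.of R A))) g hg)).2

theorem evalAt_comp (Φ : NaiveSplitting.pointsFunctor M ≅ overFunctor D k₀ k₁)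
    {A B : CommRingCat.{u}} (φ : A ⟶ B) (ρ : R →+* A) (ρ' : R →+* B) (g : Spec A ⟶ M.left)
    (hg : g ≫ M.hom = Spec.map (CommRingCat.ofHom ρ)) (hρ : φ.hom.comp ρ = ρ')
    (hg' : (Spec.map φ ≫ g) ≫ M.hom = Spec.map (CommRingCat.ofHom ρ')) :
    evalAt Φ B ρ' (Spec.map φ ≫ g) hg' = (evalAt Φ A ρ g hg).map φ.hom := by
  let := ρ.toAlgebra
  let := ρ'.toAlgebra
  let f : CommAlgCat.of R A ⟶ CommAlgCat.of R B :=
    CommAlgCat.ofHom { φ.hom with commutes' := fun r => DFunLike.congr_fun hρ r }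
  have h := NatTrans.naturality_apply Φ.hom f (Over.homMk (U := (algSpec (CommRingCat.of R)).obj
    (Opposite.op (CommAlgCat.of R A))) g hg)
  exact congrArg Subtype.val h

theorem evalAt_surjective (Φ : NaiveSplitting.pointsFunctor M ≅ overFunctor D k₀ k₁)
    {A : CommRingCat.{u}} (x : SplitPoint D k₀ k₁ A) :
    ∃ g hg, evalAt Φ A x.str g hg = x := by
  let := x.str.toAlgebra
  obtain ⟨h, hh⟩ : ∃ h, Φ.hom.app (CommAlgCat.of R A) h = ⟨x, rfl⟩ :=
    ⟨Φ.inv.app (CommAlgCat.of R A) ⟨x, rfl⟩,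
      ConcreteCategory.congr_hom (Φ.inv_hom_id_app (CommAlgCat.of R A)) ⟨x, rfl⟩⟩
  exact ⟨CommaMorphism.left h, Over.w h, congrArg Subtype.val hh⟩

/-- The map on points given by an isomorphism of functors. -/
noncomputable def pointMap (Φ : NaiveSplitting.pointsFunctor M ≅ overFunctor D k₀ k₁) :
    PointMap D k₀ k₁ M :=
  -- Any point of `M.left` becomes a point over `R` once `A` is given the algebra structure induced
  -- by `M.hom`.
  have h : ∀ {A : CommRingCat.{u}} (g : Spec A ⟶ M.left),
      g ≫ M.hom = Spec.map (CommRingCat.ofHom (Spec.preimage (g ≫ M.hom)).hom) :=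
    fun g => (Spec.map_preimage (g ≫ M.hom)).symm
  { toFun := fun {A} g => evalAt Φ A (Spec.preimage (g ≫ M.hom)).hom g (h g)
    comp := fun φ g => evalAt_comp Φ φ _ _ g _ (by
      refine congrArg CommRingCat.Hom.hom (a₁ := Spec.preimage (g ≫ M.hom) ≫ φ)
        (Spec.map_injective ?_)
      rw [Spec.map_comp, Spec.map_preimage, Spec.map_preimage, Category.assoc]) _
    comp_hom := fun g => by rw [evalAt_str]; exact h g
    surjective := fun {A} x => by
      obtain ⟨g, hg, hx⟩ := evalAt_surjective Φ x
      have hρ : (Spec.preimage (g ≫ M.hom)).hom = x.str :=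
        congrArg CommRingCat.Hom.hom (Spec.map_injective ((Spec.map_preimage _).trans hg))
      refine ⟨g, ?_⟩
      simp only [hρ, hx] }

end CoordinateSpace.SplitPoint

/-! ### The neighbourhood of the special point and the failure of flatness. -/

namespace SplitModel

open CoordinateSpace CoordinateSpace.SplitPoint

variable {R : Type u} [CommRing R] {ϖ : R} {m s : ℕ} {M : Over (Spec (CommRingCat.of R))}

/-- A split pair over a field such that `ϖ` is nonzero is not transverse to the complement of the
second member of the special point. -/
theorem eq_zero_of_transverse (h2 : IsUnit (2 : R)) (hm : 0 < m) (hs : s < 2 * m) {K : Type u}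
    [Field K] (x : SplitPoint (data ϖ m) (2 * (2 * m) - s) (2 * m) K)
    (h : x.N₁ ⊔ coordKer K (set₁ m s)ᶜ = ⊤) : x.str ϖ = 0 := by
  by_contra hp
  have h2' : (2 : K) ≠ 0 := by
    have := (h2.map x.str).ne_zero
    rwa [map_ofNat] at this
  exact odd_card hm (even_of_isSplit h2' hp isLagrangian_set₁ (by omega) x.gr₀ x.gr₁ x.split h)

/-- Around a point of the special fibre, there is an affine open subset on which `ϖ` vanishes at
every point. -/
theorem exists_affineOpen (q : PointMap (data ϖ m) (2 * (2 * m) - s) (2 * m) M)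
    (h2 : IsUnit (2 : R)) (hϖ : ¬ IsUnit ϖ) (hm : 0 < m) (hs1 : 1 ≤ s) (hs : s < 2 * m) :
    ∃ U : M.left.Opens, IsAffineOpen U ∧ (∃ x, x ∈ U) ∧ ∀ x ∈ U, ϖ ∈ (M.hom x).asIdeal := by
  obtain ⟨𝔪, h𝔪, hmem⟩ := exists_max_ideal_of_mem_nonunits hϖ
  let _ : Field (R ⧸ 𝔪) := Ideal.Quotient.field 𝔪
  let k := CommRingCat.of (R ⧸ 𝔪)
  obtain ⟨g, hg⟩ := q.surjective (A := k) (specialPoint ϖ (Ideal.Quotient.mk 𝔪)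
    (Ideal.Quotient.eq_zero_iff_mem.2 hmem) hs1 hs)
  let o : PrimeSpectrum (R ⧸ 𝔪) := ⊥
  obtain ⟨_, ⟨V, hV : IsAffineOpen V, rfl⟩, hoV, -⟩ :=
    M.left.isBasis_affineOpens.exists_subset_of_mem_open (Set.mem_univ (g o)) isOpen_univ
  have hrange : Set.range g ⊆ Set.range hV.fromSpec := by
    rintro _ ⟨p, rfl⟩
    have : p = o := Subsingleton.elim (α := PrimeSpectrum (R ⧸ 𝔪)) p o
    rw [hV.range_fromSpec, this]
    exact hoV
  let θ := Spec.preimage (IsOpenImmersion.lift hV.fromSpec g hrange)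
  have hθ : Spec.map θ ≫ hV.fromSpec = g := by
    rw [Spec.map_preimage, IsOpenImmersion.lift_fac]
  let z := q.toFun hV.fromSpec
  have hz : z.map θ.hom = specialPoint ϖ (Ideal.Quotient.mk 𝔪)
      (Ideal.Quotient.eq_zero_iff_mem.2 hmem) hs1 hs := by
    rw [← q.comp, hθ, hg]
  let W := z.N₁ ⊔ coordKer Γ(M.left, V) (set₁ m s)ᶜ
  have hW : ∀ {B : Type u} [CommRing B] (φ : Γ(M.left, V) →+* B),
      extend φ W = (z.map φ).N₁ ⊔ coordKer B (set₁ m s)ᶜ := fun φ => by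
    rw [extend_sup, extend_coordKer, SplitPoint.map_N₁]
  have hWθ : extend θ.hom W = ⊤ := by
    rw [hW, hz]
    exact coordKer_sup_compl _ _
  rw [extend_eq_top_iff] at hWθ
  -- At the special point `N₁` and the coordinate complement span everything, so some `f`
  -- annihilating the quotient by `W` is nonzero there. Wherever `f` is nonzero, transversality
  -- persists.
  obtain ⟨f, hf, hfθ⟩ : ∃ f ∈ Module.annihilator Γ(M.left, V) ((Idx m → Γ(M.left, V)) ⧸ W),
      θ.hom f ≠ 0 := by
    by_contra! hcon
    have h3 : Ideal.map θ.hom (Module.annihilator _ ((Idx m → Γ(M.left, V)) ⧸ W)) ≤ ⊥ :=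
      Ideal.map_le_iff_le_comap.2 fun f hf => hcon f hf
    rw [hWθ] at h3
    exact (bot_lt_top (α := Ideal (R ⧸ 𝔪))).ne (top_le_iff.1 h3 : (⊥ : Ideal (R ⧸ 𝔪)) = ⊤)
  have hbasic : ∀ p : PrimeSpectrum Γ(M.left, V),
      hV.fromSpec p ∈ M.left.basicOpen f ↔ f ∉ p.asIdeal := by
    intro p
    change p ∈ hV.fromSpec ⁻¹ᵁ M.left.basicOpen f ↔ _
    rw [hV.fromSpec_preimage_basicOpen]
    rfl
  refine ⟨M.left.basicOpen f, hV.basicOpen f, ⟨hV.fromSpec (Spec.map θ o), ?_⟩, ?_⟩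
  · exact (hbasic _).2 hfθ
  · intro x hx
    have hxV : x ∈ Set.range hV.fromSpec := by
      rw [hV.range_fromSpec]
      exact M.left.basicOpen_le f hx
    obtain ⟨p, rfl⟩ := hxV
    have hp : f ∉ PrimeSpectrum.asIdeal p := (hbasic p).1 hx
    have hprime : (PrimeSpectrum.asIdeal p).IsPrime := PrimeSpectrum.isPrime p
    let K := (PrimeSpectrum.asIdeal p).ResidueField
    let ψ : Γ(M.left, V) →+* K := algebraMap _ _
    have hψ : ∀ a, ψ a = 0 ↔ a ∈ PrimeSpectrum.asIdeal p := fun a =>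
      Ideal.algebraMap_residueField_eq_zero
    -- The image of `f` is invertible in the residue field at `p`, so the fibre is transverse and
    -- the parity obstruction applies to it.
    have htop : extend ψ W = ⊤ := by
      rw [extend_eq_top_iff, Ideal.eq_top_iff_one]
      have h4 : ψ f ∈ Ideal.map ψ (Module.annihilator _ ((Idx m → Γ(M.left, V)) ⧸ W)) :=
        Ideal.mem_map_of_mem ψ hf
      have h5 := Ideal.mul_mem_left _ (ψ f)⁻¹ h4
      rwa [inv_mul_cancel₀ (fun h => hp ((hψ f).1 h))] at h5
    rw [hW] at htop
    have h6 : ψ (z.str ϖ) = 0 := eq_zero_of_transverse h2 hm hs (z.map ψ) htop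
    rw [hψ] at h6
    have h7 : M.hom (hV.fromSpec p) = Spec.map (CommRingCat.ofHom z.str) p := by
      rw [← q.comp_hom hV.fromSpec]
      rfl
    rw [h7]
    exact h6

/-- A morphism to the spectrum of a domain is not flat if a nonempty affine open subset lies over
the zero locus of a nonzero element. -/
theorem not_flat_of_affineOpen [IsDomain R] (hϖ : ϖ ≠ 0) {U : M.left.Opens} (hU : IsAffineOpen U)
    (hne : ∃ x, x ∈ U) (h : ∀ x ∈ U, ϖ ∈ (M.hom x).asIdeal) : ¬ Flat M.hom := by
  intro hflat
  let σ := Spec.preimage (hU.fromSpec ≫ M.hom)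
  have hσ : Spec.map σ = hU.fromSpec ≫ M.hom := Spec.map_preimage _
  have h1 : Flat (Spec.map σ) := by
    rw [hσ]
    infer_instance
  rw [Flat.SpecMap_iff] at h1
  obtain ⟨x, hx⟩ := hne
  have hmem : ∀ p : PrimeSpectrum Γ(M.left, U), σ.hom ϖ ∈ p.asIdeal := by
    intro p
    have hp : hU.fromSpec p ∈ U := by
      have : hU.fromSpec p ∈ Set.range hU.fromSpec := ⟨p, rfl⟩
      rwa [hU.range_fromSpec] at this
    have h3 := h _ hp
    have h4 : M.hom (hU.fromSpec p) = Spec.map σ p := by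
      rw [hσ]
      rfl
    rw [h4] at h3
    exact h3
  -- An element lying in every prime is nilpotent.
  have hnil : IsNilpotent (σ.hom ϖ) := by
    rw [← mem_nilradical, nilradical_eq_sInf, Ideal.mem_sInf]
    intro I hI
    exact hmem ⟨I, hI⟩
  obtain ⟨n, hn⟩ := hnil
  let _ : Algebra R Γ(M.left, U) := σ.hom.toAlgebra
  have : Module.Flat R Γ(M.left, U) := h1
  -- Flatness over a domain makes `ϖ ^ n` act injectively, yet it acts as zero; the coordinate ring
  -- of the nonempty `U` would then be trivial.
  have hreg : IsSMulRegular Γ(M.left, U) (ϖ ^ n) :=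
    Module.Flat.isSMulRegular_of_nonZeroDivisors
      (mem_nonZeroDivisors_of_ne_zero (pow_ne_zero n hϖ))
  have h10 : (1 : Γ(M.left, U)) = 0 := by
    apply hreg
    change ϖ ^ n • (1 : Γ(M.left, U)) = ϖ ^ n • (0 : Γ(M.left, U))
    rw [smul_zero, Algebra.smul_def, mul_one]
    change σ.hom (ϖ ^ n) = 0
    rw [map_pow, hn]
  have hxr : x ∈ Set.range hU.fromSpec := by
    rw [hU.range_fromSpec]
    exact hx
  obtain ⟨p, -⟩ := hxr
  exact PrimeSpectrum.isPrime p |>.ne_top ((Ideal.eq_top_iff_one _).2 (h10 ▸ Ideal.zero_mem _))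

end SplitModel

/-! ### A basis of the standard lattice -/

namespace NaiveSplitting.SplitHermitianSpace

variable {O₀ F₀ F V : Type u} [CommRing O₀] [IsDomain O₀]
    [IsDiscreteValuationRing O₀] [Field F₀] [Algebra O₀ F₀] [IsFractionRing O₀ F₀]
    [Field F] [Algebra F₀ F] [Algebra O₀ F] [IsScalarTower O₀ F₀ F]
    [AddCommGroup V] [Module F V] [Module O₀ V] [IsScalarTower O₀ F V] {m : ℕ}
    (D : SplitHermitianSpace O₀ F₀ F V m)

theorem algebraMap_injective (_ : SplitHermitianSpace O₀ F₀ F V m) :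
    Function.Injective (algebraMap O₀ F) := by
  rw [IsScalarTower.algebraMap_eq O₀ F₀ F]
  exact (algebraMap F₀ F).injective.comp (IsFractionRing.injective O₀ F₀)

theorem conj_algebraMap (a : O₀) : D.conj (algebraMap O₀ F a) = algebraMap O₀ F a := by
  rw [IsScalarTower.algebraMap_apply O₀ F₀ F, AlgEquiv.commutes]

theorem isIntegral_conj {x : F} (hx : IsIntegral O₀ x) : IsIntegral O₀ (D.conj x) :=
  hx.map (D.conj.toAlgHom.restrictScalars O₀)

theorem π_mul_self : D.π * D.π = algebraMap O₀ F D.π₀ := by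
  rw [← pow_two, D.π_sq, ← IsScalarTower.algebraMap_apply]

theorem two_ne_zero' (D : SplitHermitianSpace O₀ F₀ F V m) : (2 : F) ≠ 0 := by
  have := (D.isUnit_two.map (algebraMap O₀ F)).ne_zero
  rwa [map_ofNat] at this

theorem exists_algebraMap_eq_of_isIntegral {c : F₀} (hc : IsIntegral O₀ (algebraMap F₀ F c)) :
    ∃ a : O₀, algebraMap O₀ F a = algebraMap F₀ F c := by
  rw [isIntegral_algebraMap_iff (algebraMap F₀ F).injective] at hc
  obtain ⟨a, rfl⟩ := IsIntegrallyClosed.isIntegral_iff.1 hc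
  exact ⟨a, IsScalarTower.algebraMap_apply O₀ F₀ F a⟩

theorem exists_add_conj {x : F} (hx : IsIntegral O₀ x) :
    ∃ a : O₀, algebraMap O₀ F a = x + D.conj x := by
  obtain ⟨a, ha⟩ := exists_algebraMap_eq_of_isIntegral (O₀ := O₀) (F₀ := F₀) (F := F)
    (c := Algebra.trace F₀ F x) (by
      rw [D.trace_eq]
      exact hx.add (D.isIntegral_conj hx))
  exact ⟨a, ha.trans (D.trace_eq x)⟩

/-- The integers of `F` are generated over `O₀` by `1` and `π`. -/
theorem exists_eq_add_mul_π {x : F} (hx : IsIntegral O₀ x) :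
    ∃ a b : O₀, x = algebraMap O₀ F a + algebraMap O₀ F b * D.π := by
  obtain ⟨w, hw⟩ := D.isUnit_two.exists_right_inv
  have hw' : 2 * algebraMap O₀ F w = 1 := by
    rw [← map_ofNat (algebraMap O₀ F) 2, ← map_mul, hw, map_one]
  obtain ⟨a, ha⟩ := D.exists_add_conj hx
  obtain ⟨T, hT⟩ := D.exists_add_conj (D.isIntegral_π.mul hx)
  rw [map_mul, D.conj_π] at hT
  obtain ⟨N, hN⟩ := D.exists_add_conj (hx.mul hx)
  obtain ⟨P, hP⟩ := D.exists_add_conj (hx.mul (D.isIntegral_conj hx))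
  rw [map_mul] at hN hP
  have hinv : D.conj (D.conj x) = x := by
    have h1 := D.trace_eq (D.conj x)
    have h2 : D.conj (x + D.conj x) = x + D.conj x := by rw [← ha, D.conj_algebraMap]
    rw [map_add] at h2
    linear_combination h2
  rw [hinv] at hP
  -- Write `x'` for the conjugate of `x`. Here `T = π (x - x')`, `N = x² + x'²` and `P = 2 x x'`, so
  -- `T² = π₀ (x - x')²`. Hence `π₀` divides `T`, giving `x - x' = π b`, and `x` is half of `(x +
  -- x') + (x - x')`.
  have hdvd : T ^ 2 = D.π₀ * (N - P) := by
    apply D.algebraMap_injective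
    rw [map_pow, map_mul, map_sub, hT, hN, hP, ← D.π_mul_self]
    ring
  obtain ⟨b, hb⟩ := D.irreducible_π₀.prime.dvd_of_dvd_pow (Dvd.intro _ hdvd.symm)
  have hb' : algebraMap O₀ F T = D.π * D.π * algebraMap O₀ F b := by
    rw [hb, map_mul, D.π_mul_self]
  refine ⟨w * a, w * b, ?_⟩
  have h3 : x - D.conj x = D.π * algebraMap O₀ F b := by
    apply mul_left_cancel₀ D.π_ne_zero
    linear_combination hb' - hT
  rw [map_mul, map_mul, ha]
  linear_combination (-x) * hw' + algebraMap O₀ F w * h3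

/-- The generators of the standard lattice over the integers of `F`. -/
noncomputable def latticeGen (i : Fin (2 * m)) : D.lattice :=
  ⟨if i.val < m then D.π⁻¹ • D.e i else D.e i, Submodule.subset_span ⟨i, rfl⟩⟩

theorem coe_mulπ (x : D.lattice) : (D.mulπ x : V) = D.π • (x : V) := rfl

/-- The generators of the standard lattice over `O₀`. -/
noncomputable def latticeVec (a : SplitModel.Idx m) : D.lattice :=
  if a.1 = 0 then D.latticeGen a.2 else D.mulπ (D.latticeGen a.2)

theorem latticeVec_zero (i : Fin (2 * m)) : D.latticeVec (0, i) = D.latticeGen i := if_pos rfl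

theorem latticeVec_one (i : Fin (2 * m)) : D.latticeVec (1, i) = D.mulπ (D.latticeGen i) :=
  if_neg (one_ne_zero (α := Fin 2))

theorem mulπ_mulπ (x : D.lattice) : D.mulπ (D.mulπ x) = D.π₀ • x := by
  apply Subtype.ext
  rw [coe_mulπ, coe_mulπ, smul_smul, D.π_mul_self, Submodule.coe_smul_of_tower, algebraMap_smul]

theorem linearIndependent_latticeGen :
    LinearIndependent F (fun i => (D.latticeGen i : V)) := by
  have h : ∀ i, (D.latticeGen i : V) = (if i.val < m then D.π⁻¹ else 1 : F) • D.e i := by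
    intro i
    simp only [latticeGen]
    split_ifs <;> simp
  simp only [h]
  have hu : ∀ i : Fin (2 * m), IsUnit (if i.val < m then D.π⁻¹ else 1 : F) := by
    intro i
    split_ifs
    · exact (inv_ne_zero D.π_ne_zero).isUnit
    · exact isUnit_one
  have := (D.e.isUnitSMul hu).linearIndependent
  convert this using 1
  ext i
  exact (Module.Basis.isUnitSMul_apply hu i).symm

/-- A relation over `O₀` is a relation over `F` with coefficients `a + b π`, so these vanish; adding
the conjugate `a - b π` isolates `2 a`. -/
theorem linearIndependent_latticeVec : LinearIndependent O₀ D.latticeVec := by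
  rw [Fintype.linearIndependent_iff]
  intro c hc
  have h1 := congrArg (Subtype.val : D.lattice → V) hc
  rw [Fintype.sum_prod_type, Fin.sum_univ_two, ← Finset.sum_add_distrib] at h1
  have h2 : ∑ i, (algebraMap O₀ F (c (0, i)) + algebraMap O₀ F (c (1, i)) * D.π) •
      (D.latticeGen i : V) = 0 := by
    rw [Submodule.coe_zero, Submodule.coe_sum] at h1
    rw [← h1]
    refine Finset.sum_congr rfl fun i _ => ?_
    rw [latticeVec_zero, latticeVec_one, Submodule.coe_add, Submodule.coe_smul_of_tower,
      Submodule.coe_smul_of_tower, coe_mulπ, add_smul, mul_smul, algebraMap_smul,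
      algebraMap_smul]
  have h3 := Fintype.linearIndependent_iff.1 D.linearIndependent_latticeGen _ h2
  have h4 : ∀ i, algebraMap O₀ F (c (0, i)) = 0 ∧ algebraMap O₀ F (c (1, i)) = 0 := by
    intro i
    have h5 := h3 i
    have h6 := congrArg D.conj h5
    rw [map_add, map_mul, D.conj_algebraMap, D.conj_algebraMap, D.conj_π, map_zero] at h6
    have h7 : algebraMap O₀ F (c (0, i)) = 0 := by
      have : 2 * algebraMap O₀ F (c (0, i)) = 0 := by linear_combination h5 + h6
      exact (mul_eq_zero.1 this).resolve_left D.two_ne_zero'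
    refine ⟨h7, ?_⟩
    rw [h7, zero_add] at h5
    exact (mul_eq_zero.1 h5).resolve_right D.π_ne_zero
  rintro ⟨a, i⟩
  apply D.algebraMap_injective
  rw [map_zero]
  fin_cases a
  · exact (h4 i).1
  · exact (h4 i).2

theorem span_latticeVec : ⊤ ≤ Submodule.span O₀ (Set.range D.latticeVec) := by
  rintro ⟨x, hx⟩ -
  have hmem : ∀ a, D.latticeVec a ∈ Submodule.span O₀ (Set.range D.latticeVec) :=
    fun a => Submodule.subset_span ⟨a, rfl⟩
  have hπ : ∀ y ∈ Submodule.span O₀ (Set.range D.latticeVec),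
      D.mulπ y ∈ Submodule.span O₀ (Set.range D.latticeVec) := by
    intro y hy
    induction hy using Submodule.span_induction with
    | zero => rw [map_zero]; exact Submodule.zero_mem _
    | add y z _ _ hy hz => rw [map_add]; exact Submodule.add_mem _ hy hz
    | smul c y _ hy => rw [map_smul]; exact Submodule.smul_mem _ _ hy
    | mem y hy =>
      obtain ⟨⟨a, i⟩, rfl⟩ := hy
      fin_cases a
      · have := hmem (1, i)
        rw [latticeVec_one, ← latticeVec_zero] at this
        exact this
      · have := Submodule.smul_mem _ D.π₀ (hmem (0, i))
        rw [latticeVec_zero, ← mulπ_mulπ, ← latticeVec_one] at this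
        exact this
  have h : ∀ x (hx : x ∈ D.lattice), (⟨x, hx⟩ : D.lattice) ∈
      Submodule.span O₀ (Set.range D.latticeVec) := by
    intro x hx
    induction hx using Submodule.span_induction with
    | zero => exact Submodule.zero_mem _
    | add x y hx hy h h' => exact Submodule.add_mem _ h h'
    | smul c x hx h =>
      obtain ⟨a, b, hab⟩ := D.exists_eq_add_mul_π c.2
      have h8 : (⟨c • x, Submodule.smul_mem _ c hx⟩ : D.lattice) =
          a • ⟨x, hx⟩ + b • D.mulπ ⟨x, hx⟩ := by
        apply Subtype.ext
        rw [Submodule.coe_add, Submodule.coe_smul_of_tower, Submodule.coe_smul_of_tower, coe_mulπ]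
        change (c : F) • x = a • x + b • D.π • x
        rw [hab, add_smul, mul_smul, algebraMap_smul, algebraMap_smul]
      exact h8 ▸ Submodule.add_mem _ (Submodule.smul_mem _ _ h) (Submodule.smul_mem _ _ (hπ _ h))
    | mem x hx =>
      obtain ⟨i, rfl⟩ := hx
      have h9 := hmem (0, i)
      rw [latticeVec_zero] at h9
      exact h9
  exact h x hx

/-- The basis `f_i, π f_i` of the standard lattice. -/
noncomputable def latticeBasis : Module.Basis (SplitModel.Idx m) O₀ D.lattice :=
  Module.Basis.mk D.linearIndependent_latticeVec D.span_latticeVec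

theorem latticeBasis_apply (a : SplitModel.Idx m) : D.latticeBasis a = D.latticeVec a :=
  Module.Basis.mk_apply _ _ a

theorem algebraMap_latticeForm' (x y : D.lattice) :
    2 * algebraMap O₀ F (D.latticeForm x y) = D.φ x y + D.conj (D.φ x y) := by
  rw [IsScalarTower.algebraMap_apply O₀ F₀ F, algebraMap_latticeForm, symmForm, map_mul,
    D.trace_eq, map_inv₀, map_ofNat, mul_inv_cancel_left₀ D.two_ne_zero']

/-- Of two paired indices exactly one carries the factor `π⁻¹`. In the second, conjugate-linear
argument it contributes `-π⁻¹`, which is the source of `sign`. -/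
theorem φ_latticeGen (i j : Fin (2 * m)) : D.φ (D.latticeGen i) (D.latticeGen j) =
    if j = i.rev then SplitModel.sign F i * D.π⁻¹ else 0 := by
  have hs : D.φ (D.e i) (D.e j) = if j = i.rev then 1 else 0 := by
    have := D.split i j.rev
    rw [Fin.rev_rev] at this
    rw [this]
    congr 1
    rw [← Fin.rev_inj, Fin.rev_rev, eq_comm (a := i.rev)]
  by_cases h : j = i.rev
  · rw [if_pos h] at hs ⊢
    have hv : j.val + i.val + 1 = 2 * m := by rw [h, Fin.val_rev]; omega
    simp only [latticeGen, SplitModel.sign]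
    by_cases hi : i.val < m
    · have hj : ¬ j.val < m := by omega
      simp [hi, hj, hs]
    · have hj : j.val < m := by omega
      simp [hi, hj, hs, LinearMap.map_smulₛₗ, D.conj_π, inv_neg]
  · rw [if_neg h] at hs ⊢
    simp only [latticeGen]
    split_ifs <;> simp [hs, LinearMap.map_smulₛₗ]

theorem conj_sign (i : Fin (2 * m)) : D.conj (SplitModel.sign F i) = SplitModel.sign F i := by
  simp only [SplitModel.sign]
  split_ifs <;> simp

theorem latticeForm_latticeVec (a b : SplitModel.Idx m) :
    D.latticeForm (D.latticeVec a) (D.latticeVec b) = SplitModel.formMatrix O₀ m a b := by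
  have h0 := D.π_ne_zero
  apply D.algebraMap_injective
  apply mul_left_cancel₀ D.two_ne_zero'
  rw [D.algebraMap_latticeForm']
  have hM := congrFun (congrFun (SplitModel.formMatrix_map (m := m) (algebraMap O₀ F)) a) b
  rw [Matrix.map_apply] at hM
  rw [hM]
  obtain ⟨a, i⟩ := a
  obtain ⟨b, j⟩ := b
  fin_cases a <;> fin_cases b <;> by_cases h : j = i.rev <;>
    simp [latticeVec, coe_mulπ, LinearMap.map_smulₛₗ, φ_latticeGen, D.conj_π, conj_sign,
      SplitModel.formMatrix, h] <;> field_simp <;> ring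

variable {D} in
theorem unif_sq_smul (z : D.integers ⊗[O₀] D.lattice) : D.unif ^ 2 • z = D.π₀ • z := by
  have : D.unif ^ 2 = algebraMap O₀ D.integers D.π₀ := by
    apply Subtype.ext
    rw [pow_two]
    exact D.π_mul_self
  rw [this, algebraMap_smul]

/-- In the basis `f_i, π f_i`, the matrices of the naive splitting functor are those of the split
model. -/
theorem ofBasis_eq : CoordinateSpace.SplitData.ofBasis (D.latticeBasis.baseChange D.integers) D.unif
    (D.mulπ.baseChange D.integers) (D.latticeForm.baseChange D.integers) =
      SplitModel.data D.unif m := by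
  let b := D.latticeBasis.baseChange D.integers
  have hb : ∀ a, b a = 1 ⊗ₜ D.latticeVec a := fun a => by
    rw [← latticeBasis_apply]
    exact Module.Basis.baseChange_apply _ _ _
  have hop : Matrix.of (fun a => b.equivFun (D.mulπ.baseChange D.integers (b a))) =
      SplitModel.opMatrix D.unif m := by
    have h0 : ∀ i, D.mulπ.baseChange D.integers (b (0, i)) = b (1, i) := fun i => by
      rw [hb, hb, LinearMap.baseChange_tmul, latticeVec_zero, latticeVec_one]
    have h1 : ∀ i, D.mulπ.baseChange D.integers (b (1, i)) = D.unif ^ 2 • b (0, i) := fun i => by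
      rw [unif_sq_smul, hb, hb, LinearMap.baseChange_tmul, latticeVec_zero, latticeVec_one,
        mulπ_mulπ, TensorProduct.tmul_smul]
    refine Matrix.ext ?_
    rintro ⟨a, i⟩ ⟨c, j⟩
    rw [Matrix.of_apply]
    fin_cases a
    · refine (congrFun (congrArg b.equivFun (h0 i)) (c, j)).trans ?_
      rw [Module.Basis.equivFun_self]
      fin_cases c <;> simp [SplitModel.opMatrix]
    · refine (congrFun (congrArg b.equivFun (h1 i)) (c, j)).trans ?_
      rw [map_smul, Pi.smul_apply, Module.Basis.equivFun_self]
      fin_cases c <;> simp [SplitModel.opMatrix]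
  have hform : Matrix.of (fun a c => D.latticeForm.baseChange D.integers (b a) (b c)) =
      SplitModel.formMatrix D.integers m := by
    rw [← SplitModel.formMatrix_map (algebraMap O₀ D.integers)]
    ext a c
    rw [Matrix.of_apply, hb, hb, LinearMap.BilinForm.baseChange_tmul, latticeForm_latticeVec,
      Matrix.map_apply, Algebra.smul_def, mul_one, mul_one]
  rw [CoordinateSpace.SplitData.ofBasis, SplitModel.data, hop, hform]

/-- If `π (a + b π) = 1`, the part fixed by conjugation reads `b π₀ = 1`, contradicting that `π₀` is
not a unit. -/
theorem not_isUnit_unif : ¬ IsUnit D.unif := by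
  intro h
  obtain ⟨c, hc⟩ := h.exists_right_inv
  have h1 : D.π * (c : F) = 1 := congrArg Subtype.val hc
  obtain ⟨a, b, hab⟩ := D.exists_eq_add_mul_π c.2
  have h2 : algebraMap O₀ F a * D.π + algebraMap O₀ F (b * D.π₀) = 1 := by
    rw [map_mul, ← D.π_mul_self]
    rw [hab] at h1
    linear_combination h1
  have h3 := congrArg D.conj h2
  rw [map_add, map_mul, D.conj_algebraMap, D.conj_algebraMap, D.conj_π, map_one] at h3
  have h4 : b * D.π₀ = 1 := by
    apply D.algebraMap_injective
    apply mul_left_cancel₀ D.two_ne_zero'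
    rw [map_one]
    linear_combination h2 + h3
  exact D.irreducible_π₀.not_isUnit (IsUnit.of_mul_eq_one_right b h4)

theorem isUnit_two_integers (D : SplitHermitianSpace O₀ F₀ F V m) : IsUnit (2 : D.integers) := by
  have := D.isUnit_two.map (algebraMap O₀ D.integers)
  rwa [map_ofNat] at this

theorem unif_ne_zero : D.unif ≠ 0 := fun h => D.π_ne_zero (congrArg Subtype.val h)

end NaiveSplitting.SplitHermitianSpace

theorem proposition5p1 {O₀ F₀ F V : Type u}
    [CommRing O₀] [IsDomain O₀] [IsDiscreteValuationRing O₀]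
    [IsAdicComplete (IsLocalRing.maximalIdeal O₀) O₀] [PerfectField (IsLocalRing.ResidueField O₀)]
    [Field F₀] [Algebra O₀ F₀] [IsFractionRing O₀ F₀]
    [Field F] [Algebra F₀ F] [Algebra O₀ F] [IsScalarTower O₀ F₀ F]
    [AddCommGroup V] [Module F V] [Module O₀ V] [IsScalarTower O₀ F V]
    {m : ℕ} (hm : 3 < 2 * m) (D : NaiveSplitting.SplitHermitianSpace O₀ F₀ F V m)
    (r s : ℕ) (hrs : r + s = 2 * m) (hr : 1 ≤ r) (hs : 1 ≤ s) :
    (∃ M : Over (Spec (CommRingCat.of D.integers)),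
      NaiveSplitting.Represents M (D.naiveSplittingFunctor s)) ∧
    ∀ M : Over (Spec (CommRingCat.of D.integers)),
      NaiveSplitting.Represents M (D.naiveSplittingFunctor s) →
      ¬ Flat M.hom ∧
      ∃ U : M.left.Opens, IsAffineOpen U ∧
        (∃ x ∈ U, D.unif ∈ (M.hom x).asIdeal) ∧ ∀ x ∈ U, (M.hom x).asIdeal ≠ ⊥ := by
  have hiso : Nonempty (D.naiveSplittingFunctor s ≅ CoordinateSpace.SplitPoint.overFunctor
      (SplitModel.data D.unif m) (2 * (2 * m) - s) (2 * m)) := by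
    -- Replacing the explicit matrices by those of the lattice basis reduces the claim to the
    -- general comparison of functors.
    rw [← D.ofBasis_eq]
    exact CoordinateSpace.nonempty_iso_overFunctor _ _ _ _ (2 * m) s
  obtain ⟨Ψ⟩ := hiso
  refine ⟨?_, fun M hM => ?_⟩
  · obtain ⟨M, ⟨Φ⟩⟩ := CoordinateSpace.SplitPoint.exists_over (SplitModel.data D.unif m)
      (2 * (2 * m) - s) (2 * m)
    exact ⟨M, ⟨Φ ≪≫ Ψ.symm⟩⟩
  · obtain ⟨Φ⟩ := hM
    obtain ⟨U, hU, ⟨x, hx⟩, h⟩ := SplitModel.exists_affineOpen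
      (CoordinateSpace.SplitPoint.pointMap (Φ ≪≫ Ψ)) D.isUnit_two_integers D.not_isUnit_unif
      (by omega) hs (by omega)
    refine ⟨SplitModel.not_flat_of_affineOpen D.unif_ne_zero hU ⟨x, hx⟩ h, U, hU,
      ⟨x, hx, h x hx⟩, fun y hy hbot => D.unif_ne_zero ?_⟩
    have h1 := h y hy
    rw [hbot] at h1
    exact h1
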